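/- Let $d\in\{2,3\}$, $\mathrm{Re}\ge 0$, $\mathrm{Wi}>0$, $0<\varepsilon<1$, and let $\mathcal{T}_h=\{K_1,\dots,K_{N_K}\}$ be a conformal simplicial mesh of an open bounded polyhedral domain $\mathcal{D}\subset\mathbb{R}^d$. Denote by $V$ the space $(\mathbb{P}_2)^d$ of continuous vector fields on $\overline{\mathcal D}$ which are polynomial of degree at most $2$ on each $K_k$ and vanish on $\partial\mathcal{D}$, by $\mathbb{P}_{1,disc}$ the space of piecewise affine, possibly discontinuous, functions, and by $S$ the space $(\mathbb{P}_0)^{d(d+1)/2}$ of piecewise constant fields of symmetric $d\times d$ matrices. Write $A:B=\operatorname{tr}(AB^T)$ and $(\nabla u)_{ij}=\partial_j u_i$. For $u\in V$ and $\psi\in S$, let $\nabla u=\Omega+B+Ne^{-\psi}$ be a pointwise decomposition on each element with $\Omega,B,N$ piecewise affine, $\Omega,N$ antisymmetric, and $B$ symmetric and commuting with $e^{\psi}$. Given a time step $\Delta t>0$ and $(u^n,\psi^n)$, consider the two following schemes, in which $t^n=n\Delta t$: $(u^{n+1},\psi^{n+1})\in V\times S$ is a solution if for some $p^{n+1}\in\mathbb{P}_{1,disc}$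 one has, for all $(v,q,\phi)\in V\times\mathbb{P}_{1,disc}\times S$, $$0=\int_{\mathcal D}\Big[\mathrm{Re}\Big(\frac{u^{n+1}-u^n}{\Delta t}+u^n\cdot\nabla u^{n+1}\Big)\cdot v-p^{n+1}\operatorname{div}v+q\operatorname{div}u^{n+1}+(1-\varepsilon)\nabla u^{n+1}:\nabla v+\frac{\varepsilon}{\mathrm{Wi}}e^{\psi^{n+1}}:\nabla v$$ $$\qquad-(\Omega^{n+1}\psi^{n+1}-\psi^{n+1}\Omega^{n+1}):\phi-2B^{n+1}:\phi-\frac1{\mathrm{Wi}}(e^{-\psi^{n+1}}-I):\phi\Big]+\mathcal{A}(\phi),$$ where $\Omega^{n+1},B^{n+1}$ come from a decomposition of $\nabla u^{n+1}$ associated with $\psi^{n+1}$, and * (characteristic scheme) $\mathcal{A}(\phi)=\int_{\mathcal D}\frac{\psi^{n+1}-\psi^n\circ X^n(t^n)}{\Delta t}:\phi$, where $X^n$ is the backward flow of $u^n$: $\frac{d}{dt}X^n(t,x)=u^n(X^n(t,x))$ for $t\in[t^n,t^{n+1}]$ and $X^n(t^{n+1},x)=x$; * (discontinuous Galerkin scheme)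 $\mathcal{A}(\phi)=\int_{\mathcal D}\frac{\psi^{n+1}-\psi^n}{\Delta t}:\phi+\sum_{j}\int_{E_j}|u^n\cdot \boldsymbol{n}|\,(\psi^{n+1,+}-\psi^{n+1,-}):\phi^+$, where the $E_j$ are the internal edges (faces if $d=3$) of the mesh with unit normal $\boldsymbol{n}$, and $\phi^{\pm}(x)=\lim_{\delta\to0^{\pm}}\phi(x+\delta u^n(x))$ are the downstream and upstream values. Then, for each of the two schemes and for any initial condition $(u^0,\psi^0)\in V\times S$, there is a constant $c_1>0$ depending only on $(u^0,\psi^0)$ (and on the fixed mesh and parameters $\mathrm{Re},\mathrm{Wi},\varepsilon$) such that, for every time step $0<\Delta t<c_1$, there exists a sequence $(u^n,\psi^n)_{n\in\mathbb{N}}$ in $V\times S$ starting from $(u^0,\psi^0)$ such that, for all $n\in\mathbb{N}$, $(u^{n+1},\psi^{n+1})$ is the unique solution in $V\times S$ of the scheme with data $(u^n,\psi^n)$. -/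

import Mathlib

open MeasureTheory Set

noncomputable section

namespace OldroydLog

/-- The Euclidean space `ℝ^d`. -/
abbrev E (d : ℕ) := EuclideanSpace ℝ (Fin d)

/-- Real `d × d` matrices. -/
abbrev Mat (d : ℕ) := Matrix (Fin d) (Fin d) ℝ

/-- Double contraction `A : B = tr (A Bᵀ)`. -/
def ddot {d : ℕ} (A B : Mat d) : ℝ := (A * B.transpose).trace

/-- Velocity gradient, `(∇u)_{ij} = ∂u_i / ∂x_j`. -/
def grad {d : ℕ} (u : E d → E d) (x : E d) : Mat d :=
  Matrix.of fun i j => (fderiv ℝ u x (EuclideanSpace.single j 1)) i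

/-- Divergence. -/
def divg {d : ℕ} (u : E d → E d) (x : E d) : ℝ := (grad u x).trace

/-- The convective derivative `(w · ∇) u`. -/
def convect {d : ℕ} (w u : E d → E d) (x : E d) : E d := fderiv ℝ u x (w x)

/-- `G = Ω + B + N e^{-ψ}` with `Ω`, `N` antisymmetric and `B` symmetric commuting with `e^ψ`. -/
def IsDecomposition {d : ℕ} (G ψ Ω B N : Mat d) : Prop :=
  G = Ω + B + N * NormedSpace.exp (-ψ) ∧
    Ω.transpose = -Ω ∧ N.transpose = -N ∧ B.transpose = B ∧ Commute B (NormedSpace.exp ψ)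

/-- A conformal simplicial mesh in `ℝ^d`: finitely many nondegenerate `d`-simplices, with distinct
vertex sets, any two of which meet in the convex hull of their common vertices (a common face, or
the empty set). -/
structure Mesh (d : ℕ) where
  /-- number of elements -/
  N : ℕ
  /-- the elements -/
  cell : Fin N → Affine.Simplex ℝ (E d) d
  distinct : ∀ k l, k ≠ l → range (cell k).points ≠ range (cell l).points
  conformal : ∀ k l, convexHull ℝ (range (cell k).points) ∩ convexHull ℝ (range (cell l).points) =
    convexHull ℝ (range (cell k).points ∩ range (cell l).points)

namespace Mesh

variable {d : ℕ} (M : Mesh d)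

/-- The closed element `K_k`. -/
def elem (k : Fin M.N) : Set (E d) := convexHull ℝ (range (M.cell k).points)

/-- The open bounded polyhedral set `𝒟` tessellated by the mesh. -/
def domain : Set (E d) := interior (⋃ k, M.elem k)

/-- The field on `ℝ^d` equal to `f k` in the interior of `K_k` for each `k`, and to `0` elsewhere
(the union of the boundaries of the elements is a null set). -/
def cellwise {α : Type*} [AddCommMonoid α] (f : Fin M.N → E d → α) (x : E d) : α :=
  ∑ k, (interior (M.elem k)).indicator (f k) x

/-- The velocity space `(ℙ₂)^d` with no-slip boundary condition: continuous fields, polynomial of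
degree at most `2` in every element and zero on `∂𝒟`. Fields are extended by zero outside `𝒟`. -/
def velocitySpace : Set (E d → E d) :=
  {u | Continuous u ∧ (∀ x, x ∉ M.domain → u x = 0) ∧
    ∀ k i, ∃ P : MvPolynomial (Fin d) ℝ, P.totalDegree ≤ 2 ∧
      ∀ x ∈ M.elem k, u x i = MvPolynomial.eval (fun j => x j) P}

/-- `ℙ_{1,disc}` with values in a vector space `W`: one affine map per element. -/
abbrev P1disc (W : Type*) [AddCommGroup W] [Module ℝ W] := Fin M.N → (E d →ᵃ[ℝ] W)

/-- The field associated with an element of `ℙ_{1,disc}`. -/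
def p1 {W : Type*} [AddCommGroup W] [Module ℝ W] (p : M.P1disc W) : E d → W :=
  M.cellwise fun k => ⇑(p k)

/-- The space `(ℙ₀)^{d(d+1)/2}` of symmetric-matrix-valued piecewise constants: one symmetric
matrix per element. -/
def stressSpace : Set (Fin M.N → Mat d) := {ψ | ∀ k, (ψ k).IsSymm}

/-- The field associated with a piecewise constant. -/
def p0 (ψ : Fin M.N → Mat d) : E d → Mat d := M.cellwise fun k _ => ψ k

/-- Pairs (velocity, log-conformation tensor). -/
abbrev State := (E d → E d) × (Fin M.N → Mat d)

/-- The discrete space for pairs (velocity, log-conformation tensor). -/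
def stateSpace : Set M.State := M.velocitySpace ×ˢ M.stressSpace

/-- The facet of `K_k` opposite to its `i`-th vertex. -/
def facet (k : Fin M.N) (i : Fin (d + 1)) : Set (E d) := convexHull ℝ ((M.cell k).points '' {i}ᶜ)

/-- The unit normal to the facet of `K_k` opposite to its `i`-th vertex, pointing out of `K_k`. -/
def normal [NeZero d] (k : Fin M.N) (i : Fin (d + 1)) : E d :=
  ((M.cell k).height i)⁻¹ • ((M.cell k).altitudeFoot i -ᵥ (M.cell k).points i)

open scoped Classical in
/-- The internal edges (faces when `d = 3`), each listed once: `(k, i, l)` with `k < l` stands for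
the facet of `K_k` opposite to its `i`-th vertex when `K_l` is the element on its other side. -/
def internalEdges : Finset (Fin M.N × Fin (d + 1) × Fin M.N) :=
  Finset.univ.filter fun e => e.1 < e.2.2 ∧
    (M.cell e.1).points '' {e.2.1}ᶜ ⊆ range (M.cell e.2.2).points

/-- Downstream value, for the velocity vector `w`, of the piecewise constant `φ` on the edge between
`K_k` and `K_l`, where `n` is normal to the edge and points from `K_k` to `K_l`; this is
`lim_{δ → 0+} φ (x + δ w)` at interior points `x` of the edge when `w · n ≠ 0`. -/
def downstream (φ : Fin M.N → Mat d) (k l : Fin M.N) (n w : E d) : Mat d :=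
  if 0 ≤ inner ℝ w n then φ l else φ k

/-- Upstream value: as `downstream`, with `δ → 0-`. -/
def upstream (φ : Fin M.N → Mat d) (k l : Fin M.N) (n w : E d) : Mat d :=
  if 0 ≤ inner ℝ w n then φ k else φ l

/-- The jump term `∑_j ∫_{E_j} |u · n| ⟦ψ⟧ : φ⁺`, integrated with respect to the
`(d-1)`-dimensional surface measure. -/
def jumpTerm [NeZero d] (u : E d → E d) (ψ φ : Fin M.N → Mat d) : ℝ :=
  ∑ e ∈ M.internalEdges,
    ∫ x in M.facet e.1 e.2.1,
      |inner ℝ (u x) (M.normal e.1 e.2.1)| *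
        ddot (M.downstream ψ e.1 e.2.2 (M.normal e.1 e.2.1) (u x) -
            M.upstream ψ e.1 e.2.2 (M.normal e.1 e.2.1) (u x))
          (M.downstream φ e.1 e.2.2 (M.normal e.1 e.2.1) (u x)) ∂(μHE[d - 1])

/-- `X` is the backward flow in `𝒟` of the velocity field `u` on `[t₀, t₁]`:
`dX/dt (t, x) = u (X (t, x))` and `X (t₁, x) = x`. -/
def IsBackwardFlow (u : E d → E d) (t₀ t₁ : ℝ) (X : ℝ → E d → E d) : Prop :=
  ∀ x ∈ M.domain, X t₁ x = x ∧ ∀ t ∈ Icc t₀ t₁, X t x ∈ M.domain ∧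
    HasDerivWithinAt (fun s => X s x) (u (X t x)) (Icc t₀ t₁) t

/-- `Ω`, `B`, `N` are fields in `ℙ_{1,disc}` which decompose `∇u` pointwise in every element. -/
def IsDiscreteDecomposition (u : E d → E d) (ψ : Fin M.N → Mat d)
    (Ω B N : M.P1disc (Mat d)) : Prop :=
  ∀ k, ∀ x ∈ interior (M.elem k), IsDecomposition (grad u x) (ψ k) (Ω k x) (B k x) (N k x)

/-- The part of the integrand which is common to both schemes (all terms except for those which
discretize the material derivative of `ψ`). Here `u` is the old velocity, `u'`, `p'`, `ψ'` are the
new fields, `Ω`, `B` come from the decomposition of `∇u'`, and `v`, `q`, `φ` are test functions. -/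
def integrand (Re Wi ε Δt : ℝ) (u u' : E d → E d) (p' : M.P1disc ℝ) (ψ' : Fin M.N → Mat d)
    (Ω B : M.P1disc (Mat d)) (v : E d → E d) (q : M.P1disc ℝ) (φ : Fin M.N → Mat d)
    (x : E d) : ℝ :=
  Re * inner ℝ (Δt⁻¹ • (u' x - u x) + convect u u' x) (v x)
    - M.p1 p' x * divg v x + M.p1 q x * divg u' x
    + (1 - ε) * ddot (grad u' x) (grad v x)
    + ε / Wi * ddot (NormedSpace.exp (M.p0 ψ' x)) (grad v x)
    - ddot (M.p1 Ω x * M.p0 ψ' x - M.p0 ψ' x * M.p1 Ω x) (M.p0 φ x)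
    - 2 * ddot (M.p1 B x) (M.p0 φ x)
    - 1 / Wi * ddot (NormedSpace.exp (-(M.p0 ψ' x)) - 1) (M.p0 φ x)

/-- One step, from `t^n = n Δt` to `t^{n+1}`, of the log-formulation scheme with the characteristic
method: `Y' = (u^{n+1}, ψ^{n+1})` is, for some pressure `p^{n+1}`, a solution of the scheme with
data `Y = (u^n, ψ^n)`. -/
def CharacStep (Re Wi ε Δt : ℝ) (n : ℕ) (Y Y' : M.State) : Prop :=
  Y' ∈ M.stateSpace ∧
  ∃ (p' : M.P1disc ℝ) (Ω B N : M.P1disc (Mat d)) (X : ℝ → E d → E d),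
    M.IsDiscreteDecomposition Y'.1 Y'.2 Ω B N ∧
    M.IsBackwardFlow Y.1 (n * Δt) ((n + 1) * Δt) X ∧
    ∀ v ∈ M.velocitySpace, ∀ q : M.P1disc ℝ, ∀ φ ∈ M.stressSpace,
      0 = ∫ x in M.domain,
        (M.integrand Re Wi ε Δt Y.1 Y'.1 p' Y'.2 Ω B v q φ x
          + ddot (Δt⁻¹ • (M.p0 Y'.2 x - M.p0 Y.2 (X (n * Δt) x))) (M.p0 φ x))

/-- One step of the log-formulation scheme with the discontinuous Galerkin method:
`Y' = (u^{n+1}, ψ^{n+1})` is, for some pressure `p^{n+1}`, a solution of the scheme with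
data `Y = (u^n, ψ^n)`. -/
def DGStep [NeZero d] (Re Wi ε Δt : ℝ) (Y Y' : M.State) : Prop :=
  Y' ∈ M.stateSpace ∧
  ∃ (p' : M.P1disc ℝ) (Ω B N : M.P1disc (Mat d)),
    M.IsDiscreteDecomposition Y'.1 Y'.2 Ω B N ∧
    ∀ v ∈ M.velocitySpace, ∀ q : M.P1disc ℝ, ∀ φ ∈ M.stressSpace,
      0 = (∑ k, ∫ x in M.elem k,
        (M.integrand Re Wi ε Δt Y.1 Y'.1 p' Y'.2 Ω B v q φ x
          + ddot (Δt⁻¹ • (M.p0 Y'.2 x - M.p0 Y.2 x)) (M.p0 φ x)))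
        + M.jumpTerm Y.1 Y'.2 φ

end Mesh

end OldroydLog

end

noncomputable section
namespace OldroydLog
open scoped Matrix.Norms.Frobenius
open NormedSpace (exp)

/-! ### The Frobenius product of matrices -/

section Ddot
variable {d : ℕ}

/-! The scheme has a free energy, the kinetic energy plus a multiple of `∫ tr (e^ψ - ψ - I)`. It
does not increase along solutions with solenoidal velocities. Hence every solution, at every step,
lies in one ball fixed by the initial data. In that ball a step is a fixed-point problem which is a
contraction for small `Δt`. The same threshold serves for all steps, and uniqueness in the ball is
uniqueness outright because no solution can lie outside it.

The log-formulation. The differential `dexp ψ` of the exponential sends `Ωψ - ψΩ + 2B` to `G e^ψ +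
e^ψ Gᵀ`, with `G` the velocity gradient; at symmetric `ψ` it is invertible. So the term is a
function `stretch ψ G`, independent of the decomposition, linear in `G` and locally Lipschitz in `ψ`
(`stretch_eq`, `exists_stretch_bound`). A decomposition always exists and can be chosen linear in
`G` (`exists_linear_decomposition`), which keeps `Ω`, `B`, `N` piecewise affine.

The energy. The momentum equation is tested with the new velocity and the stress equation with `e^ψ
- I`, weighted by `ε / (2 Wi)`. The elastic terms cancel (`ddot_stretch_exp`), relaxation dissipates
(`ddot_relaxation_nonpos`), and Klein's inequality `entropy_sub_le` turns transport of `ψ` into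
transport of entropy.

The transport. Both schemes fit one abstract pattern, `Transport`: nonnegative weights of old values
and nonnegative upwind fluxes. For solenoidal velocities the weights have controlled column sums and
the fluxes balance, which is what keeps entropy from being created. For characteristics the weights
are volumes of pieces of elements, and the column bound is Liouville's theorem
(`volume_preimage_flow_le`). For the Galerkin scheme the balance is the divergence theorem in a
simplex (`sum_facet_integral`) together with conformity of the mesh (`sum_exchange`).

The constraint. The divergence of a velocity is itself an admissible pressure, so discretely
solenoidal velocities are pointwise solenoidal in the elements (`divg_eq_zero`); thus convection
does no work (`conv_self`). The pressure is removed and recovered by duality in finite dimension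
(`exists_pressure`).

The initial velocity need not be solenoidal, so the first step is treated apart: for small `Δt` the
defects of convection and transport are absorbed (`exists_energy_bound`). All later velocities are
solenoidal, and `exists_sequence` combines the estimates. -/

lemma ddot_eq_sum (A B : Mat d) : ddot A B = ∑ i, ∑ j, A i j * B i j := by
  simp [ddot, Matrix.trace, Matrix.mul_apply]

lemma ddot_comm (A B : Mat d) : ddot A B = ddot B A := by
  simp [ddot_eq_sum, mul_comm]

lemma ddot_add_left (A B C : Mat d) : ddot (A + B) C = ddot A C + ddot B C := by
  simp [ddot, add_mul]

lemma ddot_smul_left (c : ℝ) (A B : Mat d) : ddot (c • A) B = c * ddot A B := by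
  simp [ddot]

/-- The double contraction as a bilinear map. -/
def ddotₗ : Mat d →ₗ[ℝ] Mat d →ₗ[ℝ] ℝ :=
  LinearMap.mk₂ ℝ ddot ddot_add_left ddot_smul_left
    (fun A B C => by rw [ddot_comm, ddot_add_left, ddot_comm B, ddot_comm C])
    (fun c A B => by rw [ddot_comm, ddot_smul_left, ddot_comm B, smul_eq_mul])

lemma ddotₗ_apply (A B : Mat d) : ddotₗ A B = ddot A B := rfl

lemma ddot_add_right (A B C : Mat d) : ddot A (B + C) = ddot A B + ddot A C :=
  (ddotₗ A).map_add B C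

lemma ddot_smul_right (c : ℝ) (A B : Mat d) : ddot A (c • B) = c * ddot A B :=
  (ddotₗ A).map_smul c B

lemma ddot_sub_left (A B C : Mat d) : ddot (A - B) C = ddot A C - ddot B C :=
  (ddotₗ.flip C).map_sub A B

lemma ddot_sub_right (A B C : Mat d) : ddot A (B - C) = ddot A B - ddot A C :=
  (ddotₗ A).map_sub B C

lemma ddot_neg_left (A B : Mat d) : ddot (-A) B = -ddot A B :=
  (ddotₗ.flip B).map_neg A

@[simp] lemma ddot_zero_left (A : Mat d) : ddot 0 A = 0 := by simp [ddot]

@[simp] lemma ddot_zero_right (A : Mat d) : ddot A 0 = 0 := by simp [ddot]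

lemma ddot_sum_left {ι : Type*} (s : Finset ι) (f : ι → Mat d) (B : Mat d) :
    ddot (∑ i ∈ s, f i) B = ∑ i ∈ s, ddot (f i) B :=
  map_sum (ddotₗ.flip B) f s

lemma ddot_transpose (A B : Mat d) : ddot A.transpose B.transpose = ddot A B := by
  rw [ddot_eq_sum, ddot_eq_sum, Finset.sum_comm]; rfl

lemma ddot_self (A : Mat d) : ddot A A = ‖A‖ ^ 2 := by
  rw [Matrix.frobenius_norm_def, ddot_eq_sum, ← Real.sqrt_eq_rpow, Real.sq_sqrt (by positivity)]
  simp [pow_two]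

lemma abs_ddot_le (A B : Mat d) : |ddot A B| ≤ ‖A‖ * ‖B‖ := by
  apply abs_le_of_sq_le_sq _ (by positivity)
  rw [mul_pow, ← ddot_self, ← ddot_self, ddot_eq_sum, ddot_eq_sum, ddot_eq_sum]
  simp only [← Finset.sum_product', Finset.univ_product_univ]
  refine (Finset.sum_mul_sq_le_sq_mul_sq _ _ _).trans_eq ?_
  simp [pow_two]

lemma ddot_le (A B : Mat d) : ddot A B ≤ ‖A‖ * ‖B‖ := (le_abs_self _).trans (abs_ddot_le A B)

lemma eq_zero_of_ddot_self {A : Mat d} (h : ddot A A = 0) : A = 0 := by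
  rw [ddot_self] at h; simpa using h

lemma ddot_mul_left (A B C : Mat d) : ddot (A * B) C = ddot B (A.transpose * C) := by
  simp only [ddot, Matrix.transpose_mul, Matrix.transpose_transpose]
  rw [Matrix.mul_assoc, Matrix.trace_mul_comm, ← Matrix.mul_assoc]

lemma ddot_mul_right (A B C : Mat d) : ddot (A * B) C = ddot A (C * B.transpose) := by
  simp only [ddot, Matrix.transpose_mul, Matrix.transpose_transpose]
  rw [Matrix.mul_assoc]

lemma ddot_one_right (A : Mat d) : ddot A 1 = A.trace := by simp [ddot]

end Ddot

/-! ### The matrix exponential and its differential at symmetric matrices -/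

section Exp
variable {d : ℕ}

lemma continuous_exp_mat : Continuous (exp : Mat d → Mat d) := NormedSpace.exp_continuous

lemma exp_mul_exp_neg (A : Mat d) : exp A * exp (-A) = 1 := by
  rw [← Matrix.exp_add_of_commute _ _ (Commute.neg_right (Commute.refl A)), add_neg_cancel,
    NormedSpace.exp_zero]

lemma exp_neg_mul_exp (A : Mat d) : exp (-A) * exp A = 1 := by
  simpa using exp_mul_exp_neg (-A)

lemma exp_symm {ψ : Mat d} (h : ψ.IsSymm) : (exp ψ).transpose = exp ψ := by
  rw [← Matrix.exp_transpose, h.eq]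

/-- The matrix exponential is bounded on bounded sets. -/
lemma exists_exp_bound (d : ℕ) (R : ℝ) :
    ∃ C : ℝ, 1 ≤ C ∧ ∀ A : Mat d, ‖A‖ ≤ R → ‖exp A‖ ≤ C := by
  obtain ⟨C, hC⟩ := (isCompact_closedBall (0 : Mat d) R).exists_bound_of_continuousOn
    continuous_exp_mat.continuousOn
  exact ⟨max 1 C, le_max_left _ _, fun A hA => (hC A (by simpa using hA)).trans (le_max_right _ _)⟩

/-- The integrand of Duhamel's formula. -/
lemma continuous_duhamel (A B X : Mat d) :
    Continuous fun s : ℝ => exp (s • A) * X * exp ((1 - s) • B) := by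
  have := continuous_exp_mat (d := d)
  fun_prop

lemma hasDerivAt_duhamel (A B X : Mat d) (t : ℝ) :
    HasDerivAt (fun s : ℝ => exp (s • A) * X * exp ((1 - s) • B))
      (exp (t • A) * (A * X - X * B) * exp ((1 - t) • B)) t := by
  have h1 : HasDerivAt (fun s : ℝ => exp (s • A)) (exp (t • A) * A) t :=
    hasDerivAt_exp_smul_const A t
  have h2 : HasDerivAt (fun s : ℝ => exp (s • B)) (B * exp ((1 - t) • B)) (1 - t) :=
    hasDerivAt_exp_smul_const' B (1 - t)
  have h3 : HasDerivAt (fun s : ℝ => exp ((1 - s) • B)) (-(B * exp ((1 - t) • B))) t := by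
    have h4 := HasDerivAt.scomp t h2 ((hasDerivAt_id t).const_sub 1)
    rw [neg_one_smul] at h4
    exact h4
  refine ((h1.mul_const X).mul h3).congr_deriv ?_
  simp only [mul_sub, sub_mul, mul_neg, mul_assoc]
  abel

/-- The fundamental theorem of calculus for `s ↦ e^{sA} X e^{(1-s)B}`. A general `X` is kept for two
uses: `X = 1` gives the Lipschitz bound of the exponential, and `A = B = ψ` gives the commutator
formula for the differential. -/
lemma integral_duhamel (A B X : Mat d) :
    ∫ s in (0 : ℝ)..1, exp (s • A) * (A * X - X * B) * exp ((1 - s) • B)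
      = exp A * X - X * exp B := by
  rw [intervalIntegral.integral_eq_sub_of_hasDerivAt (fun t _ => hasDerivAt_duhamel A B X t)
    ((continuous_duhamel A B _).intervalIntegrable _ _)]
  simp [NormedSpace.exp_zero]

/-- Bound on Duhamel integrals. -/
lemma norm_integral_duhamel_le {R C : ℝ} (hC : ∀ A : Mat d, ‖A‖ ≤ R → ‖exp A‖ ≤ C)
    {A B : Mat d} (hA : ‖A‖ ≤ R) (hB : ‖B‖ ≤ R) (X : Mat d) :
    ‖∫ s in (0 : ℝ)..1, exp (s • A) * X * exp ((1 - s) • B)‖ ≤ C ^ 2 * ‖X‖ := by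
  have hR : 0 ≤ R := (norm_nonneg _).trans hA
  have key : ∀ {s : ℝ} (D : Mat d), 0 ≤ s → s ≤ 1 → ‖D‖ ≤ R → ‖exp (s • D)‖ ≤ C := by
    intro s D h0 h1 hD
    refine hC _ ?_
    rw [norm_smul, Real.norm_of_nonneg h0]
    nlinarith [norm_nonneg D]
  have hC0 : 0 ≤ C := (norm_nonneg _).trans (hC A hA)
  have := intervalIntegral.norm_integral_le_of_norm_le_const (a := 0) (b := 1)
    (f := fun s : ℝ => exp (s • A) * X * exp ((1 - s) • B)) (C := C ^ 2 * ‖X‖) ?_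
  · simpa using this
  · intro s hs
    rw [uIoc_of_le zero_le_one] at hs
    calc _ ≤ ‖exp (s • A)‖ * ‖X‖ * ‖exp ((1 - s) • B)‖ :=
          (norm_mul_le _ _).trans (by gcongr; exact norm_mul_le _ _)
      _ ≤ C * ‖X‖ * C := by
          gcongr
          · exact key A hs.1.le hs.2 hA
          · exact key B (by linarith [hs.2]) (by linarith [hs.1]) hB
      _ = _ := by ring

/-- The matrix exponential is Lipschitz on bounded sets. -/
lemma norm_exp_sub_le {R C : ℝ} (hC : ∀ A : Mat d, ‖A‖ ≤ R → ‖exp A‖ ≤ C)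
    {A B : Mat d} (hA : ‖A‖ ≤ R) (hB : ‖B‖ ≤ R) : ‖exp A - exp B‖ ≤ C ^ 2 * ‖A - B‖ := by
  have := norm_integral_duhamel_le hC hA hB (A - B)
  have h2 := integral_duhamel A B 1
  simp only [mul_one, one_mul] at h2
  rwa [h2] at this

/-- The differential of the matrix exponential at `ψ`. -/
def dexp (ψ : Mat d) : Mat d →ₗ[ℝ] Mat d where
  toFun X := ∫ s in (0 : ℝ)..1, exp (s • ψ) * X * exp ((1 - s) • ψ)
  map_add' X Y := by
    rw [← intervalIntegral.integral_add ((continuous_duhamel _ _ _).intervalIntegrable _ _)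
      ((continuous_duhamel _ _ _).intervalIntegrable _ _)]
    simp [mul_add, add_mul]
  map_smul' c X := by
    rw [RingHom.id_apply, ← intervalIntegral.integral_smul]
    simp

lemma dexp_apply (ψ X : Mat d) :
    dexp ψ X = ∫ s in (0 : ℝ)..1, exp (s • ψ) * X * exp ((1 - s) • ψ) := rfl

/-- Passing a linear map under the integral lets traces, transposes and quadratic forms of `dexp` be
read off the integrand. -/
lemma linear_dexp {F : Type*} [NormedAddCommGroup F] [NormedSpace ℝ F] [CompleteSpace F]
    (l : Mat d →ₗ[ℝ] F)
    (ψ X : Mat d) :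
    l (dexp ψ X) = ∫ s in (0 : ℝ)..1, l (exp (s • ψ) * X * exp ((1 - s) • ψ)) := by
  have h := l.toContinuousLinearMap.intervalIntegral_comp_comm
    ((continuous_duhamel ψ ψ X).intervalIntegrable (μ := volume) 0 1)
  rw [dexp_apply]
  exact h.symm

/-- Infinitesimal rotations act on `ψ` and on `e^ψ` by commutators, and `dexp` intertwines the two
actions. -/
lemma dexp_commutator (ψ X : Mat d) : dexp ψ (X * ψ - ψ * X) = X * exp ψ - exp ψ * X := by
  have h := integral_duhamel ψ ψ X
  rw [← neg_sub, ← neg_sub (exp ψ * X), ← h, map_neg, dexp_apply]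

lemma dexp_of_commute {ψ X : Mat d} (h : Commute X ψ) : dexp ψ X = X * exp ψ := by
  rw [dexp_apply]
  have : ∀ s : ℝ, exp (s • ψ) * X * exp ((1 - s) • ψ) = X * exp ψ := by
    intro s
    have h1 : Commute X (exp (s • ψ)) := (h.smul_right s).exp_right
    rw [← h1.eq, mul_assoc, ← Matrix.exp_add_of_commute]
    · rw [← add_smul, add_sub_cancel, one_smul]
    · exact ((Commute.refl ψ).smul_left _).smul_right _
  simp [this]

/-- By cyclicity of the trace the two exponentials of the integrand merge into `e^ψ`, whatever `s`
is. This evaluates the stress equation tested with `e^ψ`. -/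
lemma trace_dexp (ψ X : Mat d) : (dexp ψ X).trace = (X * exp ψ).trace := by
  have h := linear_dexp (Matrix.traceLinearMap (Fin d) ℝ ℝ) ψ X
  simp only [Matrix.traceLinearMap_apply] at h
  rw [h]
  have : ∀ s : ℝ, (exp (s • ψ) * X * exp ((1 - s) • ψ)).trace = (X * exp ψ).trace := by
    intro s
    rw [mul_assoc, Matrix.trace_mul_comm, mul_assoc, ← Matrix.exp_add_of_commute]
    · rw [← add_smul, sub_add_cancel, one_smul]
    · exact ((Commute.refl ψ).smul_left _).smul_right _
  simp [this]

/-- The same cyclicity; here the exponentials cancel altogether, which serves for the test matrix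
`I`. -/
lemma trace_dexp_mul_exp_neg (ψ X : Mat d) : (dexp ψ X * exp (-ψ)).trace = X.trace := by
  have h := linear_dexp
    ((Matrix.traceLinearMap (Fin d) ℝ ℝ) ∘ₗ LinearMap.mulRight ℝ (exp (-ψ))) ψ X
  simp only [LinearMap.comp_apply, LinearMap.mulRight_apply, Matrix.traceLinearMap_apply] at h
  rw [h]
  have : ∀ s : ℝ, (exp (s • ψ) * X * exp ((1 - s) • ψ) * exp (-ψ)).trace = X.trace := by
    intro s
    rw [mul_assoc, ← Matrix.exp_add_of_commute, mul_assoc, Matrix.trace_mul_comm, mul_assoc,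
      ← Matrix.exp_add_of_commute]
    · have : (1 - s) • ψ + -ψ + s • ψ = 0 := by module
      rw [this, NormedSpace.exp_zero, mul_one]
    · exact ((((Commute.refl ψ).smul_left _).add_left ((Commute.refl ψ).neg_left))).smul_right _
    · exact ((Commute.refl ψ).smul_left _).neg_right
  simp [this]

/-- Transposition exchanges the two exponentials, and the substitution `s ↦ 1 - s` exchanges them
back. -/
lemma transpose_dexp {ψ : Mat d} (hψ : ψ.IsSymm) (X : Mat d) :
    (dexp ψ X).transpose = dexp ψ X.transpose := by
  have h := linear_dexp (Matrix.transposeLinearEquiv (Fin d) (Fin d) ℝ ℝ).toLinearMap ψ X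
  simp only [LinearEquiv.coe_coe, Matrix.transposeLinearEquiv_apply] at h
  change (dexp ψ X).transpose = ∫ s in (0 : ℝ)..1, (exp (s • ψ) * X * exp ((1 - s) • ψ)).transpose at h
  rw [h, dexp_apply]
  have e : ∀ s : ℝ, (exp (s • ψ)).transpose = exp (s • ψ) := fun s => exp_symm (hψ.smul s)
  simp_rw [Matrix.transpose_mul, e]
  have := intervalIntegral.integral_comp_sub_left
    (f := fun s : ℝ => exp (s • ψ) * X.transpose * exp ((1 - s) • ψ)) (a := 0) (b := 1) 1
  simp only [sub_sub_cancel, sub_self, sub_zero] at this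
  rw [← this]
  simp only [mul_assoc]

/-- Coercivity of the differential of the exponential at symmetric matrices. -/
lemma dexp_coercive {R C : ℝ} (hC1 : 1 ≤ C) (hC : ∀ A : Mat d, ‖A‖ ≤ R → ‖exp A‖ ≤ C)
    {ψ : Mat d} (hψ : ψ.IsSymm) (hR : ‖ψ‖ ≤ R) (X : Mat d) :
    ‖X‖ ^ 2 ≤ C ^ 4 * ddot (dexp ψ X) X := by
  have h := linear_dexp (ddotₗ.flip X) ψ X
  simp only [LinearMap.flip_apply, ddotₗ_apply] at h
  have half : ∀ s : ℝ, exp (s • ψ) = exp ((s / 2) • ψ) * exp ((s / 2) • ψ) := by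
    intro s
    rw [← Matrix.exp_add_of_commute _ _ (Commute.refl _), ← add_smul]; congr 2; ring
  have e : ∀ s : ℝ, (exp (s • ψ)).transpose = exp (s • ψ) := fun s => exp_symm (hψ.smul s)
  -- With the square roots `P = e^{sψ/2}` and `Q = e^{(1-s)ψ/2}`, which are symmetric, the integrand
  -- paired with `X` is `‖P X Q‖²`. Then `X` is recovered by multiplying with `P⁻¹` and `Q⁻¹`, each
  -- of norm at most `C`; squaring gives `C ^ 4`.
  have key : ∀ s ∈ Icc (0 : ℝ) 1, ‖X‖ ^ 2 ≤ C ^ 4 * ddot (exp (s • ψ) * X * exp ((1 - s) • ψ)) X := by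
    intro s hs
    set P := exp ((s / 2) • ψ)
    set Q := exp (((1 - s) / 2) • ψ)
    have h1 : ddot (exp (s • ψ) * X * exp ((1 - s) • ψ)) X = ‖P * X * Q‖ ^ 2 := by
      rw [half s, half (1 - s), ← ddot_self]
      rw [mul_assoc, mul_assoc, ddot_mul_left, e]
      rw [← mul_assoc, ← mul_assoc, ddot_mul_right, e]
    have hn : ∀ t : ℝ, 0 ≤ t → t ≤ 1 → ‖exp (-(t • ψ))‖ ≤ C := by
      intro t h0 h1
      refine hC _ ?_
      rw [norm_neg, norm_smul, Real.norm_of_nonneg h0]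
      nlinarith [norm_nonneg ψ]
    have hX : X = exp (-((s / 2) • ψ)) * (P * X * Q) * exp (-(((1 - s) / 2) • ψ)) := by
      have h2 : exp (-((s / 2) • ψ)) * P = 1 := exp_neg_mul_exp _
      have h3 : Q * exp (-(((1 - s) / 2) • ψ)) = 1 := exp_mul_exp_neg _
      calc X = 1 * X * 1 := by simp
        _ = (exp (-((s / 2) • ψ)) * P) * X * (Q * exp (-(((1 - s) / 2) • ψ))) := by rw [h2, h3]
        _ = _ := by simp only [mul_assoc]
    have h4 : ‖X‖ ≤ C * ‖P * X * Q‖ * C := by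
      conv_lhs => rw [hX]
      refine (norm_mul_le _ _).trans ?_
      gcongr
      · refine (norm_mul_le _ _).trans ?_
        gcongr
        exact hn _ (by linarith [hs.1]) (by linarith [hs.2])
      · exact hn _ (by linarith [hs.2]) (by linarith [hs.1])
    rw [h1]
    calc ‖X‖ ^ 2 ≤ (C * ‖P * X * Q‖ * C) ^ 2 := by gcongr
      _ = _ := by ring
  rw [h, ← intervalIntegral.integral_const_mul]
  calc ‖X‖ ^ 2 = ∫ _ in (0 : ℝ)..1, ‖X‖ ^ 2 := by simp
    _ ≤ _ := by
      refine intervalIntegral.integral_mono_on zero_le_one (by simp) ?_ key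
      apply Continuous.intervalIntegrable
      have h5 := (ddotₗ.flip X).continuous_of_finiteDimensional.comp (continuous_duhamel ψ ψ X)
      exact continuous_const.mul h5

lemma dexp_injective {ψ : Mat d} (hψ : ψ.IsSymm) : Function.Injective (dexp ψ) := by
  rw [injective_iff_map_eq_zero]
  intro X hX
  obtain ⟨C, hC1, hC⟩ := exists_exp_bound d ‖ψ‖
  have := dexp_coercive hC1 hC hψ le_rfl X
  rw [hX, ddot_zero_left, mul_zero] at this
  exact norm_eq_zero.1 (pow_eq_zero_iff two_ne_zero |>.1 (le_antisymm this (by positivity)))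

/-- By the commutator formula `dexp ψ` kills the commutator of `B` and `ψ` as soon as `B` commutes
with `e^ψ`; injectivity concludes. -/
lemma commute_of_commute_exp {ψ B : Mat d} (hψ : ψ.IsSymm) (h : Commute B (exp ψ)) :
    Commute B ψ := by
  have h1 := dexp_commutator ψ B
  rw [h.eq, sub_self] at h1
  have := dexp_injective hψ (h1.trans (map_zero _).symm)
  exact sub_eq_zero.1 this

end Exp

/-! ### The stretching term as a function of `ψ` and the velocity gradient -/

section Stretching
variable {d : ℕ}

/-- The right-hand side `G e^ψ + e^ψ Gᵀ` of the upper-convected derivative. -/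
def upper (ψ : Mat d) : Mat d →ₗ[ℝ] Mat d where
  toFun G := G * exp ψ + exp ψ * G.transpose
  map_add' G G' := by rw [Matrix.transpose_add]; noncomm_ring
  map_smul' c G := by simp [smul_add]

lemma upper_apply (ψ G : Mat d) : upper ψ G = G * exp ψ + exp ψ * G.transpose := rfl

/-- The term `Ωψ - ψΩ + 2B` of the log-formulation as a linear function of the velocity gradient. -/
def stretch (ψ : Mat d) : Mat d →ₗ[ℝ] Mat d :=
  (Ring.inverse (dexp ψ : Module.End ℝ (Mat d)) : Module.End ℝ (Mat d)) ∘ₗ upper ψ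

/-- `Ring.inverse` has a default value at non-units, but an injective endomorphism of a
finite-dimensional space is a unit, so for symmetric `ψ` it is a true inverse. -/
lemma dexp_stretch {ψ : Mat d} (hψ : ψ.IsSymm) (G : Mat d) : dexp ψ (stretch ψ G) = upper ψ G := by
  have h : IsUnit (dexp ψ : Module.End ℝ (Mat d)) := by
    rw [LinearMap.isUnit_iff_ker_eq_bot, LinearMap.ker_eq_bot]
    exact dexp_injective hψ
  have := congrArg (fun l : Module.End ℝ (Mat d) => l (upper ψ G)) (Ring.mul_inverse_cancel _ h)
  simpa [stretch] using this

/-- Apply the injective map `dexp ψ`: the rotation gives the commutator of `Ω` with `e^ψ`, and `B`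
commutes with `ψ`, so it gives `2 B e^ψ`. In `G e^ψ + e^ψ Gᵀ` the part `N e^{-ψ}` contributes `N +
Nᵀ = 0`. Hence the term of the scheme does not depend on the chosen decomposition. -/
lemma stretch_eq {G ψ Ω B N : Mat d} (hψ : ψ.IsSymm) (h : IsDecomposition G ψ Ω B N) :
    Ω * ψ - ψ * Ω + (2 : ℝ) • B = stretch ψ G := by
  obtain ⟨hG, hΩ, hN, hB, hc⟩ := h
  apply dexp_injective hψ
  have hB' := commute_of_commute_exp hψ hc
  rw [dexp_stretch hψ, map_add, map_smul, dexp_commutator, dexp_of_commute hB', upper_apply, hG]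
  have e1 : (exp (-ψ)).transpose = exp (-ψ) := exp_symm (by simpa [Matrix.IsSymm] using hψ)
  have e2 : N * exp (-ψ) * exp ψ = N := by rw [mul_assoc, exp_neg_mul_exp, mul_one]
  have e3 : exp ψ * (exp (-ψ) * N) = N := by rw [← mul_assoc, exp_mul_exp_neg, one_mul]
  simp only [Matrix.transpose_add, Matrix.transpose_mul, hΩ, hN, hB, e1, add_mul, mul_add,
    mul_neg, e2, e3, ← hc.eq, two_smul]
  abel

lemma stretch_symm {ψ : Mat d} (hψ : ψ.IsSymm) (G : Mat d) : (stretch ψ G).IsSymm := by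
  apply dexp_injective hψ
  rw [← transpose_dexp hψ, dexp_stretch hψ, upper_apply]
  simp [exp_symm hψ, add_comm]

/-- The cancellation behind the free energy: the work of the stretching term is twice the elastic
term of the momentum equation, up to a trace which vanishes for solenoidal velocities. -/
lemma ddot_stretch_exp {ψ : Mat d} (hψ : ψ.IsSymm) (G : Mat d) :
    ddot (stretch ψ G) (exp ψ - 1) = 2 * ddot (exp ψ) G - 2 * G.trace := by
  have h1 : ddot (stretch ψ G) (exp ψ) = 2 * ddot (exp ψ) G := by
    rw [ddot, exp_symm hψ, ← trace_dexp, dexp_stretch hψ, upper_apply, Matrix.trace_add]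
    rw [← Matrix.trace_transpose (G * exp ψ), Matrix.transpose_mul, exp_symm hψ, ddot, two_mul]
  have h2 : ddot (stretch ψ G) 1 = 2 * G.trace := by
    rw [ddot_one_right, ← trace_dexp_mul_exp_neg ψ, dexp_stretch hψ, upper_apply, add_mul,
      Matrix.trace_add, mul_assoc, exp_mul_exp_neg, mul_one, Matrix.trace_mul_comm, ← mul_assoc,
      exp_neg_mul_exp, one_mul, Matrix.trace_transpose, two_mul]
  rw [ddot_sub_right, h1, h2]

lemma norm_upper_le {R C : ℝ} (hC : ∀ A : Mat d, ‖A‖ ≤ R → ‖exp A‖ ≤ C) {ψ : Mat d}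
    (hR : ‖ψ‖ ≤ R) (G : Mat d) : ‖upper ψ G‖ ≤ 2 * C * ‖G‖ := by
  have hψ := hC ψ hR
  calc ‖upper ψ G‖ ≤ ‖G * exp ψ‖ + ‖exp ψ * G.transpose‖ := norm_add_le _ _
    _ ≤ ‖G‖ * ‖exp ψ‖ + ‖exp ψ‖ * ‖G.transpose‖ := add_le_add (norm_mul_le _ _) (norm_mul_le _ _)
    _ ≤ ‖G‖ * C + C * ‖G‖ := by rw [Matrix.frobenius_norm_transpose]; gcongr
    _ = _ := by ring

/-- Coercivity and the Cauchy–Schwarz inequality: a quantitative bound on the inverse of `dexp ψ`.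
-/
lemma norm_le_of_dexp {R C : ℝ} (hC1 : 1 ≤ C) (hC : ∀ A : Mat d, ‖A‖ ≤ R → ‖exp A‖ ≤ C)
    {ψ : Mat d} (hψ : ψ.IsSymm) (hR : ‖ψ‖ ≤ R) (X : Mat d) : ‖X‖ ≤ C ^ 4 * ‖dexp ψ X‖ := by
  have h := dexp_coercive hC1 hC hψ hR X
  have h2 := ddot_le (dexp ψ X) X
  rcases eq_or_lt_of_le (norm_nonneg X) with h0 | h0
  · rw [← h0]; positivity
  · refine le_of_mul_le_mul_right ?_ h0
    calc ‖X‖ * ‖X‖ = ‖X‖ ^ 2 := by ring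
      _ ≤ C ^ 4 * ddot (dexp ψ X) X := h
      _ ≤ C ^ 4 * (‖dexp ψ X‖ * ‖X‖) := by gcongr
      _ = _ := by ring

/-- `stretch` is bounded and Lipschitz with respect to `ψ` on bounded sets. -/
lemma exists_stretch_bound (d : ℕ) (R : ℝ) : ∃ K : ℝ, 0 ≤ K ∧
    (∀ ψ : Mat d, ψ.IsSymm → ‖ψ‖ ≤ R → ∀ G, ‖stretch ψ G‖ ≤ K * ‖G‖) ∧
    (∀ ψ ψ' : Mat d, ψ.IsSymm → ψ'.IsSymm → ‖ψ‖ ≤ R → ‖ψ'‖ ≤ R → ∀ G,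
      ‖stretch ψ G - stretch ψ' G‖ ≤ K * ‖G‖ * ‖ψ - ψ'‖) := by
  obtain ⟨C, hC1, hC⟩ := exists_exp_bound d R
  have hC0 : 0 ≤ C := zero_le_one.trans hC1
  have hb : ∀ ψ : Mat d, ψ.IsSymm → ‖ψ‖ ≤ R → ∀ G, ‖stretch ψ G‖ ≤ 2 * C ^ 5 * ‖G‖ := by
    intro ψ hψ hR G
    refine (norm_le_of_dexp hC1 hC hψ hR _).trans ?_
    rw [dexp_stretch hψ]
    calc _ ≤ C ^ 4 * (2 * C * ‖G‖) := by gcongr; exact norm_upper_le hC hR G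
      _ = _ := by ring
  refine ⟨max (2 * C ^ 5) (C ^ 4 * (2 * C ^ 2 + 2 * C ^ 3 * (2 * C ^ 5))), by positivity, ?_, ?_⟩
  · intro ψ hψ hR G
    refine (hb ψ hψ hR G).trans ?_
    gcongr
    exact le_max_left _ _
  · intro ψ ψ' hψ hψ' hR hR' G
    set δ := ‖ψ - ψ'‖
    have hsm : ∀ {s : ℝ} (D : Mat d), 0 ≤ s → s ≤ 1 → ‖D‖ ≤ R → ‖s • D‖ ≤ R := by
      intro s D h0 h1 hD
      rw [norm_smul, Real.norm_of_nonneg h0]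
      nlinarith [norm_nonneg D]
    have hd : ∀ X : Mat d, ‖dexp ψ' X - dexp ψ X‖ ≤ 2 * C ^ 3 * δ * ‖X‖ := by
      intro X
      rw [dexp_apply, dexp_apply, ← intervalIntegral.integral_sub
        ((continuous_duhamel _ _ _).intervalIntegrable _ _)
        ((continuous_duhamel _ _ _).intervalIntegrable _ _)]
      have := intervalIntegral.norm_integral_le_of_norm_le_const (a := 0) (b := 1)
        (f := fun s : ℝ => exp (s • ψ') * X * exp ((1 - s) • ψ')
          - exp (s • ψ) * X * exp ((1 - s) • ψ)) (C := 2 * C ^ 3 * δ * ‖X‖) ?_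
      · simpa using this
      · intro s hs
        rw [uIoc_of_le zero_le_one] at hs
        have l1 : ∀ t : ℝ, 0 ≤ t → t ≤ 1 → ‖exp (t • ψ') - exp (t • ψ)‖ ≤ C ^ 2 * δ := by
          intro t h0 h1
          refine (norm_exp_sub_le hC (hsm _ h0 h1 hR') (hsm _ h0 h1 hR)).trans ?_
          rw [← smul_sub, norm_smul, Real.norm_of_nonneg h0, norm_sub_rev]
          have : t * ‖ψ - ψ'‖ ≤ δ := mul_le_of_le_one_left (norm_nonneg _) h1
          gcongr
        have b1 := hC _ (hsm ψ hs.1.le hs.2 hR)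
        have b2 := hC _ (hsm ψ' (by linarith [hs.2] : 0 ≤ 1 - s) (by linarith [hs.1]) hR')
        have e : exp (s • ψ') * X * exp ((1 - s) • ψ') - exp (s • ψ) * X * exp ((1 - s) • ψ)
          = (exp (s • ψ') - exp (s • ψ)) * X * exp ((1 - s) • ψ')
            + exp (s • ψ) * X * (exp ((1 - s) • ψ') - exp ((1 - s) • ψ)) := by noncomm_ring
        rw [e]
        have m3 : ∀ P Q S : Mat d, ‖P * Q * S‖ ≤ ‖P‖ * ‖Q‖ * ‖S‖ := fun P Q S =>
          (norm_mul_le _ _).trans (by gcongr; exact norm_mul_le _ _)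
        calc _ ≤ ‖exp (s • ψ') - exp (s • ψ)‖ * ‖X‖ * ‖exp ((1 - s) • ψ')‖
              + ‖exp (s • ψ)‖ * ‖X‖ * ‖exp ((1 - s) • ψ') - exp ((1 - s) • ψ)‖ :=
              (norm_add_le _ _).trans (add_le_add (m3 _ _ _) (m3 _ _ _))
          _ ≤ (C ^ 2 * δ) * ‖X‖ * C + C * ‖X‖ * (C ^ 2 * δ) := by
              gcongr
              · exact l1 s hs.1.le hs.2
              · exact l1 _ (by linarith [hs.2]) (by linarith [hs.1])
          _ = _ := by ring
    have hu : ‖upper ψ G - upper ψ' G‖ ≤ 2 * C ^ 2 * δ * ‖G‖ := by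
      have e : upper ψ G - upper ψ' G
        = G * (exp ψ - exp ψ') + (exp ψ - exp ψ') * G.transpose := by
        rw [upper_apply, upper_apply]; noncomm_ring
      have := norm_exp_sub_le hC hR hR'
      rw [e]
      calc _ ≤ ‖G‖ * ‖exp ψ - exp ψ'‖ + ‖exp ψ - exp ψ'‖ * ‖G.transpose‖ :=
            (norm_add_le _ _).trans (add_le_add (norm_mul_le _ _) (norm_mul_le _ _))
        _ ≤ ‖G‖ * (C ^ 2 * δ) + (C ^ 2 * δ) * ‖G‖ := by
            rw [Matrix.frobenius_norm_transpose]; gcongr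
        _ = _ := by ring
    -- The difference of solutions of two linear systems: the change of the right-hand side plus the
    -- change of the operator applied to the second solution.
    have e : dexp ψ (stretch ψ G - stretch ψ' G)
        = (upper ψ G - upper ψ' G) + (dexp ψ' (stretch ψ' G) - dexp ψ (stretch ψ' G)) := by
      rw [map_sub, dexp_stretch hψ, dexp_stretch hψ']; abel
    calc ‖stretch ψ G - stretch ψ' G‖ ≤ C ^ 4 * ‖dexp ψ (stretch ψ G - stretch ψ' G)‖ :=
          norm_le_of_dexp hC1 hC hψ hR _
      _ ≤ C ^ 4 * (2 * C ^ 2 * δ * ‖G‖ + 2 * C ^ 3 * δ * (2 * C ^ 5 * ‖G‖)) := by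
          rw [e]
          gcongr
          refine (norm_add_le _ _).trans (add_le_add hu ((hd _).trans ?_))
          gcongr
          exact hb ψ' hψ' hR' G
      _ = C ^ 4 * (2 * C ^ 2 + 2 * C ^ 3 * (2 * C ^ 5)) * ‖G‖ * δ := by ring
      _ ≤ _ := by gcongr; exact le_max_right _ _

end Stretching
end OldroydLog
end

noncomputable section
namespace OldroydLog
open scoped Matrix.Norms.Frobenius
open NormedSpace (exp)

/-! ### Entropy of symmetric matrices and Klein's inequality -/

section FreeEnergy
variable {d : ℕ}

lemma exists_orthogonal_diagonalization {ψ : Mat d} (h : ψ.IsSymm) :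
    ∃ (U : Mat d) (a : Fin d → ℝ), U * U.transpose = 1 ∧ U.transpose * U = 1 ∧
      ψ = U * Matrix.diagonal a * U.transpose ∧
      exp ψ = U * Matrix.diagonal (fun i => Real.exp (a i)) * U.transpose := by
  have hA : ψ.IsHermitian := by
    rw [Matrix.IsHermitian, Matrix.conjTranspose_eq_transpose_of_trivial]; exact h
  let U : Mat d := hA.eigenvectorUnitary.1
  have h1 : U * U.transpose = 1 := by
    have := Unitary.mul_star_self_of_mem hA.eigenvectorUnitary.2
    rwa [Matrix.star_eq_conjTranspose, Matrix.conjTranspose_eq_transpose_of_trivial] at this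
  have h2 : U.transpose * U = 1 := by
    have := Unitary.star_mul_self_of_mem hA.eigenvectorUnitary.2
    rwa [Matrix.star_eq_conjTranspose, Matrix.conjTranspose_eq_transpose_of_trivial] at this
  have h3 : ψ = U * Matrix.diagonal hA.eigenvalues * U.transpose := by
    have := hA.spectral_theorem
    rw [Unitary.conjStarAlgAut_apply, Matrix.star_eq_conjTranspose,
      Matrix.conjTranspose_eq_transpose_of_trivial] at this
    exact this
  have hinv : U⁻¹ = U.transpose := Matrix.inv_eq_right_inv h1
  refine ⟨U, hA.eigenvalues, h1, h2, h3, ?_⟩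
  conv_lhs => rw [h3, ← hinv]
  rw [Matrix.exp_conj _ _ (IsUnit.of_mul_eq_one _ h1), Matrix.exp_diagonal, hinv]
  congr 3
  ext i
  rw [Pi.coe_exp, Real.exp_eq_exp_ℝ]

/-- The entropic energy density `tr (e^ψ - ψ - I)`. -/
def entropy (ψ : Mat d) : ℝ := (exp ψ - ψ - 1).trace

lemma entropy_zero : entropy (0 : Mat d) = 0 := by simp [entropy, NormedSpace.exp_zero]

lemma trace_conj_diagonal {U : Mat d} (h : U.transpose * U = 1) (a : Fin d → ℝ) :
    (U * Matrix.diagonal a * U.transpose).trace = ∑ i, a i := by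
  rw [mul_assoc, Matrix.trace_mul_comm, mul_assoc, h, mul_one, Matrix.trace_diagonal]

/-- For each eigenvalue this is `|x| ≤ (e^x - x - 1) + 1`, and the `d` units add up to the constant.
This is how a bound on the free energy bounds the stress. -/
lemma norm_le_entropy {ψ : Mat d} (h : ψ.IsSymm) : ‖ψ‖ ≤ entropy ψ + d := by
  obtain ⟨U, a, h1, h2, h3, h4⟩ := exists_orthogonal_diagonalization h
  have e1 : entropy ψ = ∑ i, (Real.exp (a i) - a i - 1) := by
    rw [entropy, Matrix.trace_sub, Matrix.trace_sub, h4, trace_conj_diagonal h2]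
    conv_lhs => enter [1, 2]; rw [h3]
    rw [trace_conj_diagonal h2]
    simp
  have e2 : ‖ψ‖ ^ 2 = ∑ i, a i ^ 2 := by
    rw [← ddot_self, ddot, h.eq]
    conv_lhs => rw [h3]
    have : U * Matrix.diagonal a * U.transpose * (U * Matrix.diagonal a * U.transpose)
      = U * Matrix.diagonal (fun i => a i ^ 2) * U.transpose := by
      calc _ = U * Matrix.diagonal a * (U.transpose * U) * Matrix.diagonal a * U.transpose := by
            simp only [mul_assoc]
        _ = _ := by
            rw [h2, mul_one, mul_assoc U, Matrix.diagonal_mul_diagonal]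
            simp [pow_two]
    rw [this, trace_conj_diagonal h2]
  have e3 : ‖ψ‖ ≤ ∑ i, |a i| := by
    refine abs_le_of_sq_le_sq' ?_ (Finset.sum_nonneg fun i _ => abs_nonneg _) |>.2
    rw [e2]
    calc ∑ i, a i ^ 2 = ∑ i, |a i| ^ 2 := by simp
      _ ≤ _ := Finset.sum_sq_le_sq_sum_of_nonneg fun i _ => abs_nonneg _
  have e4 : ∀ x : ℝ, |x| ≤ Real.exp x - x - 1 + 1 := by
    intro x
    rcases le_total 0 x with hx | hx
    · rw [abs_of_nonneg hx]
      have := Real.quadratic_le_exp_of_nonneg hx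
      nlinarith [sq_nonneg (x - 2)]
    · rw [abs_of_nonpos hx]
      linarith [Real.exp_pos x]
  calc ‖ψ‖ ≤ ∑ i, |a i| := e3
    _ ≤ ∑ i, (Real.exp (a i) - a i - 1 + 1) := Finset.sum_le_sum fun i _ => e4 _
    _ = _ := by rw [Finset.sum_add_distrib, e1]; simp

/-- Klein's inequality: convexity of the entropic energy density. -/
lemma entropy_sub_le {A B : Mat d} (hA : A.IsSymm) (hB : B.IsSymm) :
    entropy A - entropy B ≤ ddot (A - B) (exp A - 1) := by
  obtain ⟨U, a, hU1, hU2, hU3, hU4⟩ := exists_orthogonal_diagonalization hA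
  obtain ⟨W, b, hW1, hW2, hW3, hW4⟩ := exists_orthogonal_diagonalization hB
  -- The squared entries of the orthogonal matrix between the two eigenbases form a doubly
  -- stochastic matrix. Averaging over it the scalar convexity inequality of `exp` at the pairs `(a
  -- i, b j)` gives the matrix inequality; the affine part of the entropy cancels on both sides.
  set O := U.transpose * W with hO
  have hO1 : O * O.transpose = 1 := by
    rw [hO, Matrix.transpose_mul, Matrix.transpose_transpose, mul_assoc, ← mul_assoc W, hW1,
      one_mul, hU2]
  have hO2 : O.transpose * O = 1 := by
    rw [hO, Matrix.transpose_mul, Matrix.transpose_transpose, mul_assoc, ← mul_assoc U, hU1,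
      one_mul, hW2]
  have row : ∀ i, ∑ j, O i j ^ 2 = 1 := by
    intro i
    have := congrFun (congrFun hO1 i) i
    simpa [Matrix.mul_apply, pow_two] using this
  have col : ∀ j, ∑ i, O i j ^ 2 = 1 := by
    intro j
    have := congrFun (congrFun hO2 j) j
    simpa [Matrix.mul_apply, pow_two] using this
  have trA : (exp A).trace = ∑ i, Real.exp (a i) := by rw [hU4, trace_conj_diagonal hU2]
  have trB : (exp B).trace = ∑ i, Real.exp (b i) := by rw [hW4, trace_conj_diagonal hW2]
  have trAA : (A * exp A).trace = ∑ i, a i * Real.exp (a i) := by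
    rw [hU4]
    conv_lhs => enter [1, 1]; rw [hU3]
    rw [show U * Matrix.diagonal a * U.transpose
        * (U * Matrix.diagonal (fun i => Real.exp (a i)) * U.transpose)
        = U * (Matrix.diagonal a * (U.transpose * U)
          * Matrix.diagonal (fun i => Real.exp (a i))) * U.transpose by simp only [mul_assoc],
      hU2, mul_one, Matrix.diagonal_mul_diagonal, trace_conj_diagonal hU2]
  have trBA : (B * exp A).trace = ∑ i, ∑ j, O i j ^ 2 * (b j * Real.exp (a i)) := by
    rw [hU4]
    conv_lhs => enter [1, 1]; rw [hW3]
    have e : (W * Matrix.diagonal b * W.transpose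
        * (U * Matrix.diagonal (fun i => Real.exp (a i)) * U.transpose)).trace
        = (O * Matrix.diagonal b * (O.transpose * Matrix.diagonal (fun i => Real.exp (a i)))).trace := by
      rw [← mul_assoc, Matrix.trace_mul_comm, hO, Matrix.transpose_mul, Matrix.transpose_transpose]
      simp only [mul_assoc]
    rw [e]
    refine Finset.sum_congr rfl fun i _ => ?_
    rw [Matrix.diag_apply, Matrix.mul_apply]
    refine Finset.sum_congr rfl fun j _ => ?_
    rw [Matrix.mul_diagonal, Matrix.mul_diagonal, Matrix.transpose_apply]
    ring
  have key : 0 ≤ ∑ i, ∑ j, O i j ^ 2 *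
      (Real.exp (b j) - Real.exp (a i) - Real.exp (a i) * (b j - a i)) := by
    refine Finset.sum_nonneg fun i _ => Finset.sum_nonneg fun j _ => mul_nonneg (sq_nonneg _) ?_
    have := Real.add_one_le_exp (b j - a i)
    have h2 : Real.exp (b j) = Real.exp (a i) * Real.exp (b j - a i) := by
      rw [← Real.exp_add]; congr 1; ring
    rw [h2]
    nlinarith [Real.exp_pos (a i)]
  have expand : ∑ i, ∑ j, O i j ^ 2 *
      (Real.exp (b j) - Real.exp (a i) - Real.exp (a i) * (b j - a i))
      = (exp B).trace - (exp A).trace - (B * exp A).trace + (A * exp A).trace := by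
    have s1 : ∑ i, ∑ j, O i j ^ 2 * Real.exp (b j) = (exp B).trace := by
      rw [Finset.sum_comm, trB]
      refine Finset.sum_congr rfl fun j _ => ?_
      rw [← Finset.sum_mul, col, one_mul]
    have s2 : ∑ i, ∑ j, O i j ^ 2 * Real.exp (a i) = (exp A).trace := by
      rw [trA]
      refine Finset.sum_congr rfl fun j _ => ?_
      rw [← Finset.sum_mul, row, one_mul]
    have s3 : ∑ i, ∑ j, O i j ^ 2 * (a i * Real.exp (a i)) = (A * exp A).trace := by
      rw [trAA]
      refine Finset.sum_congr rfl fun j _ => ?_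
      rw [← Finset.sum_mul, row, one_mul]
    rw [← s1, ← s2, ← s3, trBA]
    simp only [← Finset.sum_sub_distrib, ← Finset.sum_add_distrib]
    refine Finset.sum_congr rfl fun i _ => Finset.sum_congr rfl fun j _ => ?_
    ring
  have e : ddot (A - B) (exp A - 1)
      = (A * exp A).trace - (B * exp A).trace - A.trace + B.trace := by
    rw [ddot_sub_right, ddot_one_right, ddot, exp_symm hA, sub_mul, Matrix.trace_sub,
      Matrix.trace_sub]
    ring
  rw [expand] at key
  rw [e]
  simp only [entropy, Matrix.trace_sub]
  linarith

/-- Klein's inequality at `A = 0`, where the gradient `e^A - I` of the entropy vanishes. -/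
lemma entropy_nonneg {ψ : Mat d} (h : ψ.IsSymm) : 0 ≤ entropy ψ := by
  have := entropy_sub_le (A := 0) (B := ψ) (by simp [Matrix.IsSymm]) h
  simp only [entropy_zero, NormedSpace.exp_zero, sub_self, ddot_zero_right] at this
  linarith

/-- The product expands to `tr (2 I - e^ψ - e^{-ψ})`, which is minus the sum of the entropies of `ψ`
and `-ψ`. -/
lemma ddot_relaxation_nonpos {ψ : Mat d} (h : ψ.IsSymm) :
    ddot (exp (-ψ) - 1) (exp ψ - 1) ≤ 0 := by
  have h1 := entropy_nonneg h
  have hn : (-ψ).IsSymm := by simpa [Matrix.IsSymm] using h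
  have h2 := entropy_nonneg hn
  have e : ddot (exp (-ψ) - 1) (exp ψ - 1) = -(entropy ψ + entropy (-ψ)) := by
    rw [ddot, Matrix.transpose_sub, exp_symm h, Matrix.transpose_one, sub_mul, mul_sub, mul_sub,
      exp_neg_mul_exp]
    simp only [entropy, Matrix.trace_sub, Matrix.trace_neg, mul_one, one_mul]
    ring
  rw [e]; linarith

end FreeEnergy

/-! ### Existence of the decomposition of the velocity gradient -/

section Decomposition
variable {d : ℕ}

/-- Antisymmetric matrices. -/
def antisymmetric (d : ℕ) : Submodule ℝ (Mat d) where
  carrier := {A | A.transpose = -A}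
  add_mem' {A B} hA hB := by
    simp only [mem_ofPred_eq] at *
    rw [Matrix.transpose_add, hA, hB, neg_add]
  zero_mem' := by simp
  smul_mem' c A hA := by
    simp only [mem_ofPred_eq] at *
    rw [Matrix.transpose_smul, hA, smul_neg]

/-- Symmetric matrices commuting with `P`. -/
def symmetricCommutant (P : Mat d) : Submodule ℝ (Mat d) where
  carrier := {A | A.transpose = A ∧ Commute A P}
  add_mem' {A B} hA hB := by
    refine ⟨?_, hA.2.add_left hB.2⟩
    rw [Matrix.transpose_add, hA.1, hB.1]
  zero_mem' := by simp
  smul_mem' c A hA := by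
    refine ⟨?_, hA.2.smul_left c⟩
    rw [Matrix.transpose_smul, hA.1]

/-- The velocity gradient can be decomposed linearly. -/
lemma exists_linear_decomposition {ψ : Mat d} (hψ : ψ.IsSymm) :
    ∃ Ω B N : Mat d →ₗ[ℝ] Mat d, ∀ G, IsDecomposition G ψ (Ω G) (B G) (N G) := by
  let a := (antisymmetric d).subtype
  let c := (symmetricCommutant (exp ψ)).subtype
  let T : (antisymmetric d × symmetricCommutant (exp ψ)) × antisymmetric d →ₗ[ℝ] Mat d :=
    (a.coprod c).coprod (LinearMap.mulRight ℝ (exp (-ψ)) ∘ₗ a)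
  have hT : ∀ Ω B N, T ((Ω, B), N) = Ω.1 + B.1 + N.1 * exp (-ψ) := fun _ _ _ => rfl
  -- Surjectivity by duality. Let `Y` be orthogonal to the range. Testing with all `Ω` makes `Y`
  -- symmetric, and testing with all `N` makes `Y e^{-ψ}` symmetric. Then `Y` commutes with `e^ψ`,
  -- so that `Y` is itself an admissible `B`, and orthogonality to itself gives `Y = 0`.
  have hrange : LinearMap.range T = ⊤ := by
    by_contra hne
    obtain ⟨f, hf0, hf⟩ := Submodule.exists_le_ker_of_lt_top _ (lt_top_iff_ne_top.2 hne)
    let Y : Mat d := Matrix.of fun i j => f (Matrix.single i j 1)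
    have hY : ∀ A, f A = ddot A Y := by
      intro A
      conv_lhs => rw [Matrix.matrix_eq_sum_single A]
      rw [ddot_eq_sum, map_sum]
      refine Finset.sum_congr rfl fun i _ => ?_
      rw [map_sum]
      refine Finset.sum_congr rfl fun j _ => ?_
      have : Matrix.single i j (A i j) = A i j • Matrix.single i j (1 : ℝ) := by
        rw [Matrix.smul_single, smul_eq_mul, mul_one]
      rw [this, map_smul, smul_eq_mul]; rfl
    have hz : ∀ Ω B N, ddot (T ((Ω, B), N)) Y = 0 := by
      intro Ω B N
      rw [← hY]
      exact hf ⟨_, rfl⟩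
    have hanti : ∀ A : Mat d, (A - A.transpose) ∈ antisymmetric d := by
      intro A
      change (A - A.transpose).transpose = -(A - A.transpose)
      simp
    have eself : ∀ A : Mat d, ddot (A - A.transpose) A = 0 → A.transpose = A := by
      intro A h0
      have : ddot (A - A.transpose) (A - A.transpose) = 0 := by
        have h1 : ddot (A - A.transpose) A.transpose = -ddot (A - A.transpose) A := by
          rw [← ddot_transpose, Matrix.transpose_sub, Matrix.transpose_transpose, ← ddot_neg_left,
            neg_sub]
        rw [ddot_sub_right, h1, h0]; simp
      exact (sub_eq_zero.1 (eq_zero_of_ddot_self this)).symm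
    have hYs : Y.transpose = Y := by
      apply eself
      have := hz ⟨_, hanti Y⟩ 0 0
      simpa [hT] using this
    have he : (exp (-ψ)).transpose = exp (-ψ) := exp_symm (by simpa [Matrix.IsSymm] using hψ)
    have hZs : (Y * exp (-ψ)).transpose = Y * exp (-ψ) := by
      apply eself
      have := hz 0 0 ⟨_, hanti (Y * exp (-ψ))⟩
      simp only [hT, ZeroMemClass.coe_zero, add_zero, zero_add] at this
      rwa [ddot_mul_right, he] at this
    have hcomm : Commute Y (exp ψ) := by
      rw [Matrix.transpose_mul, he, hYs] at hZs
      have h1 : exp ψ * (exp (-ψ) * Y) * exp ψ = exp ψ * (Y * exp (-ψ)) * exp ψ := by rw [hZs]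
      have e1 : exp ψ * (exp (-ψ) * Y) * exp ψ = Y * exp ψ := by
        rw [← mul_assoc, exp_mul_exp_neg, one_mul]
      have e2 : exp ψ * (Y * exp (-ψ)) * exp ψ = exp ψ * Y := by
        rw [mul_assoc, mul_assoc Y, exp_neg_mul_exp, mul_one]
      rw [e1, e2] at h1
      exact h1
    have hY0 : Y = 0 := by
      have := hz 0 ⟨Y, hYs, hcomm⟩ 0
      simp only [hT, ZeroMemClass.coe_zero, add_zero, zero_add, zero_mul] at this
      exact eq_zero_of_ddot_self this
    apply hf0
    ext A
    rw [hY, hY0]; simp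
  -- A linear right inverse rather than a choice for each `G`: composed with the affine gradient on
  -- an element, it yields affine `Ω`, `B`, `N`.
  obtain ⟨g, hg⟩ := T.exists_rightInverse_of_surjective hrange
  refine ⟨a ∘ₗ LinearMap.fst ℝ _ _ ∘ₗ LinearMap.fst ℝ _ _ ∘ₗ g,
    c ∘ₗ LinearMap.snd ℝ _ _ ∘ₗ LinearMap.fst ℝ _ _ ∘ₗ g, a ∘ₗ LinearMap.snd ℝ _ _ ∘ₗ g, ?_⟩
  intro G
  have h1 : T (g G) = G := congrArg (fun l : Mat d →ₗ[ℝ] Mat d => l G) hg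
  exact ⟨h1.symm, (g G).1.1.2, (g G).2.2, (g G).1.2.2.1, (g G).1.2.2.2⟩

end Decomposition
end OldroydLog
end

noncomputable section
namespace OldroydLog
open scoped Matrix.Norms.Frobenius
open NormedSpace (exp)

/-! ### Multilinear forms in finite dimension -/

section FiniteDimensionalForms
variable {V : Type*} [NormedAddCommGroup V] [NormedSpace ℝ V] [FiniteDimensional ℝ V]

lemma exists_bound_linear {F : Type*} [NormedAddCommGroup F] [NormedSpace ℝ F] (f : V →ₗ[ℝ] F) :
    ∃ C, 0 ≤ C ∧ ∀ v, ‖f v‖ ≤ C * ‖v‖ :=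
  ⟨‖f.toContinuousLinearMap‖, norm_nonneg _, fun v => f.toContinuousLinearMap.le_opNorm v⟩

lemma exists_bound_bilinear (f : V →ₗ[ℝ] V →ₗ[ℝ] ℝ) :
    ∃ C, 0 ≤ C ∧ ∀ u v, |f u v| ≤ C * ‖u‖ * ‖v‖ := by
  obtain ⟨C, h0, hC⟩ := exists_bound_linear
    ((LinearMap.toContinuousLinearMap : (V →ₗ[ℝ] ℝ) ≃ₗ[ℝ] (V →L[ℝ] ℝ)).toLinearMap ∘ₗ f)
  refine ⟨C, h0, fun u v => ?_⟩
  have := (LinearMap.toContinuousLinearMap (f u)).le_opNorm v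
  refine this.trans ?_
  gcongr
  exact hC u

lemma exists_bound_trilinear (f : V →ₗ[ℝ] V →ₗ[ℝ] V →ₗ[ℝ] ℝ) :
    ∃ C, 0 ≤ C ∧ ∀ w u v, |f w u v| ≤ C * ‖w‖ * ‖u‖ * ‖v‖ := by
  let c := (LinearMap.toContinuousLinearMap : (V →ₗ[ℝ] ℝ) ≃ₗ[ℝ] (V →L[ℝ] ℝ)).toLinearMap
  let g : V →ₗ[ℝ] (V →L[ℝ] V →L[ℝ] ℝ) :=
    { toFun := fun w => LinearMap.toContinuousLinearMap (c ∘ₗ f w)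
      map_add' := fun w w' => by rw [map_add, LinearMap.comp_add, map_add]
      map_smul' := fun a w => by
        rw [map_smul, LinearMap.comp_smul, map_smul, RingHom.id_apply] }
  obtain ⟨C, h0, hC⟩ := exists_bound_linear (F := V →L[ℝ] V →L[ℝ] ℝ) g
  refine ⟨C, h0, fun w u v => ?_⟩
  have h1 : |f w u v| ≤ ‖g w u‖ * ‖v‖ := (g w u).le_opNorm v
  have h2 : ‖g w u‖ ≤ ‖g w‖ * ‖u‖ := (g w).le_opNorm u
  refine h1.trans ?_
  gcongr
  refine h2.trans ?_
  gcongr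
  exact hC w

/-- The quadratic form attains a positive minimum on the compact unit sphere; homogeneity does the
rest. -/
lemma exists_coercive (f : V →ₗ[ℝ] V →ₗ[ℝ] ℝ) (hf : ∀ v, v ≠ 0 → 0 < f v v) :
    ∃ c, 0 < c ∧ ∀ v, c * ‖v‖ ^ 2 ≤ f v v := by
  have hcont : Continuous fun v => f v v := by
    let c := (LinearMap.toContinuousLinearMap : (V →ₗ[ℝ] ℝ) ≃ₗ[ℝ] (V →L[ℝ] ℝ)).toLinearMap
    let g := (c ∘ₗ f).toContinuousLinearMap
    exact (g.continuous.clm_apply continuous_id)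
  rcases subsingleton_or_nontrivial V with h | h
  · exact ⟨1, one_pos, fun v => by simp [Subsingleton.elim v 0]⟩
  obtain ⟨v₀, hv₀, hmin⟩ := (isCompact_sphere (0 : V) 1).exists_isMinOn
    (NormedSpace.sphere_nonempty.2 zero_le_one) hcont.continuousOn
  have hv₀' : v₀ ≠ 0 := by
    rintro rfl
    simp at hv₀
  refine ⟨f v₀ v₀, hf _ hv₀', fun v => ?_⟩
  rcases eq_or_ne v 0 with rfl | hv
  · simp
  have hn : 0 < ‖v‖ := norm_pos_iff.2 hv
  have h1 : ‖v‖⁻¹ • v ∈ Metric.sphere (0 : V) 1 := by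
    rw [mem_sphere_zero_iff_norm, norm_smul, norm_inv, norm_norm, inv_mul_cancel₀ hn.ne']
  have h2 := hmin h1
  simp only [mem_ofPred_eq, map_smul, LinearMap.smul_apply, smul_eq_mul] at h2
  calc f v₀ v₀ * ‖v‖ ^ 2 ≤ (‖v‖⁻¹ * (‖v‖⁻¹ * f v v)) * ‖v‖ ^ 2 := by gcongr
    _ = f v v := by field_simp

/-- A finite-dimensional Lax–Milgram lemma: positivity gives injectivity into the dual of `V₀`,
which has the same dimension. -/
lemma exists_solution_of_pos (V₀ : Submodule ℝ V) (B : V →ₗ[ℝ] V →ₗ[ℝ] ℝ)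
    (hB : ∀ v ∈ V₀, v ≠ 0 → 0 < B v v) (f : V →ₗ[ℝ] ℝ) :
    ∃ u ∈ V₀, ∀ v ∈ V₀, B u v = f v := by
  let B₀ : V₀ →ₗ[ℝ] Module.Dual ℝ V₀ := B.compl₁₂ V₀.subtype V₀.subtype
  have hinj : Function.Injective B₀ := by
    rw [injective_iff_map_eq_zero]
    intro u hu
    by_contra hne
    have h1 := hB u u.2 (by simpa using hne)
    have h2 : B₀ u u = 0 := by rw [hu]; rfl
    exact h1.ne' h2
  have hsurj := (LinearMap.injective_iff_surjective_of_finrank_eq_finrank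
    (Subspace.dual_finrank_eq (K := ℝ) (V := V₀)).symm).1 hinj
  obtain ⟨u, hu⟩ := hsurj (f ∘ₗ V₀.subtype)
  exact ⟨u, u.2, fun v hv => congrArg (fun l : Module.Dual ℝ V₀ => l ⟨v, hv⟩) hu⟩

end FiniteDimensionalForms

/-! ### The abstract scheme and its free energy estimates -/

/-- The bilinear forms of the discrete momentum equation. -/
structure Forms (d N : ℕ) (V : Type*) [NormedAddCommGroup V] [NormedSpace ℝ V] where
  /-- discretely divergence-free velocities -/
  V₀ : Submodule ℝ V
  /-- inertia -/
  mass : V →ₗ[ℝ] V →ₗ[ℝ] ℝ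
  /-- viscosity -/
  visc : V →ₗ[ℝ] V →ₗ[ℝ] ℝ
  /-- convection -/
  conv : V →ₗ[ℝ] V →ₗ[ℝ] V →ₗ[ℝ] ℝ
  /-- integral of the velocity gradient over each element -/
  gr : Fin N → V →ₗ[ℝ] Mat d
  /-- volume of each element -/
  vol : Fin N → ℝ
  mass_symm : ∀ u v, mass u v = mass v u
  mass_pos : ∀ v, v ≠ 0 → 0 < mass v v
  visc_pos : ∀ v, v ≠ 0 → 0 < visc v v
  vol_pos : ∀ k, 0 < vol k
  trace_gr : ∀ k, ∀ u ∈ V₀, (gr k u).trace = 0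
  conv_self : ∀ w ∈ V₀, ∀ u, conv w u u = 0

variable {d N : ℕ} {V : Type*} [NormedAddCommGroup V] [NormedSpace ℝ V]

/-- The coefficients of a discretization of the transport of piecewise constants by a velocity
(first argument) during a time step (second argument): `old` are the weights of the old values,
`flux` those of the upwind fluxes. -/
structure Transport (F : Forms d N V) where
  /-- weights of the old values -/
  old : V → ℝ → Fin N → Fin N → ℝ
  /-- upwind fluxes -/
  flux : V → ℝ → Fin N → Fin N → ℝ
  old_nonneg : ∀ w t k l, 0 ≤ old w t k l
  -- Inequalities suffice for rows and columns: missing mass acts as transport of the value `ψ = 0`,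
  -- whose entropy and norm are zero. Row sums bound the transported stress for every velocity;
  -- column sums and flux balance, which prevent creation of entropy, are required for solenoidal
  -- velocities only.
  old_row : ∀ w t k, ∑ l, old w t k l ≤ F.vol k
  old_col : ∀ w ∈ F.V₀, ∀ t, 0 < t → ∀ l, ∑ k, old w t k l ≤ F.vol l
  flux_nonneg : ∀ w t k l, 0 ≤ flux w t k l
  flux_bound : ∃ C, ∀ w t k l, flux w t k l ≤ C * ‖w‖
  flux_balance : ∀ w ∈ F.V₀, ∀ t k, ∑ l, flux w t l k = ∑ l, flux w t k l

/-- Physical parameters. -/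
structure Params where
  /-- Reynolds number -/
  Re : ℝ
  /-- Weissenberg number -/
  Wi : ℝ
  /-- elastic viscosity fraction -/
  ε : ℝ
  Re_nonneg : 0 ≤ Re
  Wi_pos : 0 < Wi
  ε_pos : 0 < ε
  ε_lt : ε < 1

namespace Transport
variable {F : Forms d N V} (T : Transport F) (P : Params)

/-- One step of the scheme in the space of discretely divergence-free velocities. -/
structure Step (t : ℝ) (Y Y' : V × (Fin N → Mat d)) : Prop where
  divFree : Y'.1 ∈ F.V₀
  symm : ∀ k, (Y'.2 k).IsSymm
  momentum : ∀ v ∈ F.V₀, P.Re * (t⁻¹ * (F.mass Y'.1 v - F.mass Y.1 v) + F.conv Y.1 Y'.1 v)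
    + (1 - P.ε) * F.visc Y'.1 v + P.ε / P.Wi * ∑ k, ddot (exp (Y'.2 k)) (F.gr k v) = 0
  stress : ∀ k, t⁻¹ • (F.vol k • Y'.2 k - ∑ l, T.old Y.1 t k l • Y.2 l)
    + ∑ l, T.flux Y.1 t l k • (Y'.2 k - Y'.2 l) - stretch (Y'.2 k) (F.gr k Y'.1)
    - (F.vol k / P.Wi) • (exp (-Y'.2 k) - 1) = 0

/-- The free energy. -/
def energy (F : Forms d N V) (P : Params) (Y : V × (Fin N → Mat d)) : ℝ :=
  P.Re / 2 * F.mass Y.1 Y.1 + P.ε / (2 * P.Wi) * ∑ k, F.vol k * entropy (Y.2 k)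

variable {T P}

/-- The discrete free energy balance. -/
lemma Step.balance {t : ℝ} (ht : 0 < t) {Y Y' : V × (Fin N → Mat d)} (hY : ∀ k, (Y.2 k).IsSymm)
    (h : T.Step P t Y Y') :
    P.Re * (t⁻¹ * (F.mass Y'.1 Y'.1 - F.mass Y.1 Y'.1) + F.conv Y.1 Y'.1 Y'.1)
      + (1 - P.ε) * F.visc Y'.1 Y'.1
      + P.ε / (2 * P.Wi) * (t⁻¹ * (∑ k, F.vol k * entropy (Y'.2 k)
            - ∑ k, ∑ l, T.old Y.1 t k l * entropy (Y.2 l))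
          + ∑ k, ∑ l, T.flux Y.1 t l k * (entropy (Y'.2 k) - entropy (Y'.2 l))) ≤ 0 := by
  have hWi := P.Wi_pos
  have hε := P.ε_pos
  have hm := h.momentum _ h.divFree
  have hs : ∀ k, t⁻¹ * (F.vol k * entropy (Y'.2 k) - ∑ l, T.old Y.1 t k l * entropy (Y.2 l))
      + ∑ l, T.flux Y.1 t l k * (entropy (Y'.2 k) - entropy (Y'.2 l))
      ≤ 2 * ddot (exp (Y'.2 k)) (F.gr k Y'.1) := by
    intro k
    -- The stress equation on `K_k` is tested with the gradient `e^ψ - I` of the entropy at the new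
    -- stress.
    have e := congrArg (fun A => ddot A (exp (Y'.2 k) - 1)) (h.stress k)
    simp only [ddot_sub_left, ddot_add_left, ddot_smul_left, ddot_zero_left, ddot_sum_left] at e
    rw [← ddot_sub_left, ddot_stretch_exp (h.symm k), F.trace_gr k _ h.divFree] at e
    have r : F.vol k / P.Wi * ddot (exp (-Y'.2 k) - 1) (exp (Y'.2 k) - 1) ≤ 0 :=
      mul_nonpos_of_nonneg_of_nonpos (div_nonneg (F.vol_pos k).le hWi.le)
        (ddot_relaxation_nonpos (h.symm k))
    have p1 : F.vol k * entropy (Y'.2 k) - ∑ l, T.old Y.1 t k l * entropy (Y.2 l)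
        ≤ F.vol k * ddot (Y'.2 k) (exp (Y'.2 k) - 1)
          - ∑ l, T.old Y.1 t k l * ddot (Y.2 l) (exp (Y'.2 k) - 1) := by
      have a1 : ∀ l, T.old Y.1 t k l * (entropy (Y'.2 k) - entropy (Y.2 l))
          ≤ T.old Y.1 t k l * (ddot (Y'.2 k) (exp (Y'.2 k) - 1)
            - ddot (Y.2 l) (exp (Y'.2 k) - 1)) := by
        intro l
        rw [← ddot_sub_left]
        exact mul_le_mul_of_nonneg_left (entropy_sub_le (h.symm k) (hY l)) (T.old_nonneg _ _ _ _)
      -- Klein's inequality against `ψ = 0` takes care of the part of the volume of `K_k` that the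
      -- row of old weights does not fill.
      have a2 : entropy (Y'.2 k) ≤ ddot (Y'.2 k) (exp (Y'.2 k) - 1) := by
        have := entropy_sub_le (h.symm k) (B := 0) (by simp [Matrix.IsSymm])
        simpa [entropy_zero] using this
      have a3 := Finset.sum_le_sum fun l (_ : l ∈ Finset.univ) => a1 l
      simp only [mul_sub, Finset.sum_sub_distrib, ← Finset.sum_mul] at a3
      have a4 := mul_le_mul_of_nonneg_left a2 (sub_nonneg.2 (T.old_row Y.1 t k))
      nlinarith
    have p2 : ∑ l, T.flux Y.1 t l k * (entropy (Y'.2 k) - entropy (Y'.2 l))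
        ≤ ∑ l, T.flux Y.1 t l k * (ddot (Y'.2 k) (exp (Y'.2 k) - 1)
            - ddot (Y'.2 l) (exp (Y'.2 k) - 1)) := by
      refine Finset.sum_le_sum fun l _ => ?_
      rw [← ddot_sub_left]
      exact mul_le_mul_of_nonneg_left (entropy_sub_le (h.symm k) (h.symm l)) (T.flux_nonneg _ _ _ _)
    have p3 := mul_le_mul_of_nonneg_left p1 (inv_nonneg.2 ht.le)
    linarith
  have hsum := Finset.sum_le_sum fun k (_ : k ∈ Finset.univ) => hs k
  rw [Finset.sum_add_distrib, ← Finset.mul_sum, ← Finset.mul_sum, Finset.sum_sub_distrib] at hsum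
  -- With the weight `ε / (2 Wi)` the work of the stretching term equals the elastic term of the
  -- momentum equation, and they cancel in the sum.
  have h2 := mul_le_mul_of_nonneg_left hsum (by positivity : 0 ≤ P.ε / (2 * P.Wi))
  have e : P.ε / (2 * P.Wi) * (2 * ∑ k, ddot (exp (Y'.2 k)) (F.gr k Y'.1))
      = P.ε / P.Wi * ∑ k, ddot (exp (Y'.2 k)) (F.gr k Y'.1) := by
    field_simp
  rw [e] at h2
  linarith

lemma mass_nonneg (F : Forms d N V) (v : V) : 0 ≤ F.mass v v := by
  rcases eq_or_ne v 0 with rfl | h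
  · simp
  · exact (F.mass_pos v h).le

lemma visc_nonneg (F : Forms d N V) (v : V) : 0 ≤ F.visc v v := by
  rcases eq_or_ne v 0 with rfl | h
  · simp
  · exact (F.visc_pos v h).le

lemma mass_sub_le (F : Forms d N V) (u w : V) :
    (F.mass u u - F.mass w w) / 2 ≤ F.mass u u - F.mass w u := by
  have := mass_nonneg F (u - w)
  simp only [map_sub, LinearMap.sub_apply, F.mass_symm u w] at this
  linarith

lemma Step.entropy_nonneg {t : ℝ} {Y Y' : V × (Fin N → Mat d)} (h : T.Step P t Y Y') :
    0 ≤ ∑ k, F.vol k * entropy (Y'.2 k) :=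
  Finset.sum_nonneg fun k _ => mul_nonneg (F.vol_pos k).le (OldroydLog.entropy_nonneg (h.symm k))

/-- The free energy is nonincreasing. -/
lemma Step.energy_le {t : ℝ} (ht : 0 < t) {Y Y' : V × (Fin N → Mat d)}
    (hY : ∀ k, (Y.2 k).IsSymm) (hY₀ : Y.1 ∈ F.V₀) (h : T.Step P t Y Y') :
    energy F P Y' ≤ energy F P Y := by
  have hb := h.balance ht hY
  rw [F.conv_self _ hY₀, add_zero] at hb
  have h1 : ∑ k, ∑ l, T.old Y.1 t k l * entropy (Y.2 l) ≤ ∑ k, F.vol k * entropy (Y.2 k) := by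
    rw [Finset.sum_comm]
    refine Finset.sum_le_sum fun l _ => ?_
    rw [← Finset.sum_mul]
    exact mul_le_mul_of_nonneg_right (T.old_col _ hY₀ t ht l) (OldroydLog.entropy_nonneg (hY l))
  -- In the sum, the entropy of each element is multiplied by its total inflow minus its total
  -- outflow, which is zero.
  have h2 : ∑ k, ∑ l, T.flux Y.1 t l k * (entropy (Y'.2 k) - entropy (Y'.2 l)) = 0 := by
    simp only [mul_sub, Finset.sum_sub_distrib, ← Finset.sum_mul]
    conv_lhs => enter [2]; rw [Finset.sum_comm]
    simp only [← Finset.sum_mul, T.flux_balance _ hY₀ t, sub_self]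
  rw [h2, add_zero] at hb
  have hv := mul_nonneg (sub_nonneg.2 P.ε_lt.le) (visc_nonneg F Y'.1)
  have hm := mul_le_mul_of_nonneg_left (mass_sub_le F Y'.1 Y.1) P.Re_nonneg
  have hWi := P.Wi_pos
  have hε := P.ε_pos
  have h3 := mul_le_mul_of_nonneg_left h1 (by positivity : 0 ≤ P.ε / (2 * P.Wi))
  have h4 : t⁻¹ * (P.Re * (F.mass Y'.1 Y'.1 - F.mass Y.1 Y'.1)
      + P.ε / (2 * P.Wi) * (∑ k, F.vol k * entropy (Y'.2 k)
            - ∑ k, ∑ l, T.old Y.1 t k l * entropy (Y.2 l))) ≤ 0 := by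
    linarith
  have h5 := nonpos_of_mul_nonpos_right h4 (inv_pos.2 ht)
  unfold energy
  linarith

variable [FiniteDimensional ℝ V]

variable (T P) in
/-- The free energy after one step from arbitrary data is bounded for small time steps. -/
lemma exists_energy_bound (Y : V × (Fin N → Mat d)) (hY : ∀ k, (Y.2 k).IsSymm) :
    ∃ c K : ℝ, 0 < c ∧ ∀ t, 0 < t → t < c → ∀ Y', T.Step P t Y Y' → energy F P Y' ≤ K := by
  obtain ⟨Cc, hCc0, hCc⟩ := exists_bound_trilinear F.conv
  obtain ⟨μ, hμ0, hμ⟩ := exists_coercive F.mass F.mass_pos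
  obtain ⟨Cf, hCf⟩ := T.flux_bound
  have hWi := P.Wi_pos
  have hε := P.ε_pos
  have hRe := P.Re_nonneg
  set vi : ℝ := ∑ k, (F.vol k)⁻¹
  have hvi0 : 0 ≤ vi := Finset.sum_nonneg fun k _ => inv_nonneg.2 (F.vol_pos k).le
  -- A growth rate for data that may not be solenoidal: the first term compares the work of
  -- convection with the kinetic energy, the second the unbalanced upwind fluxes with the total
  -- entropy.
  set q : ℝ := 2 * (Cc * ‖Y.1‖ / μ) + N * (|Cf| * ‖Y.1‖) * vi
  have hq0 : 0 ≤ q := by positivity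
  -- Column sums are not available here, so each weight `old k l` is bounded by the volume of `K_k`
  -- alone.
  set K₀ : ℝ := P.Re / 2 * F.mass Y.1 Y.1
    + P.ε / (2 * P.Wi) * ∑ k, F.vol k * ∑ l, entropy (Y.2 l)
  have hvol := fun k => (F.vol_pos k)
  -- For these steps `q t ≤ 1 / 2`, and `(1 - q t) E ≤ K₀` with `E ≥ 0` yields `E ≤ 2 K₀`.
  refine ⟨(2 * (q + 1))⁻¹, 2 * K₀, by positivity, fun t ht htc Y' h => ?_⟩
  have hb := h.balance ht hY
  have hE : 0 ≤ energy F P Y' := by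
    have := h.entropy_nonneg
    have := mass_nonneg F Y'.1
    unfold energy; positivity
  have hconv : -(2 * (Cc * ‖Y.1‖ / μ)) * (F.mass Y'.1 Y'.1 / 2) ≤ F.conv Y.1 Y'.1 Y'.1 := by
    have h1 := (abs_le.1 (hCc Y.1 Y'.1 Y'.1)).1
    have h2 : Cc * ‖Y.1‖ * ‖Y'.1‖ * ‖Y'.1‖ ≤ Cc * ‖Y.1‖ / μ * F.mass Y'.1 Y'.1 := by
      calc _ = Cc * ‖Y.1‖ / μ * (μ * ‖Y'.1‖ ^ 2) := by field_simp
        _ ≤ _ := by gcongr; exact hμ _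
    linarith
  have hold : ∑ k, ∑ l, T.old Y.1 t k l * entropy (Y.2 l)
      ≤ ∑ k, F.vol k * ∑ l, entropy (Y.2 l) := by
    refine Finset.sum_le_sum fun k _ => ?_
    rw [Finset.mul_sum]
    refine Finset.sum_le_sum fun l _ => mul_le_mul_of_nonneg_right ?_
      (OldroydLog.entropy_nonneg (hY l))
    exact (Finset.single_le_sum (fun l _ => T.old_nonneg Y.1 t k l) (Finset.mem_univ l)).trans
      (T.old_row _ _ _)
  have hflux : -(N * (|Cf| * ‖Y.1‖) * vi) * ∑ k, F.vol k * entropy (Y'.2 k)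
      ≤ ∑ k, ∑ l, T.flux Y.1 t l k * (entropy (Y'.2 k) - entropy (Y'.2 l)) := by
    have hent := fun k => OldroydLog.entropy_nonneg (h.symm k)
    have hfl : ∀ k l, T.flux Y.1 t k l ≤ |Cf| * ‖Y.1‖ := fun k l =>
      (hCf _ _ _ _).trans (by gcongr; exact le_abs_self _)
    have h1 : ∀ k l, -((|Cf| * ‖Y.1‖) * entropy (Y'.2 l))
        ≤ T.flux Y.1 t l k * (entropy (Y'.2 k) - entropy (Y'.2 l)) := by
      intro k l
      have a1 := mul_nonneg (T.flux_nonneg Y.1 t l k) (hent k)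
      have a2 := mul_le_mul_of_nonneg_right (hfl l k) (hent l)
      linarith
    have h2 : ∀ l, entropy (Y'.2 l) ≤ vi * (F.vol l * entropy (Y'.2 l)) := by
      intro l
      have : (F.vol l)⁻¹ ≤ vi := Finset.single_le_sum
        (fun k _ => inv_nonneg.2 (F.vol_pos k).le) (Finset.mem_univ l)
      have a3 := mul_le_mul_of_nonneg_right this (mul_nonneg (hvol l).le (hent l))
      rwa [inv_mul_cancel_left₀ (hvol l).ne'] at a3
    calc -(N * (|Cf| * ‖Y.1‖) * vi) * ∑ k, F.vol k * entropy (Y'.2 k)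
        = ∑ _k : Fin N, ∑ l, -((|Cf| * ‖Y.1‖) * (vi * (F.vol l * entropy (Y'.2 l)))) := by
          simp only [Finset.sum_const, Finset.card_univ, Fintype.card_fin, nsmul_eq_mul,
            Finset.sum_neg_distrib, ← Finset.mul_sum]
          ring
      _ ≤ _ := by
          refine Finset.sum_le_sum fun k _ => Finset.sum_le_sum fun l _ => (?_ : _ ≤ _).trans (h1 k l)
          have := mul_le_mul_of_nonneg_left (h2 l) (by positivity : 0 ≤ |Cf| * ‖Y.1‖)
          linarith
  set S := ∑ k, F.vol k * entropy (Y'.2 k) with hS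
  have hS0 : 0 ≤ S := h.entropy_nonneg
  set m := F.mass Y'.1 Y'.1 with hm
  have hm0 : 0 ≤ m := mass_nonneg F Y'.1
  have hv := mul_nonneg (sub_nonneg.2 P.ε_lt.le) (visc_nonneg F Y'.1)
  have hms := mass_sub_le F Y'.1 Y.1
  set e := P.ε / (2 * P.Wi)
  have he : 0 ≤ e := by positivity
  have k1 : t⁻¹ * (energy F P Y' - K₀) - q * energy F P Y' ≤ 0 := by
    have b1 := mul_le_mul_of_nonneg_left hconv hRe
    have b2 := mul_le_mul_of_nonneg_left hflux he
    have b3 := mul_le_mul_of_nonneg_left hms (mul_nonneg hRe (inv_nonneg.2 ht.le))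
    have b4 := mul_le_mul_of_nonneg_left hold (mul_nonneg he (inv_nonneg.2 ht.le))
    have b5 : 0 ≤ N * (|Cf| * ‖Y.1‖) * vi * (P.Re * m / 2) := by positivity
    have b6 : 0 ≤ 2 * (Cc * ‖Y.1‖ / μ) * (e * S) := by positivity
    simp only [energy, ← hS, ← hm, K₀, q]
    linarith
  have k2 : q * t ≤ 1 / 2 := by
    have : t * (2 * (q + 1)) < 1 := by
      have := mul_lt_mul_of_pos_right htc (by positivity : 0 < 2 * (q + 1))
      rwa [inv_mul_cancel₀ (by positivity)] at this
    nlinarith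
  have k3 : energy F P Y' - K₀ - q * t * energy F P Y' ≤ 0 := by
    have := mul_le_mul_of_nonneg_left k1 ht.le
    rw [mul_zero, mul_sub, mul_inv_cancel_left₀ ht.ne'] at this
    linarith
  nlinarith

variable (T P) in
/-- Solutions with bounded free energy are bounded. -/
lemma exists_bound_of_energy (K : ℝ) : ∃ R : ℝ, ∀ t, ∀ Y Y', T.Step P t Y Y' →
    energy F P Y' ≤ K → ‖Y'.1‖ ≤ R ∧ ∀ k, ‖Y'.2 k‖ ≤ R := by
  obtain ⟨μ, hμ0, hμ⟩ := exists_coercive F.mass F.mass_pos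
  obtain ⟨γ, hγ0, hγ⟩ := exists_coercive F.visc F.visc_pos
  choose Cg hCg0 hCg using fun k => exists_bound_linear (F.gr k)
  have hWi := P.Wi_pos
  have hε := P.ε_pos
  have hε1 := sub_pos.2 P.ε_lt
  have hRe := P.Re_nonneg
  set vi : ℝ := ∑ k, (F.vol k)⁻¹
  set R₁ : ℝ := |K| * (2 * P.Wi / P.ε) * vi + d
  obtain ⟨Ce, hCe1, hCe⟩ := exists_exp_bound d R₁
  have hCe0 : 0 ≤ Ce := zero_le_one.trans hCe1
  set R₂ : ℝ := P.ε / P.Wi * (∑ k, Ce * Cg k) / ((1 - P.ε) * γ)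
  set R₃ : ℝ := |K| * 2 / (P.Re * μ) + 1
  refine ⟨max R₁ (max R₂ R₃), fun t Y Y' h hE => ?_⟩
  have hS := h.entropy_nonneg
  have hent := fun k => OldroydLog.entropy_nonneg (h.symm k)
  have hm0 := mass_nonneg F Y'.1
  unfold energy at hE
  have hψ : ∀ k, ‖Y'.2 k‖ ≤ R₁ := by
    intro k
    refine (norm_le_entropy (h.symm k)).trans (add_le_add ?_ le_rfl)
    have h1 : P.ε / (2 * P.Wi) * ∑ k, F.vol k * entropy (Y'.2 k) ≤ |K| := by
      have : 0 ≤ P.Re / 2 * F.mass Y'.1 Y'.1 := by positivity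
      linarith [le_abs_self K]
    have h2 : F.vol k * entropy (Y'.2 k) ≤ ∑ k, F.vol k * entropy (Y'.2 k) :=
      Finset.single_le_sum (f := fun k => F.vol k * entropy (Y'.2 k))
        (fun k _ => mul_nonneg (F.vol_pos k).le (hent k)) (Finset.mem_univ k)
    have h3 : (F.vol k)⁻¹ ≤ vi := Finset.single_le_sum
        (fun k _ => inv_nonneg.2 (F.vol_pos k).le) (Finset.mem_univ k)
    have hvk := F.vol_pos k
    calc entropy (Y'.2 k) = (F.vol k * entropy (Y'.2 k)) * (F.vol k)⁻¹ := by field_simp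
      _ ≤ (∑ k, F.vol k * entropy (Y'.2 k)) * vi := by gcongr
      _ = (P.ε / (2 * P.Wi) * ∑ k, F.vol k * entropy (Y'.2 k)) * (2 * P.Wi / P.ε) * vi := by
          field_simp
      _ ≤ _ := by
          have : 0 ≤ vi := (inv_nonneg.2 hvk.le).trans h3
          gcongr
  refine ⟨?_, fun k => (hψ k).trans (le_max_left _ _)⟩
  -- When `Re = 0` the energy does not see the velocity. It is then bounded through the momentum
  -- equation tested with the velocity: viscosity dominates the elastic load, which is bounded since
  -- the stress is.
  rcases hRe.eq_or_lt with h0 | h0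
  · have hm := h.momentum _ h.divFree
    rw [← h0, zero_mul, zero_add] at hm
    have h1 : -∑ k, ddot (exp (Y'.2 k)) (F.gr k Y'.1) ≤ (∑ k, Ce * Cg k) * ‖Y'.1‖ := by
      rw [← Finset.sum_neg_distrib, Finset.sum_mul]
      refine Finset.sum_le_sum fun k _ => ?_
      refine (neg_le_abs _).trans ((abs_ddot_le _ _).trans ?_)
      calc ‖exp (Y'.2 k)‖ * ‖F.gr k Y'.1‖ ≤ Ce * (Cg k * ‖Y'.1‖) := by
            gcongr
            · exact hCe _ (hψ k)
            · exact hCg k _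
        _ = _ := by ring
    have h2 := mul_le_mul_of_nonneg_left (hγ Y'.1) hε1.le
    have h3 := mul_le_mul_of_nonneg_left h1 (by positivity : 0 ≤ P.ε / P.Wi)
    have h4 : ‖Y'.1‖ * ((1 - P.ε) * γ * ‖Y'.1‖) ≤ ‖Y'.1‖ * (P.ε / P.Wi * (∑ k, Ce * Cg k)) := by
      nlinarith
    refine le_trans ?_ ((le_max_left R₂ R₃).trans (le_max_right _ _))
    rcases (norm_nonneg Y'.1).eq_or_lt with hn | hn
    · rw [← hn]
      have : 0 ≤ ∑ k, Ce * Cg k := Finset.sum_nonneg fun k _ => mul_nonneg hCe0 (hCg0 k)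
      positivity
    · have := le_of_mul_le_mul_left h4 hn
      rw [le_div_iff₀ (by positivity)]
      linarith
  · refine le_trans ?_ ((le_max_right R₂ R₃).trans (le_max_right _ _))
    have h1 : P.Re / 2 * (μ * ‖Y'.1‖ ^ 2) ≤ |K| := by
      have := mul_le_mul_of_nonneg_left (hμ Y'.1) (by positivity : 0 ≤ P.Re / 2)
      have h2 : 0 ≤ P.ε / (2 * P.Wi) * ∑ k, F.vol k * entropy (Y'.2 k) := by positivity
      linarith [le_abs_self K]
    have h2 : ‖Y'.1‖ ^ 2 ≤ |K| * 2 / (P.Re * μ) := by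
      rw [le_div_iff₀ (by positivity)]
      linarith
    simp only [R₃]
    nlinarith [sq_nonneg (‖Y'.1‖ - 1)]

end Transport
end OldroydLog
end

noncomputable section
namespace OldroydLog
open scoped Matrix.Norms.Frobenius
open NormedSpace (exp)
-- Solving one step by contraction, and all steps by the energy
namespace Transport
variable {d N : ℕ} {V : Type*} [NormedAddCommGroup V] [NormedSpace ℝ V] [FiniteDimensional ℝ V]
variable {F : Forms d N V} (T : Transport F) (P : Params)

/-- The bilinear form of the momentum equation. -/
def momentumForm (F : Forms d N V) (P : Params) (t : ℝ) (w : V) : V →ₗ[ℝ] V →ₗ[ℝ] ℝ :=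
  P.Re • (t⁻¹ • F.mass + F.conv w) + (1 - P.ε) • F.visc

/-- The elastic load of the momentum equation. -/
def elasticLoad (F : Forms d N V) (P : Params) (ψ : Fin N → Mat d) : V →ₗ[ℝ] ℝ :=
  -(P.ε / P.Wi) • ∑ k, (ddotₗ (exp (ψ k))) ∘ₗ F.gr k


lemma elasticLoad_apply (ψ : Fin N → Mat d) (v : V) :
    elasticLoad F P ψ v = -(P.ε / P.Wi * ∑ k, ddot (exp (ψ k)) (F.gr k v)) := by
  simp [elasticLoad, ddotₗ_apply]

lemma momentum_iff {t : ℝ} {w u v : V} {ψ : Fin N → Mat d} :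
    P.Re * (t⁻¹ * (F.mass u v - F.mass w v) + F.conv w u v)
      + (1 - P.ε) * F.visc u v + P.ε / P.Wi * ∑ k, ddot (exp (ψ k)) (F.gr k v) = 0 ↔
    momentumForm F P t w u v = ((P.Re * t⁻¹) • F.mass w + elasticLoad F P ψ) v := by
  simp only [momentumForm, LinearMap.add_apply, LinearMap.smul_apply, smul_eq_mul,
    elasticLoad_apply]
  constructor <;> intro h <;> linarith

lemma exists_elasticLoad_bound (F : Forms d N V) (P : Params) (R : ℝ) : ∃ C, 0 ≤ C ∧
    (∀ ψ : Fin N → Mat d, ‖ψ‖ ≤ R → ∀ v, |elasticLoad F P ψ v| ≤ C * ‖v‖) ∧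
    (∀ ψ ψ' : Fin N → Mat d, ‖ψ‖ ≤ R → ‖ψ'‖ ≤ R → ∀ v,
      |elasticLoad F P ψ v - elasticLoad F P ψ' v| ≤ C * ‖ψ - ψ'‖ * ‖v‖) := by
  obtain ⟨Ce, hCe1, hCe⟩ := exists_exp_bound d R
  choose Cg hCg0 hCg using fun k => exists_bound_linear (F.gr k)
  have hCe0 : 0 ≤ Ce := zero_le_one.trans hCe1
  have hWi := P.Wi_pos
  have hε := P.ε_pos
  have hk : ∀ {ψ : Fin N → Mat d}, ‖ψ‖ ≤ R → ∀ k, ‖ψ k‖ ≤ R := fun h k => (norm_le_pi_norm _ k).trans h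
  have hsum0 : 0 ≤ ∑ k, Cg k := Finset.sum_nonneg fun k _ => hCg0 k
  have hle : Ce ≤ Ce ^ 2 := by nlinarith
  refine ⟨P.ε / P.Wi * (Ce ^ 2 * ∑ k, Cg k), by positivity, fun ψ hψ v => ?_, fun ψ ψ' hψ hψ' v => ?_⟩
  · rw [elasticLoad_apply, abs_neg, abs_mul, abs_of_pos (by positivity), mul_assoc, mul_assoc]
    gcongr
    rw [Finset.sum_mul, Finset.mul_sum]
    refine (Finset.abs_sum_le_sum_abs _ _).trans (Finset.sum_le_sum fun k _ => ?_)
    refine (abs_ddot_le _ _).trans ?_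
    gcongr
    · exact (hCe _ (hk hψ k)).trans hle
    · exact hCg k v
  · have e : elasticLoad F P ψ v - elasticLoad F P ψ' v
        = -(P.ε / P.Wi * ∑ k, ddot (exp (ψ k) - exp (ψ' k)) (F.gr k v)) := by
      simp only [elasticLoad_apply, ddot_sub_left, Finset.sum_sub_distrib]; ring
    rw [e, abs_neg, abs_mul, abs_of_pos (by positivity), mul_assoc, mul_assoc]
    gcongr
    calc |∑ k, ddot (exp (ψ k) - exp (ψ' k)) (F.gr k v)|
        ≤ ∑ k, (Ce ^ 2 * ‖ψ - ψ'‖) * (Cg k * ‖v‖) := by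
          refine (Finset.abs_sum_le_sum_abs _ _).trans (Finset.sum_le_sum fun k _ => ?_)
          refine (abs_ddot_le _ _).trans ?_
          gcongr
          · refine (norm_exp_sub_le hCe (hk hψ k) (hk hψ' k)).trans ?_
            gcongr
            exact norm_le_pi_norm (ψ - ψ') k
          · exact hCg k v
      _ = _ := by rw [← Finset.mul_sum, ← Finset.sum_mul]; ring

/-- Coercivity, uniformly for small time steps. -/
lemma exists_momentum_coercive (F : Forms d N V) (P : Params) (R : ℝ) :
    ∃ c a b : ℝ, 0 < c ∧ 0 < a ∧ 0 < b ∧ ∀ t, 0 < t → t < c → ∀ w, ‖w‖ ≤ R → ∀ u,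
      (P.Re * t⁻¹ * a + b) * ‖u‖ ^ 2 ≤ momentumForm F P t w u u := by
  obtain ⟨μ, hμ0, hμ⟩ := exists_coercive F.mass F.mass_pos
  obtain ⟨γ, hγ0, hγ⟩ := exists_coercive F.visc F.visc_pos
  obtain ⟨Cc, hCc0, hCc⟩ := exists_bound_trilinear F.conv
  have hε1 := sub_pos.2 P.ε_lt
  have hRe := P.Re_nonneg
  refine ⟨μ / (2 * (Cc * |R| + 1)), μ / 2, (1 - P.ε) * γ, by positivity, by positivity,
    by positivity, fun t ht htc w hw u => ?_⟩
  -- Below the chosen threshold half of the inertia absorbs the convection, whose advecting field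
  -- `w` need not be solenoidal here.
  have h1 : Cc * |R| ≤ t⁻¹ * (μ / 2) := by
    have : t * (2 * (Cc * |R| + 1)) < μ := by
      rwa [lt_div_iff₀ (by positivity)] at htc
    rw [inv_mul_eq_div, le_div_iff₀ ht]
    nlinarith
  have h2 : -(Cc * |R| * ‖u‖ ^ 2) ≤ F.conv w u u := by
    have := (abs_le.1 (hCc w u u)).1
    have h3 : Cc * ‖w‖ * ‖u‖ * ‖u‖ ≤ Cc * |R| * ‖u‖ ^ 2 := by
      rw [mul_assoc _ ‖u‖, ← pow_two]
      gcongr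
      exact hw.trans (le_abs_self _)
    linarith
  have h3 := mul_le_mul_of_nonneg_right h1 (sq_nonneg ‖u‖)
  have h4 := mul_le_mul_of_nonneg_left (hμ u) (inv_nonneg.2 ht.le)
  have h5 := mul_le_mul_of_nonneg_left (hγ u) hε1.le
  have h6 : t⁻¹ * (μ / 2) * ‖u‖ ^ 2 ≤ t⁻¹ * F.mass u u + F.conv w u u := by linarith
  have h7 := mul_le_mul_of_nonneg_left h6 hRe
  simp only [momentumForm, LinearMap.add_apply, LinearMap.smul_apply, smul_eq_mul]
  linarith

/-- The velocity as a Lipschitz function of the stress, uniformly for small time steps. -/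
lemma exists_velocity_bound (F : Forms d N V) (P : Params) (R R₁ : ℝ) :
    ∃ c C : ℝ, 0 < c ∧ 0 ≤ C ∧ ∀ t, 0 < t → t < c → ∀ w, ‖w‖ ≤ R →
      (∀ f : V →ₗ[ℝ] ℝ, ∃ u ∈ F.V₀, ∀ v ∈ F.V₀, momentumForm F P t w u v = f v) ∧
      (∀ ψ : Fin N → Mat d, ‖ψ‖ ≤ R₁ → ∀ u ∈ F.V₀,
        (∀ v ∈ F.V₀, momentumForm F P t w u v = ((P.Re * t⁻¹) • F.mass w + elasticLoad F P ψ) v) →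
        ‖u‖ ≤ C) ∧
      (∀ ψ ψ' : Fin N → Mat d, ‖ψ‖ ≤ R₁ → ‖ψ'‖ ≤ R₁ → ∀ u ∈ F.V₀, ∀ u' ∈ F.V₀,
        (∀ v ∈ F.V₀, momentumForm F P t w u v = ((P.Re * t⁻¹) • F.mass w + elasticLoad F P ψ) v) →
        (∀ v ∈ F.V₀, momentumForm F P t w u' v = ((P.Re * t⁻¹) • F.mass w + elasticLoad F P ψ') v) →
        ‖u - u'‖ ≤ C * ‖ψ - ψ'‖) := by
  obtain ⟨c, a, b, hc, ha, hb, hcoer⟩ := exists_momentum_coercive F P R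
  obtain ⟨Cl, hCl0, hCl, hCl'⟩ := exists_elasticLoad_bound F P R₁
  obtain ⟨Cm, hCm0, hCm⟩ := exists_bound_bilinear F.mass
  have hRe := P.Re_nonneg
  -- The load and the coercivity have the same two scales, `Re / t` and `1`. Comparing them
  -- separately gives a constant that depends on neither `t` nor the vanishing of `Re`. In
  -- differences the inertial load cancels and only `Cl / b` is needed.
  refine ⟨c, Cm * |R| / a + Cl / b, hc, by positivity, fun t ht htc w hw => ⟨fun f => ?_, ?_, ?_⟩⟩
  · refine exists_solution_of_pos F.V₀ _ (fun v _ hv => lt_of_lt_of_le ?_ (hcoer t ht htc w hw v)) f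
    have := norm_pos_iff.2 hv
    positivity
  · intro ψ hψ u hu h
    have h1 := h u hu
    have h2 := hcoer t ht htc w hw u
    simp only [LinearMap.add_apply, LinearMap.smul_apply, smul_eq_mul] at h1
    have h3 := (le_abs_self _).trans (hCl ψ hψ u)
    have h4 : F.mass w u ≤ Cm * |R| * ‖u‖ := by
      refine (le_abs_self _).trans ((hCm w u).trans ?_)
      gcongr
      exact hw.trans (le_abs_self _)
    have h5 := mul_le_mul_of_nonneg_left h4 (mul_nonneg hRe (inv_nonneg.2 ht.le))
    by_contra hlt
    push Not at hlt
    have hu0 : 0 < ‖u‖ := lt_of_le_of_lt (by positivity) hlt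
    have k1 : Cm * |R| < a * ‖u‖ := by
      have : Cm * |R| / a < ‖u‖ := lt_of_le_of_lt (le_add_of_nonneg_right (by positivity)) hlt
      rwa [div_lt_iff₀' ha] at this
    have k2 : Cl < b * ‖u‖ := by
      have : Cl / b < ‖u‖ := lt_of_le_of_lt (le_add_of_nonneg_left (by positivity)) hlt
      rwa [div_lt_iff₀' hb] at this
    have k3 := mul_lt_mul_of_pos_right k2 hu0
    have k4 := mul_le_mul_of_nonneg_left (mul_le_mul_of_nonneg_right k1.le hu0.le)
      (mul_nonneg hRe (inv_nonneg.2 ht.le))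
    nlinarith
  · intro ψ ψ' hψ hψ' u hu u' hu' h h'
    have hd : u - u' ∈ F.V₀ := sub_mem hu hu'
    have h1 : momentumForm F P t w (u - u') (u - u')
        = elasticLoad F P ψ (u - u') - elasticLoad F P ψ' (u - u') := by
      rw [map_sub (momentumForm F P t w), LinearMap.sub_apply, h _ hd, h' _ hd,
        LinearMap.add_apply, LinearMap.add_apply]
      ring
    have h2 := hcoer t ht htc w hw (u - u')
    have h3 := (le_abs_self _).trans (hCl' ψ ψ' hψ hψ' (u - u'))
    have h4 : 0 ≤ P.Re * t⁻¹ * a * ‖u - u'‖ ^ 2 := by positivity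
    have h5 : b * ‖u - u'‖ ^ 2 ≤ Cl * ‖ψ - ψ'‖ * ‖u - u'‖ := by linarith
    have h6 : ‖u - u'‖ ≤ Cl / b * ‖ψ - ψ'‖ := by
      rcases (norm_nonneg (u - u')).eq_or_lt with h0 | h0
      · rw [← h0]; positivity
      · have : b * ‖u - u'‖ ≤ Cl * ‖ψ - ψ'‖ := by
          refine le_of_mul_le_mul_right ?_ h0
          linarith
        rw [div_mul_eq_mul_div, le_div_iff₀ hb]; linarith
    refine h6.trans ?_
    gcongr
    exact le_add_of_nonneg_left (by positivity)

/-- The right-hand side of the evolution equation of the stress. -/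
def stressRate (t : ℝ) (w u : V) (ψ : Fin N → Mat d) : Fin N → Mat d := fun k =>
  (F.vol k)⁻¹ • (stretch (ψ k) (F.gr k u) + (F.vol k / P.Wi) • (exp (-ψ k) - 1)
    - ∑ l, T.flux w t l k • (ψ k - ψ l))

lemma stressRate_symm (t : ℝ) (w u : V) {ψ : Fin N → Mat d} (hψ : ∀ k, (ψ k).IsSymm) (k : Fin N) :
    (stressRate T P t w u ψ k).IsSymm := by
  have h1 : (exp (-ψ k)).IsSymm := exp_symm (hψ k).neg
  refine Matrix.IsSymm.smul (Matrix.IsSymm.sub (Matrix.IsSymm.add (stretch_symm (hψ k) _)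
    (Matrix.IsSymm.smul (h1.sub Matrix.isSymm_one) _)) ?_) _
  rw [Matrix.IsSymm, Matrix.transpose_sum]
  refine Finset.sum_congr rfl fun l _ => ?_
  rw [Matrix.transpose_smul, Matrix.transpose_sub, (hψ k).eq, (hψ l).eq]

/-- The implicit equation becomes a fixed-point equation: the averaged old stress plus `t` times a
rate evaluated at the new state. -/
lemma stress_iff {t : ℝ} (ht : 0 < t) {Y Y' : V × (Fin N → Mat d)} (k : Fin N) :
    t⁻¹ • (F.vol k • Y'.2 k - ∑ l, T.old Y.1 t k l • Y.2 l)
      + ∑ l, T.flux Y.1 t l k • (Y'.2 k - Y'.2 l) - stretch (Y'.2 k) (F.gr k Y'.1)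
      - (F.vol k / P.Wi) • (exp (-Y'.2 k) - 1) = 0 ↔
    Y'.2 k = (F.vol k)⁻¹ • ∑ l, T.old Y.1 t k l • Y.2 l
      + t • stressRate T P t Y.1 Y'.1 Y'.2 k := by
  have hv := (F.vol_pos k).ne'
  unfold stressRate
  set A := ∑ l, T.old Y.1 t k l • Y.2 l
  set B := ∑ l, T.flux Y.1 t l k • (Y'.2 k - Y'.2 l)
  set C := stretch (Y'.2 k) (F.gr k Y'.1)
  set D := (F.vol k / P.Wi) • (exp (-Y'.2 k) - 1)
  have e : t⁻¹ • (F.vol k • Y'.2 k - A) + B - C - D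
      = (F.vol k * t⁻¹) • (Y'.2 k - ((F.vol k)⁻¹ • A + t • (F.vol k)⁻¹ • (C + D - B))) := by
    have e1 : F.vol k * t⁻¹ * (F.vol k)⁻¹ = t⁻¹ := by field_simp
    have e2 : F.vol k * t⁻¹ * (t * (F.vol k)⁻¹) = 1 := by field_simp
    simp only [smul_sub, smul_add, smul_smul, e1, e2]
    module
  rw [e, smul_eq_zero_iff_right (by positivity), sub_eq_zero]

/-- Stretching, relaxation and fluxes are bounded and Lipschitz on bounded sets. The constant is
uniform in `t`, so the factor `t` in front of the rate makes it a contraction. -/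
lemma exists_stressRate_bound (R R₁ Ru : ℝ) : ∃ C, 0 ≤ C ∧ ∀ t w, ‖w‖ ≤ R →
    (∀ ψ : Fin N → Mat d, (∀ k, (ψ k).IsSymm) → ‖ψ‖ ≤ R₁ → ∀ u, ‖u‖ ≤ Ru →
      ‖stressRate T P t w u ψ‖ ≤ C) ∧
    (∀ ψ ψ' : Fin N → Mat d, (∀ k, (ψ k).IsSymm) → (∀ k, (ψ' k).IsSymm) → ‖ψ‖ ≤ R₁ → ‖ψ'‖ ≤ R₁ →
      ∀ u u', ‖u‖ ≤ Ru → ‖u'‖ ≤ Ru →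
      ‖stressRate T P t w u ψ - stressRate T P t w u' ψ'‖ ≤ C * (‖ψ - ψ'‖ + ‖u - u'‖)) := by
  obtain ⟨Ce, hCe1, hCe⟩ := exists_exp_bound d R₁
  obtain ⟨Ks, hKs0, hKs, hKs'⟩ := exists_stretch_bound d R₁
  choose Cg hCg0 hCg using fun k => exists_bound_linear (F.gr k)
  obtain ⟨Cf, hCf⟩ := T.flux_bound
  have hCe0 : 0 ≤ Ce := zero_le_one.trans hCe1
  have hWi := P.Wi_pos
  set G : ℝ := ∑ k, Cg k
  have hG0 : 0 ≤ G := Finset.sum_nonneg fun k _ => hCg0 k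
  have hG : ∀ k u, ‖F.gr k u‖ ≤ G * ‖u‖ := fun k u => (hCg k u).trans (by
    gcongr; exact Finset.single_le_sum (fun k _ => hCg0 k) (Finset.mem_univ k))
  set vi : ℝ := ∑ k, (F.vol k)⁻¹
  have hvi : ∀ k, (F.vol k)⁻¹ ≤ vi := fun k => Finset.single_le_sum
        (fun k _ => inv_nonneg.2 (F.vol_pos k).le) (Finset.mem_univ k)
  have hvi0 : 0 ≤ vi := Finset.sum_nonneg fun k _ => inv_nonneg.2 (F.vol_pos k).le
  set vs : ℝ := ∑ k, F.vol k
  have hvs : ∀ k, F.vol k ≤ vs := fun k => Finset.single_le_sum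
        (fun k _ => (F.vol_pos k).le) (Finset.mem_univ k)
  have hvs0 : 0 ≤ vs := Finset.sum_nonneg fun k _ => (F.vol_pos k).le
  set Φ : ℝ := |Cf| * |R|
  have hflux : ∀ t w, ‖w‖ ≤ R → ∀ k l, |T.flux w t k l| ≤ Φ := fun t w hw k l => by
    rw [abs_of_nonneg (T.flux_nonneg _ _ _ _)]
    refine (hCf w t k l).trans ?_
    calc Cf * ‖w‖ ≤ |Cf| * ‖w‖ := by gcongr; exact le_abs_self _
      _ ≤ |Cf| * |R| := by gcongr; exact hw.trans (le_abs_self _)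
  have hk : ∀ {ψ : Fin N → Mat d}, ‖ψ‖ ≤ R₁ → ∀ k, ‖ψ k‖ ≤ R₁ := fun h k => (norm_le_pi_norm _ k).trans h
  have hfluxsum : ∀ t w, ‖w‖ ≤ R → ∀ (ψ : Fin N → Mat d) k,
      ‖∑ l, T.flux w t l k • (ψ k - ψ l)‖ ≤ N * (Φ * (2 * ‖ψ‖)) := by
    intro t w hw ψ k
    calc _ ≤ ∑ _l : Fin N, Φ * (2 * ‖ψ‖) := by
          refine norm_sum_le_of_le _ fun l _ => ?_
          rw [norm_smul, Real.norm_eq_abs]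
          gcongr
          · exact hflux t w hw l k
          · rw [two_mul]
            exact (norm_sub_le _ _).trans (add_le_add (norm_le_pi_norm _ _) (norm_le_pi_norm _ _))
      _ = _ := by simp
  set C₁ : ℝ := vi * (Ks * (G * |Ru|) + vs / P.Wi * (Ce + ‖(1 : Mat d)‖) + N * (Φ * (2 * |R₁|)))
  set C₂ : ℝ := vi * (Ks * (G * |Ru|) + Ks * G + vs / P.Wi * Ce ^ 2 + N * (Φ * 2))
  refine ⟨max C₁ C₂, (by positivity : 0 ≤ C₁).trans (le_max_left _ _), fun t w hw => ⟨?_, ?_⟩⟩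
  · intro ψ hs hψ u hu
    refine le_trans ?_ (le_max_left _ _)
    rw [pi_norm_le_iff_of_nonneg (by positivity)]
    intro k
    have hv := F.vol_pos k
    rw [stressRate, norm_smul, norm_inv, Real.norm_of_nonneg hv.le]
    refine mul_le_mul (hvi k) ?_ (norm_nonneg _) hvi0
    refine (norm_sub_le _ _).trans (add_le_add ((norm_add_le _ _).trans (add_le_add ?_ ?_)) ?_)
    · refine (hKs _ (hs k) (hk hψ k) _).trans ?_
      gcongr
      refine (hG k u).trans ?_
      gcongr
      exact hu.trans (le_abs_self _)
    · rw [norm_smul, Real.norm_of_nonneg (by positivity)]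
      gcongr
      · exact hvs k
      · refine (norm_sub_le _ _).trans ?_
        gcongr
        exact hCe _ (by rw [norm_neg]; exact hk hψ k)
    · refine (hfluxsum t w hw ψ k).trans ?_
      gcongr
      exact hψ.trans (le_abs_self _)
  · intro ψ ψ' hs hs' hψ hψ' u u' hu hu'
    refine le_trans ?_ (mul_le_mul_of_nonneg_right (le_max_right C₁ C₂) (by positivity))
    rw [pi_norm_le_iff_of_nonneg (by positivity)]
    intro k
    have hv := F.vol_pos k
    have e : stressRate T P t w u ψ k - stressRate T P t w u' ψ' k = (F.vol k)⁻¹ •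
        ((stretch (ψ k) (F.gr k u) - stretch (ψ' k) (F.gr k u)) + stretch (ψ' k) (F.gr k (u - u'))
        + (F.vol k / P.Wi) • (exp (-ψ k) - exp (-ψ' k))
        - ∑ l, T.flux w t l k • ((ψ - ψ') k - (ψ - ψ') l)) := by
      have : ∑ l, T.flux w t l k • ((ψ - ψ') k - (ψ - ψ') l)
          = ∑ l, T.flux w t l k • (ψ k - ψ l) - ∑ l, T.flux w t l k • (ψ' k - ψ' l) := by
        rw [← Finset.sum_sub_distrib]
        refine Finset.sum_congr rfl fun l _ => ?_
        simp only [Pi.sub_apply]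
        module
      rw [this, map_sub, map_sub, stressRate, stressRate]
      module
    have hδ : ‖ψ k - ψ' k‖ ≤ ‖ψ - ψ'‖ := norm_le_pi_norm (ψ - ψ') k
    rw [Pi.sub_apply, e, norm_smul, norm_inv, Real.norm_of_nonneg hv.le]
    have b1 : ‖stretch (ψ k) (F.gr k u) - stretch (ψ' k) (F.gr k u)‖
        ≤ Ks * (G * |Ru|) * ‖ψ - ψ'‖ := by
      refine (hKs' _ _ (hs k) (hs' k) (hk hψ k) (hk hψ' k) _).trans ?_
      gcongr
      refine (hG k u).trans ?_
      gcongr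
      exact hu.trans (le_abs_self _)
    have b2 : ‖stretch (ψ' k) (F.gr k (u - u'))‖ ≤ Ks * G * ‖u - u'‖ := by
      refine (hKs _ (hs' k) (hk hψ' k) _).trans ?_
      rw [mul_assoc]
      gcongr
      exact hG k _
    have b3 : ‖(F.vol k / P.Wi) • (exp (-ψ k) - exp (-ψ' k))‖
        ≤ vs / P.Wi * Ce ^ 2 * ‖ψ - ψ'‖ := by
      rw [norm_smul, Real.norm_of_nonneg (by positivity), mul_assoc]
      gcongr
      · exact hvs k
      · refine (norm_exp_sub_le hCe (by rw [norm_neg]; exact hk hψ k)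
          (by rw [norm_neg]; exact hk hψ' k)).trans ?_
        gcongr
        rw [← neg_sub', norm_neg]
        exact hδ
    have b4 := hfluxsum t w hw (ψ - ψ') k
    have hbd := (norm_sub_le (stretch (ψ k) (F.gr k u) - stretch (ψ' k) (F.gr k u)
      + stretch (ψ' k) (F.gr k (u - u')) + (F.vol k / P.Wi) • (exp (-ψ k) - exp (-ψ' k)))
      (∑ l, T.flux w t l k • ((ψ - ψ') k - (ψ - ψ') l))).trans
      (add_le_add (norm_add₃_le.trans (add_le_add (add_le_add b1 b2) b3)) b4)
    rw [mul_assoc]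
    refine mul_le_mul (hvi k) (hbd.trans ?_) (norm_nonneg _) hvi0
    have p1 : 0 ≤ Ks * (G * |Ru|) * ‖u - u'‖ := by positivity
    have p2 : 0 ≤ Ks * G * ‖ψ - ψ'‖ := by positivity
    have p3 : 0 ≤ vs / P.Wi * Ce ^ 2 * ‖u - u'‖ := by positivity
    have p4 : 0 ≤ N * (Φ * 2) * ‖u - u'‖ := by positivity
    linarith

/-- Well-posedness of one step in bounded sets for small time steps. -/
lemma exists_step (R : ℝ) : ∃ c : ℝ, 0 < c ∧ ∀ t, 0 < t → t < c → ∀ Y : V × (Fin N → Mat d),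
    (∀ k, (Y.2 k).IsSymm) → ‖Y.1‖ ≤ R → (∀ k, ‖Y.2 k‖ ≤ R) →
    (∃ Y', T.Step P t Y Y') ∧
    ∀ Z Z', T.Step P t Y Z → T.Step P t Y Z' → (∀ k, ‖Z.2 k‖ ≤ R) → (∀ k, ‖Z'.2 k‖ ≤ R) →
      Z = Z' := by
  -- The averaged old stress stays in the ball of radius `|R|`, by the row sums; one unit of room is
  -- left for `t` times the rate.
  set R₁ : ℝ := |R| + 1
  have hR₁ : 0 ≤ R₁ := by positivity
  obtain ⟨c₁, Cu, hc₁, hCu0, hU⟩ := exists_velocity_bound F P R R₁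
  obtain ⟨Cs, hCs0, hS⟩ := exists_stressRate_bound T P R R₁ Cu
  set L : ℝ := Cs * (1 + Cu) + 1
  have hL : 0 < L := by positivity
  -- This bound on `t` gives `t L ≤ 1 / 2`, the contraction factor, and `t Cs ≤ 1`, the invariance
  -- of the ball.
  refine ⟨min c₁ (2 * (L + Cs))⁻¹, lt_min hc₁ (by positivity), fun t ht htc Y hYs hY1 hY2 => ?_⟩
  have ht1 := htc.trans_le (min_le_left _ _)
  have ht2 : t * (2 * (L + Cs)) < 1 := by
    have := mul_lt_mul_of_pos_right (htc.trans_le (min_le_right _ _))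
      (by positivity : 0 < 2 * (L + Cs))
    rwa [inv_mul_cancel₀ (by positivity)] at this
  have htL : t * L ≤ 1 / 2 := by nlinarith
  have htC : t * Cs ≤ 1 := by nlinarith
  obtain ⟨hex, hbd, hlip⟩ := hU t ht ht1 Y.1 hY1
  obtain ⟨hSb, hSl⟩ := hS t Y.1 hY1
  have hcontr : ∀ ψ ψ' : Fin N → Mat d, (∀ k, (ψ k).IsSymm) → (∀ k, (ψ' k).IsSymm) →
      ‖ψ‖ ≤ R₁ → ‖ψ'‖ ≤ R₁ → ∀ u ∈ F.V₀, ∀ u' ∈ F.V₀,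
      (∀ v ∈ F.V₀, momentumForm F P t Y.1 u v
        = ((P.Re * t⁻¹) • F.mass Y.1 + elasticLoad F P ψ) v) →
      (∀ v ∈ F.V₀, momentumForm F P t Y.1 u' v
        = ((P.Re * t⁻¹) • F.mass Y.1 + elasticLoad F P ψ') v) →
      ‖t • stressRate T P t Y.1 u ψ - t • stressRate T P t Y.1 u' ψ'‖ ≤ 1 / 2 * ‖ψ - ψ'‖ := by
    intro ψ ψ' hs hs' hψ hψ' u hu u' hu' h h'
    rw [← smul_sub, norm_smul, Real.norm_of_nonneg ht.le]
    have h1 := hSl ψ ψ' hs hs' hψ hψ' u u' (hbd ψ hψ u hu h) (hbd ψ' hψ' u' hu' h')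
    have h2 := hlip ψ ψ' hψ hψ' u hu u' hu' h h'
    calc t * ‖stressRate T P t Y.1 u ψ - stressRate T P t Y.1 u' ψ'‖
        ≤ t * (Cs * (‖ψ - ψ'‖ + Cu * ‖ψ - ψ'‖)) := by
          gcongr
          exact h1.trans (by gcongr)
      _ = t * (Cs * (1 + Cu)) * ‖ψ - ψ'‖ := by ring
      _ ≤ t * L * ‖ψ - ψ'‖ := by
          gcongr
          exact le_add_of_nonneg_right zero_le_one
      _ ≤ _ := by gcongr
  set A : Fin N → Mat d := fun k => (F.vol k)⁻¹ • ∑ l, T.old Y.1 t k l • Y.2 l with hA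
  refine ⟨?_, ?_⟩
  -- The velocity is eliminated: for a given stress the momentum equation is linear and determines
  -- it, so the fixed point is sought in the stress alone.
  · choose U hUmem hUeq using fun ψ : Fin N → Mat d =>
      hex ((P.Re * t⁻¹) • F.mass Y.1 + elasticLoad F P ψ)
    have hAs : ∀ k, (A k).IsSymm := by
      intro k
      refine Matrix.IsSymm.smul ?_ _
      rw [Matrix.IsSymm, Matrix.transpose_sum]
      refine Finset.sum_congr rfl fun l _ => ?_
      rw [Matrix.transpose_smul, (hYs l).eq]
    have hAn : ‖A‖ ≤ |R| := by
      rw [pi_norm_le_iff_of_nonneg (abs_nonneg _)]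
      intro k
      have hv := F.vol_pos k
      rw [hA, norm_smul, norm_inv, Real.norm_of_nonneg hv.le, inv_mul_le_iff₀ hv]
      calc _ ≤ ∑ l, T.old Y.1 t k l * |R| := by
            refine norm_sum_le_of_le _ fun l _ => ?_
            rw [norm_smul, Real.norm_of_nonneg (T.old_nonneg _ _ _ _)]
            gcongr
            · exact T.old_nonneg _ _ _ _
            · exact (hY2 l).trans (le_abs_self _)
        _ ≤ _ := by
            rw [← Finset.sum_mul]
            gcongr
            exact T.old_row _ _ _
    set s : Set (Fin N → Mat d) := {ψ | (∀ k, (ψ k).IsSymm) ∧ ‖ψ‖ ≤ R₁}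
    let Ψ : (Fin N → Mat d) → (Fin N → Mat d) := fun ψ => A + t • stressRate T P t Y.1 (U ψ) ψ
    have hclosed : IsClosed s := by
      refine IsClosed.inter ?_ (isClosed_le continuous_norm continuous_const)
      have : {ψ : Fin N → Mat d | ∀ k, (ψ k).IsSymm} = ⋂ k, {ψ | (ψ k).transpose = ψ k} := by
        ext ψ; simp [Matrix.IsSymm]
      change IsClosed {ψ : Fin N → Mat d | ∀ k, (ψ k).IsSymm}
      rw [this]
      refine isClosed_iInter fun k => isClosed_eq ?_ (continuous_apply k)
      exact (continuous_apply k).matrix_transpose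
    have hmaps : MapsTo Ψ s s := by
      intro ψ hψ
      refine ⟨fun k => (hAs k).add ((stressRate_symm T P t _ _ hψ.1 k).smul t), ?_⟩
      refine (norm_add_le _ _).trans (add_le_add hAn ?_)
      rw [norm_smul, Real.norm_of_nonneg ht.le]
      refine le_trans ?_ htC
      gcongr
      exact hSb ψ hψ.1 hψ.2 _ (hbd ψ hψ.2 _ (hUmem ψ) (hUeq ψ))
    have hcw : ContractingWith (1 / 2) (hmaps.restrict Ψ s s) := by
      refine ⟨by rw [div_lt_one] <;> norm_num, LipschitzWith.of_dist_le_mul fun x y => ?_⟩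
      have := hcontr x y x.2.1 y.2.1 x.2.2 y.2.2 _ (hUmem x) _ (hUmem y) (hUeq x) (hUeq y)
      rw [Subtype.dist_eq, dist_eq_norm, Subtype.dist_eq, dist_eq_norm]
      simpa [Ψ] using this
    obtain ⟨ψ, hψs, hfix, -⟩ := hcw.exists_fixedPoint' hclosed.isComplete hmaps
      (x := 0) ⟨fun k => by simp [Matrix.IsSymm], by simpa using hR₁⟩ (edist_ne_top _ _)
    refine ⟨(U ψ, ψ), hUmem ψ, hψs.1, fun v hv => ?_, fun k => ?_⟩
    · rw [momentum_iff]
      exact hUeq ψ v hv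
    · rw [stress_iff T P ht]
      exact (congrFun hfix k).symm
  · intro Z Z' hZ hZ' hZb hZb'
    have key : ∀ {Z}, T.Step P t Y Z → Z.2 = A + t • stressRate T P t Y.1 Z.1 Z.2 := by
      intro Z hZ
      funext k
      exact (stress_iff T P ht k).1 (hZ.stress k)
    have hbn : ∀ {Z : V × (Fin N → Mat d)}, (∀ k, ‖Z.2 k‖ ≤ R) → ‖Z.2‖ ≤ R₁ := by
      intro Z h
      rw [pi_norm_le_iff_of_nonneg hR₁]
      exact fun k => (h k).trans ((le_abs_self R).trans (le_add_of_nonneg_right zero_le_one))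
    have hm : ∀ {Z}, T.Step P t Y Z → ∀ v ∈ F.V₀, momentumForm F P t Y.1 Z.1 v
        = ((P.Re * t⁻¹) • F.mass Y.1 + elasticLoad F P Z.2) v :=
      fun hZ v hv => (momentum_iff P).1 (hZ.momentum v hv)
    have h1 := hcontr Z.2 Z'.2 hZ.symm hZ'.symm (hbn hZb) (hbn hZb') _ hZ.divFree _ hZ'.divFree
      (hm hZ) (hm hZ')
    have h2 : Z.2 - Z'.2 = t • stressRate T P t Y.1 Z.1 Z.2 - t • stressRate T P t Y.1 Z'.1 Z'.2 := by
      nth_rewrite 1 [key hZ]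
      nth_rewrite 1 [key hZ']
      abel
    rw [← h2] at h1
    have h3 : ‖Z.2 - Z'.2‖ = 0 := by linarith [norm_nonneg (Z.2 - Z'.2)]
    have h4 := hlip Z.2 Z'.2 (hbn hZb) (hbn hZb') _ hZ.divFree _ hZ'.divFree (hm hZ) (hm hZ')
    rw [h3, mul_zero] at h4
    exact Prod.ext (sub_eq_zero.1 (norm_le_zero_iff.1 h4)) (sub_eq_zero.1 (norm_eq_zero.1 h3))

/-- Global well-posedness of the time-stepping for small time steps. -/
theorem exists_sequence (Y₀ : V × (Fin N → Mat d)) (hY₀ : ∀ k, (Y₀.2 k).IsSymm) :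
    ∃ c : ℝ, 0 < c ∧ ∀ t, 0 < t → t < c → ∃ Y : ℕ → V × (Fin N → Mat d), Y 0 = Y₀ ∧
      ∀ n, T.Step P t (Y n) (Y (n + 1)) ∧ ∀ Z, T.Step P t (Y n) Z → Z = Y (n + 1) := by
  obtain ⟨c₁, K, hc₁, hK⟩ := exists_energy_bound T P Y₀ hY₀
  obtain ⟨R, hR⟩ := exists_bound_of_energy T P K
  -- One radius for the a priori bound on all solutions and for the initial data, so that a single
  -- threshold from `exists_step` serves at every step.
  set R' : ℝ := max R (max ‖Y₀.1‖ ‖Y₀.2‖)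
  obtain ⟨c₂, hc₂, hstep⟩ := exists_step T P R'
  refine ⟨min c₁ c₂, lt_min hc₁ hc₂, fun t ht htc => ?_⟩
  have ht1 := htc.trans_le (min_le_left _ _)
  have ht2 := htc.trans_le (min_le_right _ _)
  -- The initial state is a separate case because its velocity may fail to be solenoidal. After one
  -- step the velocity is solenoidal and the energy is at most `K`, and both persist.
  let Adm : V × (Fin N → Mat d) → Prop := fun Y => Y = Y₀ ∨
    (Y.1 ∈ F.V₀ ∧ (∀ k, (Y.2 k).IsSymm) ∧ energy F P Y ≤ K ∧ ‖Y.1‖ ≤ R' ∧ ∀ k, ‖Y.2 k‖ ≤ R')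
  have hAdm : ∀ Y, Adm Y → ∃ Y', Adm Y' ∧ T.Step P t Y Y' ∧ ∀ Z, T.Step P t Y Z → Z = Y' := by
    intro Y hY
    have hb : (∀ k, (Y.2 k).IsSymm) ∧ ‖Y.1‖ ≤ R' ∧ (∀ k, ‖Y.2 k‖ ≤ R') := by
      rcases hY with rfl | ⟨_, h2, _, h4, h5⟩
      · exact ⟨hY₀, (le_max_left _ _).trans (le_max_right _ _), fun k => (norm_le_pi_norm _ k).trans
          ((le_max_right _ _).trans (le_max_right _ _))⟩
      · exact ⟨h2, h4, h5⟩
    have hE : ∀ Z, T.Step P t Y Z → energy F P Z ≤ K := by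
      intro Z hZ
      rcases hY with rfl | ⟨h1, h2, h3, -, -⟩
      · exact hK t ht ht1 Z hZ
      · exact (hZ.energy_le ht h2 h1).trans h3
    -- The bound holds for every solution of the step, which turns uniqueness in the ball into
    -- uniqueness.
    have hZb : ∀ Z, T.Step P t Y Z → ‖Z.1‖ ≤ R' ∧ ∀ k, ‖Z.2 k‖ ≤ R' := fun Z hZ =>
      have h := hR t Y Z hZ (hE Z hZ)
      ⟨h.1.trans (le_max_left _ _), fun k => (h.2 k).trans (le_max_left _ _)⟩
    obtain ⟨⟨Y', hY'⟩, huniq⟩ := hstep t ht ht2 Y hb.1 hb.2.1 hb.2.2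
    exact ⟨Y', Or.inr ⟨hY'.divFree, hY'.symm, hE _ hY', (hZb _ hY').1, (hZb _ hY').2⟩, hY',
      fun Z hZ => huniq Z Y' hZ hY' (hZb Z hZ).2 (hZb Y' hY').2⟩
  choose next hnext using fun Y : {Y // Adm Y} => hAdm Y.1 Y.2
  let seq : ℕ → {Y // Adm Y} := fun n =>
    Nat.rec ⟨Y₀, Or.inl rfl⟩ (fun _ Y => ⟨next Y, (hnext Y).1⟩) n
  exact ⟨fun n => (seq n).1, rfl, fun n => ⟨(hnext (seq n)).2.1, (hnext (seq n)).2.2⟩⟩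

end Transport
end OldroydLog
end

noncomputable section
namespace OldroydLog
-- Geometry of the elements, and piecewise continuous functions
namespace Mesh
variable {d : ℕ} (M : Mesh d)

/-- The affine basis of the vertices of an element. -/
def basis (k : Fin M.N) : AffineBasis (Fin (d + 1)) ℝ (E d) where
  toFun := (M.cell k).points
  ind' := (M.cell k).independent
  tot' := by
    rw [(M.cell k).independent.affineSpan_eq_top_iff_card_eq_finrank_add_one]
    simp

/-- Barycentric coordinates in an element. -/
def bary (k : Fin M.N) (i : Fin (d + 1)) : E d →ᵃ[ℝ] ℝ := (M.basis k).coord i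

lemma bary_points (k : Fin M.N) (i j : Fin (d + 1)) :
    M.bary k i ((M.cell k).points j) = if i = j then 1 else 0 :=
  (M.basis k).coord_apply i j

lemma continuous_bary (k : Fin M.N) (i : Fin (d + 1)) : Continuous (M.bary k i) :=
  AffineMap.continuous_of_finiteDimensional _

lemma sum_bary (k : Fin M.N) (x : E d) : ∑ i, M.bary k i x = 1 :=
  (M.basis k).sum_coord_apply_eq_one x

lemma elem_eq (k : Fin M.N) : M.elem k = {x | ∀ i, 0 ≤ M.bary k i x} :=
  (M.basis k).convexHull_eq_nonneg_coord

lemma interior_elem_eq (k : Fin M.N) : interior (M.elem k) = {x | ∀ i, 0 < M.bary k i x} :=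
  (M.basis k).interior_convexHull

/-- The open element. -/
abbrev cellInt (k : Fin M.N) : Set (E d) := interior (M.elem k)

lemma mem_cellInt {k : Fin M.N} {x : E d} : x ∈ M.cellInt k ↔ ∀ i, 0 < M.bary k i x := by
  rw [cellInt, interior_elem_eq]; rfl

lemma mem_elem {k : Fin M.N} {x : E d} : x ∈ M.elem k ↔ ∀ i, 0 ≤ M.bary k i x := by
  rw [elem_eq]; rfl

lemma convex_elem (k : Fin M.N) : Convex ℝ (M.elem k) := convex_convexHull _ _

lemma isCompact_elem (k : Fin M.N) : IsCompact (M.elem k) :=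
  (finite_range _).isCompact_convexHull ℝ

lemma isClosed_elem (k : Fin M.N) : IsClosed (M.elem k) := (M.isCompact_elem k).isClosed

lemma nonempty_cellInt (k : Fin M.N) : (M.cellInt k).Nonempty :=
  interior_convexHull_nonempty_iff_affineSpan_eq_top.2 (M.basis k).tot

lemma volume_frontier_elem (k : Fin M.N) : volume (frontier (M.elem k)) = 0 :=
  (M.convex_elem k).addHaar_frontier volume

lemma elem_ae_eq (k : Fin M.N) : (M.elem k : Set (E d)) =ᵐ[volume] M.cellInt k :=
  (interior_ae_eq_of_null_frontier (M.volume_frontier_elem k)).symm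

lemma volume_cellInt_lt_top (k : Fin M.N) : volume (M.cellInt k) < ⊤ :=
  (measure_mono interior_subset).trans_lt (M.isCompact_elem k).measure_lt_top

/-- Volume of an element. -/
def vol (k : Fin M.N) : ℝ := volume.real (M.cellInt k)

lemma vol_pos (k : Fin M.N) : 0 < M.vol k :=
  ENNReal.toReal_pos (isOpen_interior.measure_pos _ (M.nonempty_cellInt k)).ne'
    (M.volume_cellInt_lt_top k).ne

/-- A barycentric coordinate vanishes on faces not containing the corresponding vertex. -/
lemma bary_eq_zero_of_mem_hull {k : Fin M.N} {i : Fin (d + 1)} {S : Set (E d)}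
    (hS : S ⊆ range (M.cell k).points) (hi : (M.cell k).points i ∉ S) {x : E d}
    (hx : x ∈ convexHull ℝ S) : M.bary k i x = 0 := by
  have : convexHull ℝ S ⊆ {x | M.bary k i x = 0} := by
    refine convexHull_min ?_ ?_
    · intro y hy
      obtain ⟨j, rfl⟩ := hS hy
      have : i ≠ j := by rintro rfl; exact hi hy
      simp [bary_points, this]
    · exact (convex_singleton (0 : ℝ)).affine_preimage (M.bary k i)
  exact this hx

/-- Both elements have `d + 1` vertices, so an inclusion of vertex sets would be an equality. -/
lemma exists_vertex_not_mem {k l : Fin M.N} (h : k ≠ l) :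
    ∃ i, (M.cell k).points i ∉ range (M.cell l).points := by
  by_contra hcon
  push Not at hcon
  apply M.distinct k l h
  have hsub : range (M.cell k).points ⊆ range (M.cell l).points := by
    rintro _ ⟨i, rfl⟩; exact hcon i
  refine Set.eq_of_subset_of_ncard_le hsub ?_ (finite_range _)
  rw [← image_univ, ← image_univ, ncard_image_of_injective _ (M.cell k).independent.injective,
    ncard_image_of_injective _ (M.cell l).independent.injective]

/-- By conformity a common point lies in the hull of the common vertices, where the coordinate of a
vertex that is not shared vanishes; interior points have positive coordinates. -/
lemma disjoint_cellInt {k l : Fin M.N} (h : k ≠ l) : Disjoint (M.cellInt k) (M.cellInt l) := by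
  rw [Set.disjoint_left]
  intro x hk hl
  obtain ⟨i, hi⟩ := M.exists_vertex_not_mem h
  have hx : x ∈ M.elem k ∩ M.elem l := ⟨interior_subset hk, interior_subset hl⟩
  rw [elem, elem, M.conformal] at hx
  have h0 := M.bary_eq_zero_of_mem_hull (i := i) inter_subset_left (fun h => hi h.2) hx
  exact (M.mem_cellInt.1 hk i).ne' h0

lemma cellwise_apply {α : Type*} [AddCommMonoid α] (f : Fin M.N → E d → α) {k : Fin M.N} {x : E d}
    (hx : x ∈ M.cellInt k) : M.cellwise f x = f k x := by
  rw [cellwise, Finset.sum_eq_single k]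
  · exact indicator_of_mem hx _
  · intro l _ hl
    exact indicator_of_notMem (fun h => Set.disjoint_left.1 (M.disjoint_cellInt hl) h hx) _
  · simp

lemma p1_apply {W : Type*} [AddCommGroup W] [Module ℝ W] (p : M.P1disc W) {k : Fin M.N} {x : E d}
    (hx : x ∈ M.cellInt k) : M.p1 p x = p k x := M.cellwise_apply _ hx

lemma p0_apply (ψ : Fin M.N → Mat d) {k : Fin M.N} {x : E d}
    (hx : x ∈ M.cellInt k) : M.p0 ψ x = ψ k := M.cellwise_apply _ hx

lemma isOpen_domain : IsOpen M.domain := isOpen_interior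

lemma cellInt_subset_domain (k : Fin M.N) : M.cellInt k ⊆ M.domain :=
  interior_mono (subset_iUnion M.elem k)

lemma domain_subset : M.domain ⊆ ⋃ k, M.elem k := interior_subset

lemma isCompact_iUnion_elem : IsCompact (⋃ k, M.elem k) := isCompact_iUnion M.isCompact_elem

/-- Only the boundaries of the elements are lost, and boundaries of convex sets are null. -/
lemma ae_mem_cell : ∀ᵐ x : E d, (∃ k, x ∈ M.cellInt k) ∨ x ∉ ⋃ k, M.elem k := by
  have h : ∀ k, ∀ᵐ x : E d, x ∉ frontier (M.elem k) := fun k =>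
    measure_eq_zero_iff_ae_notMem.1 (M.volume_frontier_elem k)
  filter_upwards [ae_all_iff.2 h] with x hx
  by_cases hmem : x ∈ ⋃ k, M.elem k
  · obtain ⟨k, hk⟩ := mem_iUnion.1 hmem
    left
    refine ⟨k, ?_⟩
    by_contra hn
    exact hx k ⟨subset_closure hk, hn⟩
  · exact Or.inr hmem

lemma domain_ae_eq : (M.domain : Set (E d)) =ᵐ[volume] ⋃ k, M.cellInt k := by
  filter_upwards [M.ae_mem_cell] with x hx
  refine propext ⟨fun h => ?_, fun h => ?_⟩
  · rcases hx with ⟨k, hk⟩ | hx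
    · exact mem_iUnion.2 ⟨k, hk⟩
    · exact absurd (M.domain_subset h) hx
  · obtain ⟨k, hk⟩ := mem_iUnion.1 h
    exact M.cellInt_subset_domain k hk

/-- Integral over the domain, element by element. -/
lemma setIntegral_domain {F : Type*} [NormedAddCommGroup F] [NormedSpace ℝ F] (f : E d → F)
    (hf : ∀ k, IntegrableOn f (M.cellInt k)) :
    ∫ x in M.domain, f x = ∑ k, ∫ x in M.cellInt k, f x := by
  rw [setIntegral_congr_set M.domain_ae_eq,
    integral_iUnion_fintype (fun k => isOpen_interior.measurableSet)
      (fun k l h => M.disjoint_cellInt h) hf]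

/-- `f` coincides with a continuous function in every open element. -/
def Nice {F : Type*} [TopologicalSpace F] (f : E d → F) : Prop :=
  ∀ k, ∃ g : E d → F, Continuous g ∧ ∀ x ∈ M.cellInt k, f x = g x

variable {M}

lemma Nice.map {F G : Type*} [TopologicalSpace F] [TopologicalSpace G] {f : E d → F}
    (hf : M.Nice f) {φ : F → G} (hφ : Continuous φ) : M.Nice fun x => φ (f x) := fun k => by
  obtain ⟨g, hg, h⟩ := hf k
  exact ⟨_, hφ.comp hg, fun x hx => congrArg φ (h x hx)⟩

lemma Nice.prodMk {F G : Type*} [TopologicalSpace F] [TopologicalSpace G] {f : E d → F}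
    {g : E d → G} (hf : M.Nice f) (hg : M.Nice g) : M.Nice fun x => (f x, g x) := fun k => by
  obtain ⟨f', hf', h⟩ := hf k
  obtain ⟨g', hg', h'⟩ := hg k
  exact ⟨_, hf'.prodMk hg', fun x hx => by simp only [h x hx, h' x hx]⟩

lemma Nice.map₂ {F G H : Type*} [TopologicalSpace F] [TopologicalSpace G] [TopologicalSpace H]
    {f : E d → F} {g : E d → G} (hf : M.Nice f) (hg : M.Nice g) {φ : F → G → H}
    (hφ : Continuous fun p : F × G => φ p.1 p.2) : M.Nice fun x => φ (f x) (g x) :=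
  (hf.prodMk hg).map hφ

lemma nice_of_continuous {F : Type*} [TopologicalSpace F] {f : E d → F} (hf : Continuous f) :
    M.Nice f := fun _ => ⟨f, hf, fun _ _ => rfl⟩

lemma nice_p1 {W : Type*} [NormedAddCommGroup W] [NormedSpace ℝ W] (p : M.P1disc W) :
    M.Nice (M.p1 p) := fun k =>
  ⟨p k, AffineMap.continuous_of_finiteDimensional _, fun _ hx => M.p1_apply p hx⟩

lemma Nice.add {F : Type*} [TopologicalSpace F] [Add F] [ContinuousAdd F] {f g : E d → F}
    (hf : M.Nice f) (hg : M.Nice g) : M.Nice fun x => f x + g x := hf.map₂ hg continuous_add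

lemma Nice.sub {F : Type*} [TopologicalSpace F] [AddGroup F] [IsTopologicalAddGroup F]
    {f g : E d → F} (hf : M.Nice f) (hg : M.Nice g) : M.Nice fun x => f x - g x :=
  hf.map₂ hg continuous_sub

lemma Nice.mul {F : Type*} [TopologicalSpace F] [Mul F] [ContinuousMul F] {f g : E d → F}
    (hf : M.Nice f) (hg : M.Nice g) : M.Nice fun x => f x * g x := hf.map₂ hg continuous_mul

lemma Nice.const_mul {f : E d → ℝ} (hf : M.Nice f) (c : ℝ) : M.Nice fun x => c * f x :=
  hf.map (continuous_const.mul continuous_id)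

lemma Nice.inner {F : Type*} [NormedAddCommGroup F] [InnerProductSpace ℝ F] {f g : E d → F}
    (hf : M.Nice f) (hg : M.Nice g) : M.Nice fun x => inner ℝ (f x) (g x) :=
  hf.map₂ hg continuous_inner

lemma Nice.ddot {f g : E d → Mat d}
    (hf : M.Nice f) (hg : M.Nice g) : M.Nice fun x => ddot (f x) (g x) := by
  refine hf.map₂ hg ?_
  simp only [ddot_eq_sum]
  fun_prop

lemma Nice.integrableOn {F : Type*} [NormedAddCommGroup F] [NormedSpace ℝ F]
    {f : E d → F} (hf : M.Nice f) (k : Fin M.N) : IntegrableOn f (M.cellInt k) := by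
  obtain ⟨g, hg, h⟩ := hf k
  have : IntegrableOn g (M.cellInt k) :=
    (hg.continuousOn.integrableOn_compact (M.isCompact_elem k)).mono_set interior_subset
  exact this.congr_fun (fun x hx => (h x hx).symm) isOpen_interior.measurableSet

variable (M)

/-- Sum of the integrals over the open elements. -/
def sumInt (f : E d → ℝ) : ℝ := ∑ k, ∫ x in M.cellInt k, f x

variable {M}

lemma sumInt_congr {f g : E d → ℝ} (h : ∀ k, ∀ x ∈ M.cellInt k, f x = g x) :
    M.sumInt f = M.sumInt g :=
  Finset.sum_congr rfl fun k _ => setIntegral_congr_fun isOpen_interior.measurableSet (h k)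

lemma sumInt_add {f g : E d → ℝ} (hf : M.Nice f) (hg : M.Nice g) :
    M.sumInt (fun x => f x + g x) = M.sumInt f + M.sumInt g := by
  rw [sumInt, sumInt, sumInt, ← Finset.sum_add_distrib]
  exact Finset.sum_congr rfl fun k _ => integral_add (hf.integrableOn k) (hg.integrableOn k)

lemma sumInt_sub {f g : E d → ℝ} (hf : M.Nice f) (hg : M.Nice g) :
    M.sumInt (fun x => f x - g x) = M.sumInt f - M.sumInt g := by
  rw [sumInt, sumInt, sumInt, ← Finset.sum_sub_distrib]
  exact Finset.sum_congr rfl fun k _ => integral_sub (hf.integrableOn k) (hg.integrableOn k)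

lemma sumInt_const_mul (c : ℝ) (f : E d → ℝ) :
    M.sumInt (fun x => c * f x) = c * M.sumInt f := by
  rw [sumInt, sumInt, Finset.mul_sum]
  exact Finset.sum_congr rfl fun k _ => integral_const_mul _ _

lemma sumInt_nonneg {f : E d → ℝ} (h : ∀ k, ∀ x ∈ M.cellInt k, 0 ≤ f x) : 0 ≤ M.sumInt f :=
  Finset.sum_nonneg fun k _ => setIntegral_nonneg isOpen_interior.measurableSet (h k)

/-- A nonnegative piecewise continuous function with zero integral vanishes. -/
lemma Nice.eq_zero_of_sumInt {f : E d → ℝ} (hf : M.Nice f)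
    (h : ∀ k, ∀ x ∈ M.cellInt k, 0 ≤ f x) (h0 : M.sumInt f = 0) :
    ∀ k, ∀ x ∈ M.cellInt k, f x = 0 := by
  intro k
  have h1 : ∫ x in M.cellInt k, f x = 0 :=
    (Finset.sum_eq_zero_iff_of_nonneg fun k _ =>
      setIntegral_nonneg isOpen_interior.measurableSet (h k)).1 h0 k (Finset.mem_univ k)
  have h2 : f =ᵐ[volume.restrict (M.cellInt k)] 0 := by
    rwa [← setIntegral_eq_zero_iff_of_nonneg_ae _ (hf.integrableOn k)]
    exact (ae_restrict_iff' isOpen_interior.measurableSet).2 (ae_of_all _ (h k))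
  obtain ⟨g, hg, hfg⟩ := hf k
  have h3 : ContinuousOn f (M.cellInt k) := hg.continuousOn.congr hfg
  exact Measure.eqOn_open_of_ae_eq h2 isOpen_interior h3 continuousOn_const

end Mesh
end OldroydLog
end

noncomputable section
namespace OldroydLog
open scoped Matrix.Norms.Frobenius

/-! ### Quadratic maps -/

section Quadratic
variable {d : ℕ}

/-- Coefficients of a quadratic map. -/
abbrev Quad (d : ℕ) := E d × (E d →L[ℝ] E d) × (E d →L[ℝ] E d →L[ℝ] E d)

/-- Evaluation of a quadratic map. -/
def Quad.eval (q : Quad d) (x : E d) : E d := q.1 + q.2.1 x + q.2.2 x x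

/-- Derivative of a quadratic map. -/
def Quad.deriv (q : Quad d) (x : E d) : E d →L[ℝ] E d := q.2.1 + q.2.2 x + q.2.2.flip x

lemma Quad.hasFDerivAt (q : Quad d) (x : E d) : HasFDerivAt q.eval (q.deriv x) x := by
  have h1 : HasFDerivAt (fun y => q.2.1 y) q.2.1 x := q.2.1.hasFDerivAt
  have h2 : HasFDerivAt (fun y => q.2.2 y y) (q.2.2 x + q.2.2.flip x) x := by
    have := (q.2.2.hasFDerivAt (x := x)).clm_apply (hasFDerivAt_id x)
    refine this.congr_fderiv ?_
    ext v : 1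
    simp
  have h3 := (h1.const_add q.1).add h2
  refine h3.congr_fderiv ?_
  rw [Quad.deriv, add_assoc]

lemma Quad.continuous_eval (q : Quad d) : Continuous q.eval :=
  continuous_iff_continuousAt.2 fun x => (q.hasFDerivAt x).continuousAt

lemma Quad.continuous_deriv (q : Quad d) : Continuous q.deriv := by
  unfold Quad.deriv
  fun_prop

/-- `f` is a polynomial function of degree at most two. -/
def IsQuadratic (f : E d → ℝ) : Prop :=
  ∃ (c : ℝ) (l : E d →L[ℝ] ℝ) (b : E d →L[ℝ] E d →L[ℝ] ℝ), ∀ x, f x = c + l x + b x x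

lemma IsQuadratic.sum {ι : Type*} (s : Finset ι) {f : ι → E d → ℝ}
    (h : ∀ i ∈ s, IsQuadratic (f i)) : IsQuadratic fun x => ∑ i ∈ s, f i x := by
  classical
  induction s using Finset.induction_on with
  | empty => exact ⟨0, 0, 0, by simp⟩
  | insert a s ha ih =>
    obtain ⟨c, l, b, h1⟩ := h a (Finset.mem_insert_self _ _)
    obtain ⟨c', l', b', h2⟩ := ih fun i hi => h i (Finset.mem_insert_of_mem hi)
    refine ⟨c + c', l + l', b + b', fun x => ?_⟩
    have h2' : ∑ i ∈ s, f i x = c' + l' x + b' x x := h2 x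
    change ∑ i ∈ insert a s, f i x = _
    rw [Finset.sum_insert ha, h1, h2']
    simp only [add_apply]
    ring

lemma exists_eq_add_single {m : Fin d →₀ ℕ} (hm : m ≠ 0) :
    ∃ i m', m = m' + Finsupp.single i 1 := by
  obtain ⟨i, hi⟩ := Finsupp.ne_iff.1 hm
  refine ⟨i, m - Finsupp.single i 1, ?_⟩
  ext j
  simp only [Finsupp.coe_add, Finsupp.coe_tsub, Pi.add_apply, Pi.sub_apply]
  rcases eq_or_ne i j with rfl | hij
  · simp only [Finsupp.single_eq_same]
    simp only [Finsupp.coe_zero, Pi.zero_apply] at hi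
    omega
  · rw [Finsupp.single_eq_of_ne (Ne.symm hij)]; omega

/-- Monomial by monomial: in degree at most two, at most two variables can be split off, giving a
constant, a linear form or a product of two coordinates. -/
lemma isQuadratic_eval {P : MvPolynomial (Fin d) ℝ} (hP : P.totalDegree ≤ 2) :
    IsQuadratic fun x => MvPolynomial.eval (fun j => x j) P := by
  have hco : ∀ i : Fin d, ∃ p : E d →L[ℝ] ℝ, ∀ x, p x = x i := fun i =>
    ⟨EuclideanSpace.proj i, fun x => rfl⟩
  choose p hp using hco
  simp only [MvPolynomial.eval_eq]
  refine IsQuadratic.sum _ fun m hm => ?_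
  have hdeg : (m.sum fun _ e => e) ≤ 2 := (MvPolynomial.le_totalDegree hm).trans hP
  have hprod : ∀ (m : Fin d →₀ ℕ) (i : Fin d) (x : E d),
      ∏ j, x j ^ ((m + Finsupp.single i 1 : Fin d →₀ ℕ) j) = (∏ j, x j ^ m j) * x i := by
    intro m i x
    simp only [Finsupp.coe_add, Pi.add_apply, pow_add, Finset.prod_mul_distrib]
    congr 1
    rw [Finset.prod_eq_single i]
    · simp
    · intro j _ hj
      rw [Finsupp.single_eq_of_ne hj, pow_zero]
    · simp
  have hprod' : ∀ x : E d, ∏ j ∈ m.support, x j ^ m j = ∏ j, x j ^ m j := by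
    intro x
    refine Finset.prod_subset (Finset.subset_univ _) fun j _ hj => ?_
    rw [Finsupp.notMem_support_iff.1 hj, pow_zero]
  have hsum : ∀ (m : Fin d →₀ ℕ) (i : Fin d),
      ((m + Finsupp.single i 1).sum fun _ e => e) = (m.sum fun _ e => e) + 1 := by
    intro m i
    rw [Finsupp.sum_add_index' (fun _ => rfl) (fun _ _ _ => rfl), Finsupp.sum_single_index rfl]
  simp only [hprod']
  set a := MvPolynomial.coeff m P
  clear_value a
  clear hm hprod'
  by_cases h0 : m = 0
  · subst h0
    exact ⟨a, 0, 0, fun x => by simp⟩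
  obtain ⟨i, m', rfl⟩ := exists_eq_add_single h0
  rw [hsum] at hdeg
  by_cases h1 : m' = 0
  · subst h1
    refine ⟨0, a • p i, 0, fun x => ?_⟩
    beta_reduce
    rw [hprod]
    simp [hp]
  obtain ⟨j, m'', rfl⟩ := exists_eq_add_single h1
  rw [hsum] at hdeg
  have h2 : m'' = 0 := by
    by_contra h2
    obtain ⟨l, m3, rfl⟩ := exists_eq_add_single h2
    rw [hsum] at hdeg
    omega
  subst h2
  refine ⟨0, 0, (ContinuousLinearMap.smulRight (a • p i) (p j)), fun x => ?_⟩
  beta_reduce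
  rw [hprod, hprod]
  simp [hp]
  ring

/-- A vector field with quadratic components is quadratic. -/
lemma exists_quad {f : E d → E d} (h : ∀ i, IsQuadratic fun x => f x i) :
    ∃ q : Quad d, ∀ x, f x = q.eval x := by
  choose c l b hf using h
  let e : Fin d → E d := fun i => EuclideanSpace.single i 1
  refine ⟨(WithLp.toLp 2 c, ∑ i, (l i).smulRight (e i),
    ∑ i, ((ContinuousLinearMap.smulRightL ℝ (E d) (E d)).flip (e i)) ∘L (b i)), fun x => ?_⟩
  ext j
  have hf' : f x j = c j + l j x + b j x x := hf j x
  rw [hf']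
  simp [Quad.eval, e, Pi.single_apply]

end Quadratic

/-! ### The velocity space: finite dimension and Lipschitz regularity -/

namespace Mesh
variable {d : ℕ} (M : Mesh d)

lemma exists_quad_of_mem {u : E d → E d} (hu : u ∈ M.velocitySpace) :
    ∃ q : Fin M.N → Quad d, ∀ k, ∀ x ∈ M.elem k, u x = (q k).eval x := by
  have : ∀ k, ∃ q : Quad d, ∀ x ∈ M.elem k, u x = q.eval x := by
    intro k
    choose P hP hPu using hu.2.2 k
    obtain ⟨q, hq⟩ := exists_quad (f := fun x => WithLp.toLp 2 fun i =>
      MvPolynomial.eval (fun j => x j) (P i)) (fun i => isQuadratic_eval (hP i))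
    refine ⟨q, fun x hx => ?_⟩
    rw [← hq]
    ext i
    exact hPu i x hx
  choose q hq using this
  exact ⟨q, hq⟩

/-- The velocity space as a submodule. -/
def velocity : Submodule ℝ (E d → E d) where
  carrier := M.velocitySpace
  add_mem' {u v} hu hv := by
    refine ⟨hu.1.add hv.1, fun x hx => by simp [hu.2.1 x hx, hv.2.1 x hx], fun k i => ?_⟩
    obtain ⟨P, hP, h1⟩ := hu.2.2 k i
    obtain ⟨Q, hQ, h2⟩ := hv.2.2 k i
    refine ⟨P + Q, (MvPolynomial.totalDegree_add P Q).trans (max_le hP hQ), fun x hx => ?_⟩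
    simp [h1 x hx, h2 x hx]
  zero_mem' := ⟨continuous_const, fun _ _ => rfl, fun _ _ => ⟨0, by simp, by simp⟩⟩
  smul_mem' c u hu := by
    refine ⟨hu.1.const_smul c, fun x hx => by simp [hu.2.1 x hx], fun k i => ?_⟩
    obtain ⟨P, hP, h1⟩ := hu.2.2 k i
    refine ⟨c • P, (MvPolynomial.totalDegree_smul_le c P).trans hP, fun x hx => ?_⟩
    simp [h1 x hx, MvPolynomial.smul_eval]

/-- Velocities, as a vector space. -/
def Vel : Type := M.velocity

instance : AddCommGroup M.Vel := inferInstanceAs (AddCommGroup M.velocity)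
instance : Module ℝ M.Vel := inferInstanceAs (Module ℝ M.velocity)

/-- The underlying field of a velocity. -/
def fn : M.Vel →ₗ[ℝ] (E d → E d) := M.velocity.subtype

variable {M}

lemma fn_mem (u : M.Vel) : M.fn u ∈ M.velocitySpace := u.2

lemma fn_injective : Function.Injective M.fn := Subtype.val_injective

lemma exists_fn {u : E d → E d} (hu : u ∈ M.velocitySpace) : ∃ v : M.Vel, M.fn v = u :=
  ⟨⟨u, hu⟩, rfl⟩

lemma fn_add (u v : M.Vel) (x : E d) : M.fn (u + v) x = M.fn u x + M.fn v x := by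
  rw [map_add]; rfl

lemma fn_smul (c : ℝ) (u : M.Vel) (x : E d) : M.fn (c • u) x = c • M.fn u x := by
  rw [map_smul]; rfl

/-- A velocity is determined by its restrictions to the elements, since it vanishes off the domain,
and these restrictions lie in the image of a finite product of spaces `Quad d`. -/
instance : FiniteDimensional ℝ M.Vel := by
  classical
  let ev : (Fin M.N → Quad d) →ₗ[ℝ] (Fin M.N → E d → E d) :=
    { toFun := fun q k => (M.elem k).indicator (q k).eval
      map_add' := fun q q' => by
        funext k x
        by_cases hx : x ∈ M.elem k
        · simp only [Pi.add_apply, indicator_of_mem hx, Quad.eval, Prod.fst_add, Prod.snd_add,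
            add_apply]
          abel
        · simp [indicator_of_notMem hx]
      map_smul' := fun c q => by
        funext k x
        by_cases hx : x ∈ M.elem k
        · simp [indicator_of_mem hx, Quad.eval]
        · simp [indicator_of_notMem hx] }
  let res : M.Vel →ₗ[ℝ] (Fin M.N → E d → E d) :=
    { toFun := fun u k => (M.elem k).indicator (M.fn u)
      map_add' := fun u v => by
        funext k x
        by_cases hx : x ∈ M.elem k
        · simp [indicator_of_mem hx]
        · simp [indicator_of_notMem hx]
      map_smul' := fun c u => by
        funext k x
        by_cases hx : x ∈ M.elem k
        · simp [indicator_of_mem hx]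
        · simp [indicator_of_notMem hx] }
  have hmem : ∀ u, res u ∈ LinearMap.range ev := by
    intro u
    obtain ⟨q, hq⟩ := M.exists_quad_of_mem (fn_mem u)
    refine ⟨q, ?_⟩
    funext k
    exact (Set.indicator_congr (hq k)).symm
  have hinj : Function.Injective (res.codRestrict _ hmem) := by
    rw [injective_iff_map_eq_zero]
    intro u hu
    have hu' : res u = 0 := congrArg Subtype.val hu
    apply fn_injective
    rw [map_zero]
    funext x
    by_cases hx : x ∈ M.domain
    · obtain ⟨k, hk⟩ := mem_iUnion.1 (M.domain_subset hx)
      have := congrFun (congrFun hu' k) x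
      simpa [res, indicator_of_mem hk] using this
    · exact (fn_mem u).2.1 x hx
  exact FiniteDimensional.of_injective _ hinj

/-- A linear identification of velocities with a Euclidean space. -/
def velEquiv : M.Vel ≃ₗ[ℝ] EuclideanSpace ℝ (Fin (Module.finrank ℝ M.Vel)) :=
  LinearEquiv.ofFinrankEq _ _ (by simp)

/-- In finite dimension any norm serves. `Vel` is a type of its own so that the topology of
pointwise convergence does not compete with this norm. -/
instance : NormedAddCommGroup M.Vel :=
  NormedAddCommGroup.induced M.Vel _ (velEquiv (M := M)).toLinearMap (velEquiv (M := M)).injective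

instance : NormedSpace ℝ M.Vel := NormedSpace.induced ℝ M.Vel _ (velEquiv (M := M)).toLinearMap

variable (M)

lemma eq_zero_of_notMem {u : E d → E d} (hu : u ∈ M.velocitySpace) {x : E d}
    (hx : x ∉ ⋃ k, M.elem k) : u x = 0 := hu.2.1 x fun h => hx (M.domain_subset h)

lemma hasCompactSupport_of_mem {u : E d → E d} (hu : u ∈ M.velocitySpace) : HasCompactSupport u :=
  HasCompactSupport.intro M.isCompact_iUnion_elem fun _ hx => M.eq_zero_of_notMem hu hx

lemma hasFDerivAt_of_mem {u : E d → E d} {q : Fin M.N → Quad d}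
    (hq : ∀ k, ∀ x ∈ M.elem k, u x = (q k).eval x) {k : Fin M.N} {x : E d}
    (hx : x ∈ M.cellInt k) : HasFDerivAt u ((q k).deriv x) x := by
  refine ((q k).hasFDerivAt x).congr_of_eventuallyEq ?_
  filter_upwards [isOpen_interior.mem_nhds hx] with y hy
  exact hq k y (interior_subset hy)

lemma differentiableAt_of_mem {u : E d → E d} (hu : u ∈ M.velocitySpace) {k : Fin M.N} {x : E d}
    (hx : x ∈ M.cellInt k) : DifferentiableAt ℝ u x := by
  obtain ⟨q, hq⟩ := M.exists_quad_of_mem hu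
  exact (M.hasFDerivAt_of_mem hq hx).differentiableAt

lemma nice_fderiv {u : E d → E d} (hu : u ∈ M.velocitySpace) : M.Nice (fderiv ℝ u) := by
  obtain ⟨q, hq⟩ := M.exists_quad_of_mem hu
  exact fun k => ⟨(q k).deriv, (q k).continuous_deriv, fun x hx =>
    (M.hasFDerivAt_of_mem hq hx).fderiv⟩

lemma nice_of_mem {u : E d → E d} (hu : u ∈ M.velocitySpace) : M.Nice u :=
  nice_of_continuous hu.1

/-- The matrix of a linear map. -/
def toMat : (E d →L[ℝ] E d) →ₗ[ℝ] Mat d where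
  toFun L := Matrix.of fun i j => (L (EuclideanSpace.single j 1)) i
  map_add' L L' := by ext; simp
  map_smul' c L := by ext; simp

lemma grad_eq (u : E d → E d) (x : E d) : grad u x = toMat (fderiv ℝ u x) := rfl

lemma continuous_toMat : Continuous (toMat (d := d)) :=
  LinearMap.continuous_of_finiteDimensional _

lemma nice_grad {u : E d → E d} (hu : u ∈ M.velocitySpace) : M.Nice (grad u) :=
  (M.nice_fderiv hu).map continuous_toMat

lemma continuous_trace : Continuous (Matrix.trace : Mat d → ℝ) :=
  (Matrix.traceLinearMap (Fin d) ℝ ℝ).continuous_of_finiteDimensional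

lemma nice_divg {u : E d → E d} (hu : u ∈ M.velocitySpace) : M.Nice (divg u) :=
  (M.nice_grad hu).map continuous_trace

/-- The velocity gradient is affine in each element. -/
lemma exists_affine_grad {u : E d → E d} (hu : u ∈ M.velocitySpace) (k : Fin M.N) :
    ∃ A : E d →ᵃ[ℝ] Mat d, ∀ x ∈ M.cellInt k, grad u x = A x := by
  obtain ⟨q, hq⟩ := M.exists_quad_of_mem hu
  let L : E d →ₗ[ℝ] Mat d := toMat ∘ₗ ((q k).2.2 + (q k).2.2.flip).toLinearMap
  refine ⟨L.toAffineMap + AffineMap.const ℝ (E d) (toMat (q k).2.1), fun x hx => ?_⟩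
  rw [grad_eq, (M.hasFDerivAt_of_mem hq hx).fderiv, Quad.deriv]
  simp only [AffineMap.coe_add, Pi.add_apply, LinearMap.coe_toAffineMap, AffineMap.const_apply, L,
    LinearMap.comp_apply, ← map_add]
  congr 1
  ext v : 1
  simp
  abel

/-- A continuous function on an interval which is Lipschitz on finitely many closed sets covering
the interval is Lipschitz. -/
lemma dist_le_of_closed_cover {F : Type*} [PseudoMetricSpace F] {ι : Type*} [Finite ι] {f : ℝ → F}
    (hf : Continuous f) {A : ι → Set ℝ} (hA : ∀ i, IsClosed (A i)) {C : ℝ}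
    (hcov : ∀ t, ∃ i, t ∈ A i)
    (hC : ∀ i, ∀ s ∈ A i, ∀ t ∈ A i, dist (f s) (f t) ≤ C * |s - t|) {a b : ℝ} (hab : a ≤ b) :
    dist (f a) (f b) ≤ C * (b - a) := by
  have hclosed : IsClosed ({t | dist (f a) (f t) ≤ C * (t - a)} ∩ Icc a b) := by
    refine IsClosed.inter (isClosed_le ?_ ?_) isClosed_Icc <;> fun_prop
  refine hclosed.Icc_subset_of_forall_exists_gt (by simp) ?_ ⟨hab, le_rfl⟩
  rintro t ⟨ht, htab⟩ y hy
  -- Among finitely many sets, one contains points arbitrarily close to `t` on its right; being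
  -- closed, it contains `t` too, and its Lipschitz bound carries the estimate past `t`.
  have hfreq : ∃ᶠ s in nhdsWithin t (Ioi t), ∃ i, s ∈ A i :=
    (Filter.Eventually.of_forall hcov).frequently
  rw [Filter.frequently_exists] at hfreq
  obtain ⟨i, hi⟩ := hfreq
  have hti : t ∈ A i := (hA i).closure_subset
    (mem_closure_iff_frequently.2 (hi.filter_mono nhdsWithin_le_nhds))
  obtain ⟨s, hs, hsA⟩ := (Filter.Eventually.and_frequently
    (Ioc_mem_nhdsGT (hy : t < y)) hi).exists
  refine ⟨s, ?_, hs⟩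
  have h1 := hC i t hti s hsA
  rw [abs_sub_comm, abs_of_pos (sub_pos.2 hs.1)] at h1
  calc dist (f a) (f s) ≤ dist (f a) (f t) + dist (f t) (f s) := dist_triangle _ _ _
    _ ≤ C * (t - a) + C * (s - t) := add_le_add ht h1
    _ = _ := by ring

/-- The field is smooth on each convex compact element and zero off the domain. Along any segment
the elements and the complement of the domain form a finite closed cover, and continuity joins the
estimates. This avoids any assumption on the shape of the domain. -/
lemma exists_lipschitz_of_mem {u : E d → E d} (hu : u ∈ M.velocitySpace) :
    ∃ C : NNReal, LipschitzWith C u := by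
  obtain ⟨q, hq⟩ := M.exists_quad_of_mem hu
  have hK : ∀ k, ∃ K : NNReal, LipschitzOnWith K u (M.elem k) := by
    intro k
    obtain ⟨B, hB⟩ := (M.isCompact_elem k).exists_bound_of_continuousOn
      (q k).continuous_deriv.continuousOn
    refine ⟨B.toNNReal, ?_⟩
    have := (M.convex_elem k).lipschitzOnWith_of_nnnorm_hasFDerivWithin_le
      (f := (q k).eval) (f' := (q k).deriv) (C := B.toNNReal)
      (fun x _ => ((q k).hasFDerivAt x).hasFDerivWithinAt) (fun x hx => by
        rw [← NNReal.coe_le_coe]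
        exact (hB x hx).trans (Real.le_coe_toNNReal B))
    intro x hx y hy
    rw [hq k x hx, hq k y hy]
    exact this hx hy
  choose K hK using hK
  set C : NNReal := ∑ k, K k
  refine ⟨C, LipschitzWith.of_dist_le_mul fun x y => ?_⟩
  let γ : ℝ → E d := AffineMap.lineMap x y
  have hγ : Continuous γ := AffineMap.lineMap_continuous
  have hdist : ∀ s t, dist (γ s) (γ t) = |s - t| * dist x y := by
    intro s t
    rw [dist_lineMap_lineMap, Real.dist_eq]
  let A : Option (Fin M.N) → Set ℝ := fun o => γ ⁻¹' (o.elim M.domainᶜ M.elem)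
  have := dist_le_of_closed_cover (f := fun t => u (γ t)) (hu.1.comp hγ) (A := A)
    (C := C * dist x y) ?_ ?_ ?_ zero_le_one
  · simpa [γ] using this
  · rintro (_ | k)
    · exact M.isOpen_domain.isClosed_compl.preimage hγ
    · exact (M.isClosed_elem k).preimage hγ
  · intro t
    by_cases h : γ t ∈ M.domain
    · obtain ⟨k, hk⟩ := mem_iUnion.1 (M.domain_subset h)
      exact ⟨some k, hk⟩
    · exact ⟨none, h⟩
  · rintro (_ | k) s hs t ht
    · change dist (u (γ s)) (u (γ t)) ≤ _
      rw [hu.2.1 _ hs, hu.2.1 _ ht, dist_self]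
      positivity
    · refine ((hK k).dist_le_mul _ hs _ ht).trans ?_
      rw [hdist, mul_assoc, mul_comm |s - t|]
      gcongr
      exact Finset.single_le_sum (f := K) (fun k _ => zero_le) (Finset.mem_univ k)

end Mesh
end OldroydLog
end

noncomputable section
namespace OldroydLog
open scoped Matrix.Norms.Frobenius

/-! ### Integration by parts for Lipschitz fields -/

section WeakDivergence
variable {d : ℕ}

lemma grad_apply (u : E d → E d) (x : E d) (i j : Fin d) :
    grad u x i j = (fderiv ℝ u x (EuclideanSpace.single j 1)) i := rfl

lemma sum_coord_smul_single (v : E d) : ∑ i, v i • EuclideanSpace.single i (1 : ℝ) = v := by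
  ext j
  simp [Pi.single_apply]

lemma LipschitzWith.coord {C : NNReal} {w : E d → E d} (hw : LipschitzWith C w) (i : Fin d) :
    LipschitzWith C fun x => w x i := by
  refine LipschitzWith.of_dist_le_mul fun x y => ?_
  refine le_trans ?_ (hw.dist_le_mul x y)
  rw [dist_eq_norm, dist_eq_norm]
  exact PiLp.norm_apply_le (w x - w y) i

/-- Integration by parts for Lipschitz fields. -/
lemma integral_fderiv_apply {C D : NNReal} {w : E d → E d} (hw : LipschitzWith C w)
    (hc : HasCompactSupport w) {g : E d → ℝ} (hg : LipschitzWith D g) :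
    ∫ x, fderiv ℝ g x (w x) = -∫ x, divg w x * g x := by
  let e : Fin d → E d := fun i => EuclideanSpace.single i 1
  have hci : ∀ i, HasCompactSupport fun x => w x i := fun i =>
    hc.comp_left (g := fun v : E d => v i) rfl
  have hint : ∀ (f h : E d → ℝ) (K : NNReal) (v : E d), LipschitzWith K f → Continuous h →
      HasCompactSupport h → Integrable fun x => lineDeriv ℝ f x v * h x := by
    intro f h K v hf hh hhc
    refine (hh.integrable_of_hasCompactSupport hhc).bdd_mul (c := K * ‖v‖) ?_ ?_
    · exact (measurable_lineDeriv hf.continuous).aestronglyMeasurable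
    · exact ae_of_all _ fun x => norm_lineDeriv_le_of_lipschitz ℝ hf
  have hw' : ∀ i, Integrable fun x => lineDeriv ℝ (fun y => w y i) x (-e i) * g x := by
    intro i
    have hc2 : HasCompactSupport fun x => lineDeriv ℝ (fun y => w y i) x (-e i) := by
      refine HasCompactSupport.intro (hci i) fun x hx => ?_
      have : (fun y => w y i) =ᶠ[nhds x] fun _ => 0 := notMem_tsupport_iff_eventuallyEq.1 hx
      rw [this.lineDeriv_eq]
      simp [lineDeriv]
    have hm : AEStronglyMeasurable (fun x => lineDeriv ℝ (fun y => w y i) x (-e i)) volume :=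
      (measurable_lineDeriv (LipschitzWith.coord hw i).continuous).aestronglyMeasurable
    have hsub : Function.support (fun x => lineDeriv ℝ (fun y => w y i) x (-e i) * g x) ⊆
        tsupport (fun y => w y i) := by
      intro x hx
      by_contra hx'
      have : (fun y => w y i) =ᶠ[nhds x] fun _ => 0 := notMem_tsupport_iff_eventuallyEq.1 hx'
      apply hx
      beta_reduce
      rw [this.lineDeriv_eq]
      simp [lineDeriv]
    rw [← integrableOn_iff_integrable_of_support_subset hsub]
    refine Integrable.bdd_mul (c := C * ‖-e i‖) ?_ hm.restrict ?_
    · exact hg.continuous.continuousOn.integrableOn_compact (hci i)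
    · exact ae_of_all _ fun x => norm_lineDeriv_le_of_lipschitz ℝ (LipschitzWith.coord hw i)
  -- By Rademacher's theorem derivatives are sums of line derivatives almost everywhere, and
  -- integration by parts is applied in each coordinate direction.
  have h1 : ∫ x, fderiv ℝ g x (w x) = ∫ x, ∑ i, lineDeriv ℝ g x (e i) * w x i := by
    refine integral_congr_ae ?_
    filter_upwards [hg.ae_differentiableAt] with x hx
    nth_rewrite 1 [← sum_coord_smul_single (w x)]
    rw [map_sum]
    refine Finset.sum_congr rfl fun i _ => ?_
    rw [map_smul, hx.lineDeriv_eq_fderiv, smul_eq_mul, mul_comm]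
  have h2 : ∫ x, ∑ i, lineDeriv ℝ g x (e i) * w x i =
      ∑ i, ∫ x, lineDeriv ℝ g x (e i) * w x i :=
    integral_finsetSum _ fun i _ =>
      hint g _ D _ hg (LipschitzWith.coord hw i).continuous (hci i)
  have h3 : ∀ i, ∫ x, lineDeriv ℝ g x (e i) * w x i =
      ∫ x, lineDeriv ℝ (fun y => w y i) x (-e i) * g x := fun i =>
    LipschitzWith.integral_lineDeriv_mul_eq hg (LipschitzWith.coord hw i) (hci i) (e i)
  rw [h1, h2, Finset.sum_congr rfl fun i _ => h3 i, ← integral_finsetSum _ fun i _ => hw' i,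
    ← integral_neg]
  refine integral_congr_ae ?_
  filter_upwards [hw.ae_differentiableAt] with x hx
  have hl : ∀ i, lineDeriv ℝ (fun y => w y i) x (-e i) = -grad w x i i := by
    intro i
    have h4 : HasFDerivAt (fun y => w y i)
        ((EuclideanSpace.proj i : E d →L[ℝ] ℝ) ∘L fderiv ℝ w x) x :=
      (EuclideanSpace.proj i : E d →L[ℝ] ℝ).hasFDerivAt.comp x hx.hasFDerivAt
    rw [h4.differentiableAt.lineDeriv_eq_fderiv, h4.fderiv, map_neg]
    rfl
  simp only [hl, neg_mul, Finset.sum_neg_distrib, ← Finset.sum_mul]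
  rfl

lemma lipschitz_norm_sq {F G : Type*} [PseudoMetricSpace F] [NormedAddCommGroup G]
    {C : NNReal} {u : F → G}
    (hu : LipschitzWith C u) {B : ℝ} (hB : ∀ x, ‖u x‖ ≤ B) :
    LipschitzWith (2 * B.toNNReal * C) fun x => ‖u x‖ ^ 2 := by
  refine LipschitzWith.of_dist_le_mul fun x y => ?_
  have hB0 : 0 ≤ B := (norm_nonneg _).trans (hB x)
  have h1 : |‖u x‖ - ‖u y‖| ≤ C * dist x y :=
    (abs_norm_sub_norm_le _ _).trans (by rw [← dist_eq_norm]; exact hu.dist_le_mul x y)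
  rw [Real.dist_eq, sq_sub_sq, abs_mul, abs_of_nonneg (by positivity)]
  push_cast
  rw [Real.coe_toNNReal _ hB0, mul_assoc]
  exact mul_le_mul (by linarith [hB x, hB y]) h1 (abs_nonneg _) (by positivity)

/-- A Lipschitz field with compact support and zero derivative is zero. -/
lemma eq_zero_of_ae_hasFDerivAt_zero [NeZero d] {C : NNReal} {u : E d → E d}
    (hu : LipschitzWith C u) (hc : HasCompactSupport u)
    (h : ∀ᵐ x, HasFDerivAt u (0 : E d →L[ℝ] E d) x) :
    u = 0 := by
  obtain ⟨B, hB⟩ := hu.continuous.bounded_above_of_compact_support hc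
  have hsq : LipschitzWith (2 * B.toNNReal * C) fun x => ‖u x‖ ^ 2 :=
    lipschitz_norm_sq hu hB
  let f : E d →L[ℝ] ℝ := EuclideanSpace.proj 0
  have hcs : HasCompactSupport fun x => ‖u x‖ ^ 2 := hc.comp_left (g := fun v : E d => ‖v‖ ^ 2) (by simp)
  -- Integration by parts against the coordinate `f x = x 0`, whose derivative is `1`, expresses the
  -- integral of `‖u‖²` through a derivative of `‖u‖²`, which is zero almost everywhere.
  have key := LipschitzWith.integral_lineDeriv_mul_eq (μ := volume) (f := f) f.lipschitz hsq hcs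
    (EuclideanSpace.single 0 1)
  have h0 : ∫ x, lineDeriv ℝ (fun x => ‖u x‖ ^ 2) x (-EuclideanSpace.single 0 1) * f x = 0 := by
    rw [← integral_zero (E d) ℝ]
    refine integral_congr_ae ?_
    filter_upwards [h] with x hx
    have h1 := hx.norm_sq
    rw [h1.differentiableAt.lineDeriv_eq_fderiv, h1.fderiv]
    simp
  have h1 : ∀ x, lineDeriv ℝ f x (EuclideanSpace.single 0 1) = 1 := by
    intro x
    rw [f.differentiableAt.lineDeriv_eq_fderiv, f.fderiv]
    simp [f]
  rw [h0] at key
  simp only [h1, one_mul] at key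
  have hcont : Continuous fun x => ‖u x‖ ^ 2 := hsq.continuous
  have h2 := (integral_eq_zero_iff_of_nonneg (fun x => by positivity)
    (hcont.integrable_of_hasCompactSupport hcs)).1 key
  have h3 : (fun x => ‖u x‖ ^ 2) = fun _ => (0 : ℝ) :=
    (Continuous.ae_eq_iff_eq volume hcont continuous_const).1 h2
  funext x
  simpa using congrFun h3 x

end WeakDivergence

/-! ### The forms of the discretization -/

namespace Mesh
variable {d : ℕ} {M : Mesh d}

lemma fn_lipschitz (u : M.Vel) : ∃ C : NNReal, LipschitzWith C (M.fn u) :=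
  M.exists_lipschitz_of_mem (fn_mem u)

lemma differentiableAt_fn (u : M.Vel) {k : Fin M.N} {x : E d} (hx : x ∈ M.cellInt k) :
    DifferentiableAt ℝ (M.fn u) x := M.differentiableAt_of_mem (fn_mem u) hx

lemma fderiv_fn_add (u v : M.Vel) {k : Fin M.N} {x : E d} (hx : x ∈ M.cellInt k) :
    fderiv ℝ (M.fn (u + v)) x = fderiv ℝ (M.fn u) x + fderiv ℝ (M.fn v) x := by
  rw [map_add, fderiv_add (differentiableAt_fn u hx) (differentiableAt_fn v hx)]

lemma fderiv_fn_smul (c : ℝ) (u : M.Vel) (x : E d) :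
    fderiv ℝ (M.fn (c • u)) x = c • fderiv ℝ (M.fn u) x := by
  rw [map_smul, fderiv_const_smul_field]
  rfl

lemma grad_fn_add (u v : M.Vel) {k : Fin M.N} {x : E d} (hx : x ∈ M.cellInt k) :
    grad (M.fn (u + v)) x = grad (M.fn u) x + grad (M.fn v) x := by
  rw [grad_eq, fderiv_fn_add u v hx, map_add]; rfl

lemma grad_fn_smul (c : ℝ) (u : M.Vel) (x : E d) :
    grad (M.fn (c • u)) x = c • grad (M.fn u) x := by
  rw [grad_eq, fderiv_fn_smul, map_smul]; rfl

lemma divg_fn_add (u v : M.Vel) {k : Fin M.N} {x : E d} (hx : x ∈ M.cellInt k) :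
    divg (M.fn (u + v)) x = divg (M.fn u) x + divg (M.fn v) x := by
  rw [divg, grad_fn_add u v hx, Matrix.trace_add]; rfl

lemma divg_fn_smul (c : ℝ) (u : M.Vel) (x : E d) :
    divg (M.fn (c • u)) x = c * divg (M.fn u) x := by
  rw [divg, grad_fn_smul, Matrix.trace_smul]; rfl

/-- Outside the elements and almost everywhere, velocities are differentiable. -/
lemma ae_cell_or_eventually_zero (u : M.Vel) :
    ∀ᵐ x : E d, (∃ k, x ∈ M.cellInt k) ∨ M.fn u =ᶠ[nhds x] 0 := by
  filter_upwards [M.ae_mem_cell] with x hx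
  refine hx.imp_right fun hx => ?_
  filter_upwards [M.isCompact_iUnion_elem.isClosed.isOpen_compl.mem_nhds hx] with y hy
  exact M.eq_zero_of_notMem (fn_mem u) hy

/-- This replaces Poincaré's inequality and makes the viscous form definite; the no-slip condition
enters through the extension by zero, and connectedness of the domain plays no part. -/
lemma fn_eq_zero_of_fderiv [NeZero d] (u : M.Vel)
    (h : ∀ k, ∀ x ∈ M.cellInt k, fderiv ℝ (M.fn u) x = 0) : u = 0 := by
  obtain ⟨C, hC⟩ := fn_lipschitz u
  apply fn_injective
  rw [map_zero]
  refine eq_zero_of_ae_hasFDerivAt_zero hC (M.hasCompactSupport_of_mem (fn_mem u)) ?_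
  filter_upwards [ae_cell_or_eventually_zero u] with x hx
  rcases hx with ⟨k, hk⟩ | hx
  · have := (differentiableAt_fn u hk).hasFDerivAt
    rwa [h k x hk] at this
  · exact (hasFDerivAt_const (0 : E d) x).congr_of_eventuallyEq hx

/-- Solenoidal velocities are weakly solenoidal. -/
lemma integral_fderiv_fn {w : M.Vel} (hw : ∀ k, ∀ x ∈ M.cellInt k, divg (M.fn w) x = 0)
    {g : E d → ℝ} {D : NNReal} (hg : LipschitzWith D g) :
    ∫ x, fderiv ℝ g x (M.fn w x) = 0 := by
  obtain ⟨C, hC⟩ := fn_lipschitz w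
  rw [integral_fderiv_apply hC (M.hasCompactSupport_of_mem (fn_mem w)) hg, neg_eq_zero,
    ← integral_zero (E d) ℝ]
  refine integral_congr_ae ?_
  filter_upwards [ae_cell_or_eventually_zero w] with x hx
  rcases hx with ⟨k, hk⟩ | hx
  · rw [hw k x hk, zero_mul]
  · have : fderiv ℝ (M.fn w) x = 0 := by
      rw [hx.fderiv_eq]; exact fderiv_const_apply 0
    rw [divg, grad_eq, this, map_zero, Matrix.trace_zero, zero_mul]

lemma nice_fn (u : M.Vel) : M.Nice (M.fn u) := M.nice_of_mem (fn_mem u)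
lemma nice_fderiv_fn (u : M.Vel) : M.Nice (fderiv ℝ (M.fn u)) := M.nice_fderiv (fn_mem u)
lemma nice_grad_fn (u : M.Vel) : M.Nice (grad (M.fn u)) := M.nice_grad (fn_mem u)
lemma nice_divg_fn (u : M.Vel) : M.Nice (divg (M.fn u)) := M.nice_divg (fn_mem u)

lemma nice_convect (w u : M.Vel) : M.Nice (convect (M.fn w) (M.fn u)) :=
  Nice.map₂ (nice_fderiv_fn u) (nice_fn w) (φ := fun L v => L v) (by fun_prop)

variable (M)

/-- The inertia form. -/
def mass : M.Vel →ₗ[ℝ] M.Vel →ₗ[ℝ] ℝ :=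
  LinearMap.mk₂ ℝ (fun u v => M.sumInt fun x => inner ℝ (M.fn u x) (M.fn v x))
    (fun u u' v => by
      rw [← sumInt_add ((nice_fn u).inner (nice_fn v)) ((nice_fn u').inner (nice_fn v))]
      exact sumInt_congr fun k x _ => by rw [fn_add, inner_add_left])
    (fun c u v => by
      rw [smul_eq_mul, ← sumInt_const_mul]
      exact sumInt_congr fun k x _ => by rw [fn_smul, real_inner_smul_left])
    (fun u v v' => by
      rw [← sumInt_add ((nice_fn u).inner (nice_fn v)) ((nice_fn u).inner (nice_fn v'))]
      exact sumInt_congr fun k x _ => by rw [fn_add, inner_add_right])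
    (fun c u v => by
      rw [smul_eq_mul, ← sumInt_const_mul]
      exact sumInt_congr fun k x _ => by rw [fn_smul, real_inner_smul_right])

/-- The viscosity form. -/
def visc : M.Vel →ₗ[ℝ] M.Vel →ₗ[ℝ] ℝ :=
  LinearMap.mk₂ ℝ (fun u v => M.sumInt fun x => ddot (grad (M.fn u) x) (grad (M.fn v) x))
    (fun u u' v => by
      rw [← sumInt_add ((nice_grad_fn u).ddot (nice_grad_fn v))
        ((nice_grad_fn u').ddot (nice_grad_fn v))]
      exact sumInt_congr fun k x hx => by rw [grad_fn_add u u' hx, ddot_add_left])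
    (fun c u v => by
      rw [smul_eq_mul, ← sumInt_const_mul]
      exact sumInt_congr fun k x _ => by rw [grad_fn_smul, ddot_smul_left])
    (fun u v v' => by
      rw [← sumInt_add ((nice_grad_fn u).ddot (nice_grad_fn v))
        ((nice_grad_fn u).ddot (nice_grad_fn v'))]
      exact sumInt_congr fun k x hx => by rw [grad_fn_add v v' hx, ddot_add_right])
    (fun c u v => by
      rw [smul_eq_mul, ← sumInt_const_mul]
      exact sumInt_congr fun k x _ => by rw [grad_fn_smul, ddot_smul_right])

lemma convect_apply (w u : E d → E d) (x : E d) : convect w u x = fderiv ℝ u x (w x) := rfl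

/-- The convection form. -/
def conv : M.Vel →ₗ[ℝ] M.Vel →ₗ[ℝ] M.Vel →ₗ[ℝ] ℝ :=
  LinearMap.mk₂ ℝ (fun w u =>
    { toFun := fun v => M.sumInt fun x => inner ℝ (convect (M.fn w) (M.fn u) x) (M.fn v x)
      map_add' := fun v v' => by
        rw [← sumInt_add ((nice_convect w u).inner (nice_fn v))
          ((nice_convect w u).inner (nice_fn v'))]
        exact sumInt_congr fun k x _ => by rw [fn_add, inner_add_right]
      map_smul' := fun c v => by
        rw [smul_eq_mul, ← sumInt_const_mul]
        exact sumInt_congr fun k x _ => by rw [fn_smul, real_inner_smul_right]; rfl })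
    (fun w w' u => LinearMap.ext fun v => by
      refine Eq.trans ?_ (sumInt_add ((nice_convect w u).inner (nice_fn v))
        ((nice_convect w' u).inner (nice_fn v)))
      exact sumInt_congr fun k x _ => by
        rw [convect_apply, fn_add, map_add, inner_add_left]; rfl)
    (fun c w u => LinearMap.ext fun v => by
      refine Eq.trans ?_ (sumInt_const_mul _ _)
      exact sumInt_congr fun k x _ => by
        rw [convect_apply, fn_smul, map_smul, real_inner_smul_left]; rfl)
    (fun w u u' => LinearMap.ext fun v => by
      refine Eq.trans ?_ (sumInt_add ((nice_convect w u).inner (nice_fn v))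
        ((nice_convect w u').inner (nice_fn v)))
      exact sumInt_congr fun k x hx => by
        rw [convect_apply, fderiv_fn_add u u' hx, add_apply, inner_add_left]; rfl)
    (fun c w u => LinearMap.ext fun v => by
      refine Eq.trans ?_ (sumInt_const_mul _ _)
      exact sumInt_congr fun k x _ => by
        rw [convect_apply, fderiv_fn_smul, smul_apply,
          real_inner_smul_left]; rfl)

/-- The integral of the gradient over an element. -/
def gr (k : Fin M.N) : M.Vel →ₗ[ℝ] Mat d where
  toFun u := ∫ x in M.cellInt k, grad (M.fn u) x
  map_add' u v := by
    rw [← integral_add ((nice_grad_fn u).integrableOn k) ((nice_grad_fn v).integrableOn k)]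
    exact setIntegral_congr_fun isOpen_interior.measurableSet fun x hx => grad_fn_add u v hx
  map_smul' c u := by
    rw [RingHom.id_apply, ← integral_smul]
    exact setIntegral_congr_fun isOpen_interior.measurableSet fun x _ => grad_fn_smul c u x

lemma linear_gr {F : Type*} [NormedAddCommGroup F] [NormedSpace ℝ F] [CompleteSpace F]
    (f : Mat d →ₗ[ℝ] F) (k : Fin M.N) (u : M.Vel) :
    f (M.gr k u) = ∫ x in M.cellInt k, f (grad (M.fn u) x) :=
  (f.toContinuousLinearMap.integral_comp_comm ((nice_grad_fn u).integrableOn k)).symm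

/-- The pairing of discontinuous pressures with divergences. -/
def pressure : M.P1disc ℝ →ₗ[ℝ] M.Vel →ₗ[ℝ] ℝ :=
  LinearMap.mk₂ ℝ (fun p v => M.sumInt fun x => M.p1 p x * divg (M.fn v) x)
    (fun p p' v => by
      rw [← sumInt_add ((nice_p1 p).mul (nice_divg_fn v)) ((nice_p1 p').mul (nice_divg_fn v))]
      exact sumInt_congr fun k x hx => by
        rw [M.p1_apply _ hx, M.p1_apply _ hx, M.p1_apply _ hx, ← add_mul]; rfl)
    (fun c p v => by
      rw [smul_eq_mul, ← sumInt_const_mul]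
      exact sumInt_congr fun k x hx => by
        rw [M.p1_apply _ hx, M.p1_apply _ hx, ← mul_assoc]; rfl)
    (fun p v v' => by
      rw [← sumInt_add ((nice_p1 p).mul (nice_divg_fn v)) ((nice_p1 p).mul (nice_divg_fn v'))]
      exact sumInt_congr fun k x hx => by rw [divg_fn_add v v' hx, mul_add])
    (fun c p v => by
      rw [smul_eq_mul, ← sumInt_const_mul]
      exact sumInt_congr fun k x hx => by rw [divg_fn_smul]; ring)

/-- The solenoidal velocities. -/
def solenoidal : Submodule ℝ M.Vel := (LinearMap.range M.pressure).dualCoannihilator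

variable {M}

lemma mem_solenoidal {v : M.Vel} :
    v ∈ M.solenoidal ↔ ∀ p : M.P1disc ℝ, M.sumInt (fun x => M.p1 p x * divg (M.fn v) x) = 0 := by
  rw [solenoidal, Submodule.mem_dualCoannihilator]
  constructor
  · intro h p
    exact h _ ⟨p, rfl⟩
  · rintro h _ ⟨p, rfl⟩
    exact h p

/-- A functional vanishing on the solenoidal velocities comes from a pressure. -/
lemma exists_pressure (f : M.Vel →ₗ[ℝ] ℝ) (hf : ∀ v ∈ M.solenoidal, f v = 0) :
    ∃ p : M.P1disc ℝ, ∀ v, f v = M.sumInt fun x => M.p1 p x * divg (M.fn v) x := by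
  have h1 : f ∈ M.solenoidal.dualAnnihilator := (Submodule.mem_dualAnnihilator _).2 hf
  -- In finite dimension a subspace of the dual is the annihilator of its coannihilator. A pressure
  -- therefore exists without an inf-sup condition; it need not be unique.
  rw [solenoidal, Subspace.dualCoannihilator_dualAnnihilator_eq] at h1
  obtain ⟨p, rfl⟩ := h1
  exact ⟨p, fun v => rfl⟩

/-- The divergence of a piecewise quadratic field is piecewise affine, hence an admissible pressure.
Tested with itself, its square has zero integral. -/
lemma divg_eq_zero {w : M.Vel} (hw : w ∈ M.solenoidal) :
    ∀ k, ∀ x ∈ M.cellInt k, divg (M.fn w) x = 0 := by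
  choose A hA using fun k => M.exists_affine_grad (fn_mem w) k
  let p : M.P1disc ℝ := fun k => (Matrix.traceLinearMap (Fin d) ℝ ℝ).toAffineMap.comp (A k)
  have hp : ∀ k, ∀ x ∈ M.cellInt k, M.p1 p x = divg (M.fn w) x := by
    intro k x hx
    rw [M.p1_apply _ hx, divg, hA k x hx]
    rfl
  have h0 := mem_solenoidal.1 hw p
  rw [sumInt_congr fun k x hx => by rw [hp k x hx]] at h0
  intro k x hx
  have := ((nice_divg_fn w).mul (nice_divg_fn w)).eq_zero_of_sumInt
    (fun k x _ => mul_self_nonneg _) h0 k x hx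
  exact mul_self_eq_zero.1 this

/-- Integrals over the whole space of functions vanishing off the elements. -/
lemma integral_eq_sumInt {f : E d → ℝ} (hf : ∀ x ∉ ⋃ k, M.elem k, f x = 0)
    (hn : ∀ k, IntegrableOn f (M.cellInt k)) : ∫ x, f x = M.sumInt f := by
  have h : (M.domain : Set (E d)) =ᵐ[volume] ⋃ k, M.elem k :=
    M.domain_ae_eq.trans (Filter.EventuallyEq.countable_iUnion fun k => (M.elem_ae_eq k).symm)
  rw [← setIntegral_eq_integral_of_forall_compl_eq_zero (s := ⋃ k, M.elem k) hf,
    ← setIntegral_congr_set h, M.setIntegral_domain f hn]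
  rfl

/-- The integrand is half the derivative of `‖u‖²` along `w`. As `‖u‖²` is Lipschitz and `w` weakly
solenoidal, its integral vanishes. -/
lemma conv_self {w : M.Vel} (hw : w ∈ M.solenoidal) (u : M.Vel) : M.conv w u u = 0 := by
  obtain ⟨C, hC⟩ := fn_lipschitz u
  obtain ⟨B, hB⟩ := hC.continuous.bounded_above_of_compact_support
    (M.hasCompactSupport_of_mem (fn_mem u))
  have h1 := integral_fderiv_fn (divg_eq_zero hw) (lipschitz_norm_sq hC hB)
  have h2 : ∀ k, ∀ x ∈ M.cellInt k, fderiv ℝ (fun x => ‖M.fn u x‖ ^ 2) x (M.fn w x) =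
      2 * inner ℝ (convect (M.fn w) (M.fn u) x) (M.fn u x) := by
    intro k x hx
    rw [(differentiableAt_fn u hx).hasFDerivAt.norm_sq.fderiv]
    simp [convect_apply, real_inner_comm]
  rw [integral_eq_sumInt, sumInt_congr h2, sumInt_const_mul] at h1
  · have h3 : (2 : ℝ) * M.conv w u u = 0 := h1
    linarith
  · intro x hx
    rw [M.eq_zero_of_notMem (fn_mem w) hx, map_zero]
  · intro k
    exact ((((nice_convect w u).inner (nice_fn u)).const_mul 2).integrableOn k).congr_fun
      (fun x hx => (h2 k x hx).symm) isOpen_interior.measurableSet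

lemma mass_pos (v : M.Vel) (hv : v ≠ 0) : 0 < M.mass v v := by
  have hnn : ∀ k, ∀ x ∈ M.cellInt k, 0 ≤ inner ℝ (M.fn v x) (M.fn v x) :=
    fun _ _ _ => real_inner_self_nonneg
  refine lt_of_le_of_ne (sumInt_nonneg hnn) fun h => hv ?_
  have h1 := ((nice_fn v).inner (nice_fn v)).eq_zero_of_sumInt hnn h.symm
  apply fn_injective
  rw [map_zero]
  have hae : M.fn v =ᵐ[volume] fun _ => (0 : E d) := by
    filter_upwards [ae_cell_or_eventually_zero v] with x hx
    rcases hx with ⟨k, hk⟩ | hx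
    · exact inner_self_eq_zero.1 (h1 k x hk)
    · exact hx.self_of_nhds
  exact (Continuous.ae_eq_iff_eq volume (fn_mem v).1 continuous_const).1 hae

lemma visc_pos [NeZero d] (v : M.Vel) (hv : v ≠ 0) : 0 < M.visc v v := by
  have hnn : ∀ k, ∀ x ∈ M.cellInt k, 0 ≤ ddot (grad (M.fn v) x) (grad (M.fn v) x) :=
    fun _ _ _ => by rw [ddot_self]; positivity
  refine lt_of_le_of_ne (sumInt_nonneg hnn) fun h => hv ?_
  have h1 := ((nice_grad_fn v).ddot (nice_grad_fn v)).eq_zero_of_sumInt hnn h.symm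
  refine fn_eq_zero_of_fderiv v fun k x hx => ?_
  have h2 : grad (M.fn v) x = 0 := by
    have := h1 k x hx
    rw [ddot_self] at this
    simpa using this
  refine ContinuousLinearMap.coe_injective ((EuclideanSpace.basisFun (Fin d) ℝ).toBasis.ext
    fun j => ?_)
  ext i
  have := congrFun (congrFun h2 i) j
  simpa [grad_apply] using this

variable (M)

/-- The forms of the discretization. -/
def forms [NeZero d] : Forms d M.N M.Vel where
  V₀ := M.solenoidal
  mass := M.mass
  visc := M.visc
  conv := M.conv
  gr := M.gr
  vol := M.vol
  mass_symm u v := sumInt_congr fun _ _ _ => real_inner_comm _ _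
  mass_pos := mass_pos
  visc_pos := visc_pos
  vol_pos := M.vol_pos
  trace_gr k u hu := by
    have := M.linear_gr (Matrix.traceLinearMap (Fin d) ℝ ℝ) k u
    rw [Matrix.traceLinearMap_apply] at this
    rw [this]
    exact setIntegral_eq_zero_of_forall_eq_zero fun x hx => divg_eq_zero hu k x hx
  conv_self w hw u := conv_self hw u

end Mesh

end OldroydLog
end

noncomputable section
namespace OldroydLog
open scoped Matrix.Norms.Frobenius
open NormedSpace (exp)

/-! ### From the weak formulation to the abstract step -/

namespace Mesh
variable {d : ℕ} {M : Mesh d}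

/-- Integrands linear in the gradient, with coefficients constant on each element, depend only on
the integrated gradients `gr`; this applies to the elastic and stretching terms because the stress
is piecewise constant. -/
lemma sumInt_linear {f : E d → ℝ} (f' : Fin M.N → Mat d →ₗ[ℝ] ℝ) (u : M.Vel)
    (h : ∀ k, ∀ x ∈ M.cellInt k, f x = f' k (grad (M.fn u) x)) :
    M.Nice f ∧ M.sumInt f = ∑ k, f' k (M.gr k u) := by
  constructor
  · intro k
    obtain ⟨g, hg, hgx⟩ := nice_grad_fn u k
    exact ⟨fun x => f' k (g x), (LinearMap.continuous_of_finiteDimensional _).comp hg,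
      fun x hx => by rw [h k x hx, hgx x hx]⟩
  · rw [sumInt_congr (g := f) fun k x hx => rfl]
    refine Finset.sum_congr rfl fun k _ => ?_
    rw [M.linear_gr (f' k) k u]
    exact setIntegral_congr_fun isOpen_interior.measurableSet (h k)

lemma sumInt_cellwise_const {f : E d → ℝ} (c : Fin M.N → ℝ)
    (h : ∀ k, ∀ x ∈ M.cellInt k, f x = c k) :
    M.Nice f ∧ M.sumInt f = ∑ k, M.vol k * c k := by
  constructor
  · exact fun k => ⟨fun _ => c k, continuous_const, h k⟩
  · refine Finset.sum_congr rfl fun k _ => ?_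
    rw [setIntegral_congr_fun isOpen_interior.measurableSet (h k), setIntegral_const, smul_eq_mul]
    rfl

/-- The weak formulation, integrated over the elements. -/
lemma sumInt_integrand {Re Wi ε t : ℝ} (u u' v : M.Vel) (p' q : M.P1disc ℝ)
    {ψ' φ : Fin M.N → Mat d} {Ω B N : M.P1disc (Mat d)} (hψ' : ∀ k, (ψ' k).IsSymm)
    (hdec : M.IsDiscreteDecomposition (M.fn u') ψ' Ω B N) :
    M.Nice (M.integrand Re Wi ε t (M.fn u) (M.fn u') p' ψ' Ω B (M.fn v) q φ) ∧
    M.sumInt (M.integrand Re Wi ε t (M.fn u) (M.fn u') p' ψ' Ω B (M.fn v) q φ) =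
      Re * (t⁻¹ * (M.mass u' v - M.mass u v) + M.conv u u' v) - M.pressure p' v
      + M.pressure q u' + (1 - ε) * M.visc u' v
      + ε / Wi * ∑ k, ddot (exp (ψ' k)) (M.gr k v)
      - ∑ k, ddot (stretch (ψ' k) (M.gr k u')) (φ k)
      - 1 / Wi * ∑ k, M.vol k * ddot (exp (-ψ' k) - 1) (φ k) := by
  let a1 : E d → ℝ := fun x => inner ℝ (M.fn u' x) (M.fn v x)
  let a2 : E d → ℝ := fun x => inner ℝ (M.fn u x) (M.fn v x)
  let a3 : E d → ℝ := fun x => inner ℝ (convect (M.fn u) (M.fn u') x) (M.fn v x)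
  let a4 : E d → ℝ := fun x => M.p1 p' x * divg (M.fn v) x
  let a5 : E d → ℝ := fun x => M.p1 q x * divg (M.fn u') x
  let a6 : E d → ℝ := fun x => ddot (grad (M.fn u') x) (grad (M.fn v) x)
  let a7 : E d → ℝ := fun x => ddot (exp (M.p0 ψ' x)) (grad (M.fn v) x)
  let a8 : E d → ℝ := fun x => ddot (stretch (M.p0 ψ' x) (grad (M.fn u') x)) (M.p0 φ x)
  let a9 : E d → ℝ := fun x => ddot (exp (-(M.p0 ψ' x)) - 1) (M.p0 φ x)
  have h1 : M.Nice a1 := (nice_fn u').inner (nice_fn v)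
  have h2 : M.Nice a2 := (nice_fn u).inner (nice_fn v)
  have h3 : M.Nice a3 := (nice_convect u u').inner (nice_fn v)
  have h4 : M.Nice a4 := (nice_p1 p').mul (nice_divg_fn v)
  have h5 : M.Nice a5 := (nice_p1 q).mul (nice_divg_fn u')
  have h6 : M.Nice a6 := (nice_grad_fn u').ddot (nice_grad_fn v)
  obtain ⟨h7, i7⟩ := sumInt_linear (f := a7) (fun k => ddotₗ (exp (ψ' k))) v
    fun k x hx => by simp only [a7, M.p0_apply _ hx]; rfl
  obtain ⟨h8, i8⟩ := sumInt_linear (f := a8) (fun k => (ddotₗ (φ k)) ∘ₗ stretch (ψ' k)) u'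
    fun k x hx => by
      simp only [a8, M.p0_apply _ hx, LinearMap.comp_apply, ddotₗ_apply]
      exact ddot_comm _ _
  obtain ⟨h9, i9⟩ := sumInt_cellwise_const (f := a9) (fun k => ddot (exp (-ψ' k) - 1) (φ k))
    fun k x hx => by simp only [a9, M.p0_apply _ hx]
  have hcongr : ∀ k, ∀ x ∈ M.cellInt k,
      M.integrand Re Wi ε t (M.fn u) (M.fn u') p' ψ' Ω B (M.fn v) q φ x =
      Re * (t⁻¹ * (a1 x - a2 x) + a3 x) - a4 x + a5 x + (1 - ε) * a6 x + ε / Wi * a7 x - a8 x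
        - 1 / Wi * a9 x := by
    intro k x hx
    -- Here the fields `Ω` and `B` disappear from the formulation.
    have hs := stretch_eq (hψ' k) (hdec k x hx)
    simp only [integrand, a1, a2, a3, a4, a5, a6, a7, a8, a9, M.p0_apply _ hx, M.p1_apply Ω hx,
      M.p1_apply B hx, ← hs, inner_add_left, real_inner_smul_left, inner_sub_left, ddot_add_left,
      ddot_smul_left]
    ring
  have n12 := h1.sub h2
  have nt := n12.const_mul t⁻¹
  have n3 := nt.add h3
  have nR := n3.const_mul Re
  have n4 := nR.sub h4
  have n5 := n4.add h5
  have n6 := n5.add (h6.const_mul (1 - ε))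
  have n7 := n6.add (h7.const_mul (ε / Wi))
  have n8 := n7.sub h8
  have n9 := n8.sub (h9.const_mul (1 / Wi))
  constructor
  · intro k
    obtain ⟨g, hg, hgx⟩ := n9 k
    exact ⟨g, hg, fun x hx => (hcongr k x hx).trans (hgx x hx)⟩
  rw [sumInt_congr hcongr, sumInt_sub n8 (h9.const_mul _), sumInt_sub n7 h8,
    sumInt_add n6 (h7.const_mul _), sumInt_add n5 (h6.const_mul _), sumInt_add n4 h5,
    sumInt_sub nR h4, sumInt_const_mul, sumInt_add nt h3, sumInt_const_mul, sumInt_sub h1 h2,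
    sumInt_const_mul, sumInt_const_mul, sumInt_const_mul, i7, i8, i9]
  simp only [LinearMap.comp_apply, ddotₗ_apply, ddot_comm (φ _)]
  rfl

/-- Velocity gradients have discrete decompositions. -/
lemma exists_discrete_decomposition (u : M.Vel) {ψ : Fin M.N → Mat d} (hψ : ∀ k, (ψ k).IsSymm) :
    ∃ Ω B N, M.IsDiscreteDecomposition (M.fn u) ψ Ω B N := by
  choose A hA using fun k => M.exists_affine_grad (fn_mem u) k
  choose Ω B N h using fun k => exists_linear_decomposition (hψ k)
  refine ⟨fun k => (Ω k).toAffineMap.comp (A k), fun k => (B k).toAffineMap.comp (A k),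
    fun k => (N k).toAffineMap.comp (A k), fun k x hx => ?_⟩
  rw [hA k x hx]
  exact h k (A k x)

variable (M) in
/-- The weak form of a step, for a transport discretization. -/
def WeakStep [NeZero d] (T : Transport M.forms) (P : Params) (t : ℝ)
    (Y Y' : M.Vel × (Fin M.N → Mat d)) : Prop :=
  (∀ k, (Y'.2 k).IsSymm) ∧ ∃ (p' : M.P1disc ℝ) (Ω B N : M.P1disc (Mat d)),
    M.IsDiscreteDecomposition (M.fn Y'.1) Y'.2 Ω B N ∧
    ∀ (v : M.Vel) (q : M.P1disc ℝ), ∀ φ ∈ M.stressSpace,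
      0 = M.sumInt (M.integrand P.Re P.Wi P.ε t (M.fn Y.1) (M.fn Y'.1) p' Y'.2 Ω B (M.fn v) q φ)
        + ∑ k, ddot (t⁻¹ • (M.vol k • Y'.2 k - ∑ l, T.old Y.1 t k l • Y.2 l)
          + ∑ l, T.flux Y.1 t l k • (Y'.2 k - Y'.2 l)) (φ k)

/-- The test functions vary independently: `q` gives solenoidality, solenoidal `v` eliminates the
pressure, and `φ` equal to the residual of the stress equation makes this residual zero. The
residual is an admissible `φ` because the old stress is symmetric. Conversely the pressure comes
from duality and the decomposition from linear algebra. -/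
lemma weakStep_iff [NeZero d] (T : Transport M.forms) (P : Params) (t : ℝ)
    {Y Y' : M.Vel × (Fin M.N → Mat d)} (hY : ∀ k, (Y.2 k).IsSymm) :
    M.WeakStep T P t Y Y' ↔ T.Step P t Y Y' := by
  set R : Fin M.N → Mat d := fun k => t⁻¹ • (M.vol k • Y'.2 k - ∑ l, T.old Y.1 t k l • Y.2 l)
          + ∑ l, T.flux Y.1 t l k • (Y'.2 k - Y'.2 l) with hR
  set Z : Fin M.N → Mat d := fun k => R k - stretch (Y'.2 k) (M.gr k Y'.1)
    - (M.vol k / P.Wi) • (exp (-Y'.2 k) - 1) with hZ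
  have hsum : ∀ φ : Fin M.N → Mat d, ∑ k, ddot (Z k) (φ k) =
      ∑ k, ddot (R k) (φ k) - ∑ k, ddot (stretch (Y'.2 k) (M.gr k Y'.1)) (φ k)
      - 1 / P.Wi * ∑ k, M.vol k * ddot (exp (-Y'.2 k) - 1) (φ k) := by
    intro φ
    rw [Finset.mul_sum, ← Finset.sum_sub_distrib, ← Finset.sum_sub_distrib]
    refine Finset.sum_congr rfl fun k _ => ?_
    rw [hZ, ddot_sub_left, ddot_sub_left, ddot_smul_left]
    ring
  constructor
  · rintro ⟨hψ', p', Ω, B, N, hdec, h⟩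
    have h' : ∀ (v : M.Vel) (q : M.P1disc ℝ), ∀ φ ∈ M.stressSpace, 0 =
        P.Re * (t⁻¹ * (M.mass Y'.1 v - M.mass Y.1 v) + M.conv Y.1 Y'.1 v) - M.pressure p' v
      + M.pressure q Y'.1 + (1 - P.ε) * M.visc Y'.1 v
      + P.ε / P.Wi * ∑ k, ddot (exp (Y'.2 k)) (M.gr k v) + ∑ k, ddot (Z k) (φ k) := by
      intro v q φ hφ
      rw [h v q φ hφ, (sumInt_integrand Y.1 Y'.1 v p' q hψ' hdec).2, hsum]
      ring
    have hs0 : (0 : Fin M.N → Mat d) ∈ M.stressSpace := fun k => Matrix.isSymm_zero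
    have hzero : ∑ k, ddot (Z k) ((0 : Fin M.N → Mat d) k) = 0 := by simp [ddot_zero_right]
    refine ⟨?_, hψ', ?_, ?_⟩
    · refine mem_solenoidal.2 fun q => ?_
      have := h' 0 q 0 hs0
      rw [hzero] at this
      have h0 : M.pressure q Y'.1 = 0 := by simpa [ddot_zero_right] using this.symm
      exact h0
    · intro v hv
      have := h' v 0 0 hs0
      have hp : M.pressure p' v = 0 := mem_solenoidal.1 hv p'
      rw [hzero, hp, map_zero, LinearMap.zero_apply] at this
      change P.Re * (t⁻¹ * (M.mass Y'.1 v - M.mass Y.1 v) + M.conv Y.1 Y'.1 v)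
        + (1 - P.ε) * M.visc Y'.1 v + P.ε / P.Wi * ∑ k, ddot (exp (Y'.2 k)) (M.gr k v) = 0
      linarith
    · have hZs : ∀ k, (Z k).IsSymm := by
        intro k
        have hd : ∀ l, (Y'.2 k - Y'.2 l).IsSymm := fun l => (hψ' k).sub (hψ' l)
        have hsumsymm : ∀ f : Fin M.N → Mat d, (∀ l, (f l).IsSymm) → (∑ l, f l).IsSymm := by
          intro f hf
          rw [Matrix.IsSymm, Matrix.transpose_sum]
          exact Finset.sum_congr rfl fun l _ => hf l
        refine (((((hψ' k).smul _).sub (hsumsymm _ fun l => (hY l).smul _)).smul _).add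
          (hsumsymm _ fun l => (hd l).smul _)).sub ?_ |>.sub (Matrix.IsSymm.smul ?_ _)
        · exact stretch_symm (hψ' k) _
        · exact Matrix.IsSymm.sub (exp_symm (hψ' k).neg) Matrix.isSymm_one
      have h1 := h' 0 0 Z hZs
      have h2 : ∑ k, ddot (Z k) (Z k) = 0 := by simpa [ddot_zero_right] using h1.symm
      intro k
      have h3 := (Finset.sum_eq_zero_iff_of_nonneg fun k _ => by
        rw [ddot_self]; positivity).1 h2 k (Finset.mem_univ k)
      rw [ddot_self] at h3
      change Z k = 0
      simpa using h3
  · rintro ⟨hdiv, hψ', hmom, hstr⟩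
    have hZ0 : ∀ k, Z k = 0 := hstr
    obtain ⟨Ω, B, N, hdec⟩ := exists_discrete_decomposition Y'.1 hψ'
    let f : M.Vel →ₗ[ℝ] ℝ := P.Re • (t⁻¹ • (M.mass Y'.1 - M.mass Y.1) + M.conv Y.1 Y'.1)
      + (1 - P.ε) • M.visc Y'.1 + (P.ε / P.Wi) • ∑ k, ddotₗ (exp (Y'.2 k)) ∘ₗ M.gr k
    have hf : ∀ v, f v = P.Re * (t⁻¹ * (M.mass Y'.1 v - M.mass Y.1 v) + M.conv Y.1 Y'.1 v)
        + (1 - P.ε) * M.visc Y'.1 v + P.ε / P.Wi * ∑ k, ddot (exp (Y'.2 k)) (M.gr k v) := by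
      intro v
      simp [f, ddotₗ_apply, LinearMap.sum_apply, mul_add]
    obtain ⟨p', hp'⟩ := exists_pressure f fun v hv => (hf v).trans (hmom v hv)
    refine ⟨hψ', p', Ω, B, N, hdec, fun v q φ hφ => ?_⟩
    have h1 := hsum φ
    simp only [hZ0, ddot_zero_left, Finset.sum_const_zero] at h1
    have hq : M.pressure q Y'.1 = 0 := mem_solenoidal.1 hdiv q
    have hpv : f v = M.pressure p' v := hp' v
    rw [(sumInt_integrand Y.1 Y'.1 v p' q hψ' hdec).2, hq]
    rw [hf] at hpv
    linarith

end Mesh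
end OldroydLog
end

noncomputable section
namespace OldroydLog

/-! ### Flows of bounded Lipschitz fields -/

section Flow
variable {F : Type*} [NormedAddCommGroup F] [NormedSpace ℝ F] {w : F → F} {K : NNReal}

/-- `f` is a global solution of the autonomous differential equation `f' = w (f)`. -/
def IsTrajectory (w : F → F) (f : ℝ → F) : Prop := ∀ t, HasDerivAt f (w (f t)) t

lemma IsTrajectory.eq (hw : LipschitzWith K w) {f g : ℝ → F} (hf : IsTrajectory w f)
    (hg : IsTrajectory w g) {t₀ : ℝ} (h : f t₀ = g t₀) : f = g :=
  ODE_solution_unique_univ (v := fun _ => w) (s := fun _ => univ)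
    (fun _ => hw.lipschitzOnWith) (fun t => ⟨hf t, mem_univ _⟩) (fun t => ⟨hg t, mem_univ _⟩) h

lemma IsTrajectory.comp_add {f : ℝ → F} (hf : IsTrajectory w f) (s : ℝ) :
    IsTrajectory w fun t => f (t + s) := fun t => (hf (t + s)).comp_add_const t s

lemma IsTrajectory.comp_neg {f : ℝ → F} (hf : IsTrajectory w f) :
    IsTrajectory (fun x => -w x) fun t => f (-t) := fun t => by
  have := (hf (-t)).scomp t (hasDerivAt_neg t)
  rw [neg_one_smul] at this
  exact this

lemma IsTrajectory.continuous {f : ℝ → F} (hf : IsTrajectory w f) : Continuous f :=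
  continuous_iff_continuousAt.2 fun t => (hf t).continuousAt

lemma IsTrajectory.dist_le (hw : LipschitzWith K w) {f g : ℝ → F} (hf : IsTrajectory w f)
    (hg : IsTrajectory w g) (t : ℝ) : dist (f t) (g t) ≤ dist (f 0) (g 0) * Real.exp (K * |t|) := by
  have key : ∀ {w : F → F} (_ : LipschitzWith K w) {f g : ℝ → F} (_ : IsTrajectory w f)
      (_ : IsTrajectory w g) {t : ℝ} (_ : 0 ≤ t),
      dist (f t) (g t) ≤ dist (f 0) (g 0) * Real.exp (K * t) := by
    intro w hw f g hf hg t ht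
    have := dist_le_of_trajectories_ODE (v := fun _ => w) (fun _ => hw) (a := 0) (b := t)
      hf.continuous.continuousOn (fun s _ => (hf s).hasDerivWithinAt)
      hg.continuous.continuousOn (fun s _ => (hg s).hasDerivWithinAt) le_rfl t ⟨ht, le_rfl⟩
    simpa using this
  rcases le_total 0 t with ht | ht
  · rw [abs_of_nonneg ht]
    exact key hw hf hg ht
  · rw [abs_of_nonpos ht]
    simpa using key (t := -t) hw.neg hf.comp_neg hg.comp_neg (by linarith)

/-- Existence of global trajectories of a bounded Lipschitz field. -/
lemma exists_trajectory [CompleteSpace F] (hw : LipschitzWith K w) {L : ℝ} (hL : ∀ x, ‖w x‖ ≤ L)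
    (x : F) : ∃ f, IsTrajectory w f ∧ f 0 = x := by
  have hloc : ∀ n : ℕ, ∃ α : ℝ → F, α 0 = x ∧
      ∀ t ∈ Icc (-(n : ℝ)) n, HasDerivWithinAt α (w (α t)) (Icc (-(n : ℝ)) n) t := by
    intro n
    have h0 : (0 : ℝ) ∈ Icc (-(n : ℝ)) n := by simp
    -- As the field is bounded by `L`, a ball of radius `L n` confines the solution during the whole
    -- of `[-n, n]`. Solutions on larger intervals extend the smaller ones by uniqueness.
    have hP : IsPicardLindelof (fun _ => w) (⟨0, h0⟩ : Icc (-(n : ℝ)) n) x (L.toNNReal * n) 0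
        L.toNNReal K :=
      { lipschitzOnWith := fun _ _ => hw.lipschitzOnWith
        continuousOn := fun _ _ => continuousOn_const
        norm_le := fun _ _ y _ => (hL y).trans (Real.le_coe_toNNReal L)
        mul_max_le := by simp }
    exact hP.exists_eq_forall_mem_Icc_hasDerivWithinAt₀
  choose α hα0 hα using hloc
  have hder : ∀ n : ℕ, ∀ t ∈ Ioo (-(n : ℝ)) n, HasDerivAt (α n) (w (α n t)) t := fun n t ht =>
    (hα n t (Ioo_subset_Icc_self ht)).hasDerivAt (Icc_mem_nhds ht.1 ht.2)
  have hmono : ∀ m n : ℕ, 0 < m → m ≤ n → ∀ t ∈ Ioo (-(m : ℝ)) m, α m t = α n t := by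
    intro m n hm hmn
    have hmn' : (m : ℝ) ≤ n := by exact_mod_cast hmn
    have hm' : (0 : ℝ) < m := by exact_mod_cast hm
    refine ODE_solution_unique_of_mem_Ioo (v := fun _ => w) (s := fun _ => univ) (t₀ := 0)
      (K := K) (fun _ _ => hw.lipschitzOnWith) ⟨by linarith, hm'⟩
      (fun t ht => ⟨hder m t ht, mem_univ _⟩)
      (fun t ht => ⟨hder n t ⟨by linarith [ht.1], by linarith [ht.2]⟩, mem_univ _⟩) ?_
    rw [hα0, hα0]
  -- The added unit makes `t` an interior point of the interval, so that the derivative there is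
  -- two-sided.
  let N : ℝ → ℕ := fun t => ⌈|t|⌉₊ + 1
  have hN : ∀ t, |t| < N t := fun t =>
    (Nat.le_ceil _).trans_lt (by simp only [N]; push_cast; linarith)
  have heq : ∀ (t : ℝ) (n : ℕ), 0 < n → |t| < n → α (N t) t = α n t := by
    intro t n hn htn
    rcases le_total (N t) n with h | h
    · exact hmono _ _ (Nat.succ_pos _) h t (abs_lt.1 (hN t))
    · exact (hmono _ _ hn h t (abs_lt.1 htn)).symm
  refine ⟨fun t => α (N t) t, fun t => ?_, hα0 _⟩
  have h1 := hder (N t) t (abs_lt.1 (hN t))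
  refine h1.congr_of_eventuallyEq ?_
  filter_upwards [(continuous_abs.isOpen_preimage _ (isOpen_Iio (a := (N t : ℝ)))).mem_nhds (hN t)]
    with s hs
  exact heq s _ (Nat.succ_pos _) hs

open scoped Classical in
/-- The flow of a field. -/
def flow (w : F → F) (t : ℝ) (x : F) : F :=
  if h : ∃ f, IsTrajectory w f ∧ f 0 = x then h.choose t else x

/-- The field has a globally defined Lipschitz flow. -/
structure Complete (w : F → F) (K : NNReal) : Prop where
  lipschitz : LipschitzWith K w
  exists_trajectory : ∀ x, ∃ f, IsTrajectory w f ∧ f 0 = x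

namespace Complete
variable (hw : Complete w K)
include hw

lemma isTrajectory (x : F) : IsTrajectory w fun t => flow w t x := by
  have h := hw.exists_trajectory x
  simp only [flow, dif_pos h]
  exact h.choose_spec.1

lemma flow_zero (x : F) : flow w 0 x = x := by
  have h := hw.exists_trajectory x
  simp only [flow, dif_pos h]
  exact h.choose_spec.2

lemma flow_eq {f : ℝ → F} (hf : IsTrajectory w f) (t : ℝ) : flow w t (f 0) = f t :=
  congrFun ((hw.isTrajectory (f 0)).eq hw.lipschitz hf (t₀ := 0) (hw.flow_zero _)) t

lemma flow_add (s t : ℝ) (x : F) : flow w (s + t) x = flow w s (flow w t x) := by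
  have := hw.flow_eq ((hw.isTrajectory x).comp_add t) s
  rw [zero_add] at this
  exact this.symm

lemma flow_lipschitz (t : ℝ) : LipschitzWith (Real.exp (K * |t|)).toNNReal (flow w t) := by
  refine LipschitzWith.of_dist_le_mul fun x y => ?_
  have := (hw.isTrajectory x).dist_le hw.lipschitz (hw.isTrajectory y) t
  rw [hw.flow_zero, hw.flow_zero] at this
  rw [Real.coe_toNNReal _ (Real.exp_pos _).le, mul_comm]
  exact this

lemma flow_of_eq_zero {x : F} (hx : w x = 0) (t : ℝ) : flow w t x = x :=
  hw.flow_eq (f := fun _ => x) (fun t => by simpa [hx] using hasDerivAt_const t x) t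

/-- By uniqueness a trajectory meeting a zero of the field is constant. Thus no trajectory leaves
the domain, off which velocities vanish. -/
lemma eq_of_flow_eq_zero {x : F} {t : ℝ} (hx : w (flow w t x) = 0) : flow w t x = x := by
  have h : IsTrajectory w fun _ => flow w t x := fun s => by
    simpa [hx] using hasDerivAt_const s (flow w t x)
  have := (hw.isTrajectory x).eq hw.lipschitz h (t₀ := t) rfl
  have h0 := congrFun this 0
  beta_reduce at h0
  rw [hw.flow_zero] at h0
  exact h0.symm

lemma norm_flow_sub_le {L : ℝ} (hL : ∀ x, ‖w x‖ ≤ L) (t : ℝ) (x : F) :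
    ‖flow w t x - x‖ ≤ L * |t| := by
  have := convex_univ.norm_image_sub_le_of_norm_hasDerivWithin_le (f := fun t => flow w t x)
    (fun s _ => (hw.isTrajectory x s).hasDerivWithinAt) (fun s _ => hL _) (mem_univ 0) (mem_univ t)
  simpa [hw.flow_zero] using this

end Complete

end Flow

/-! ### Liouville's theorem for weakly solenoidal fields -/

section Liouville
variable {d : ℕ} {w : E d → E d} {K : NNReal}

/-- The flow of a weakly solenoidal field preserves integrals. -/
lemma integral_comp_flow (hw : Complete w K) {L : ℝ} (hL : ∀ x, ‖w x‖ ≤ L)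
    (hc : HasCompactSupport w)
    (hdiv : ∀ (g : E d → ℝ) (D : NNReal), LipschitzWith D g → ∫ x, fderiv ℝ g x (w x) = 0)
    {g : E d → ℝ} {D : NNReal} (hg : LipschitzWith D g) (hgc : HasCompactSupport g) (t : ℝ) :
    ∫ x, g (flow w t x) = ∫ x, g x := by
  have hfix : ∀ x ∉ tsupport w, ∀ t, flow w t x = x := fun x hx t =>
    hw.flow_of_eq_zero (image_eq_zero_of_notMem_tsupport hx) t
  have hGl : ∀ t, LipschitzWith (D * (Real.exp (K * |t|)).toNNReal) fun x => g (flow w t x) :=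
    fun t => hg.comp (hw.flow_lipschitz t)
  have hGc : ∀ t, HasCompactSupport fun x => g (flow w t x) := fun t =>
    HasCompactSupport.intro (hc.isCompact.union hgc.isCompact) fun x hx => by
      rw [hfix x fun h => hx (Or.inl h)]
      exact image_eq_zero_of_notMem_tsupport fun h => hx (Or.inr h)
  have hint : ∀ t, Integrable fun x => g (flow w t x) := fun t =>
    (hGl t).continuous.integrable_of_hasCompactSupport (hGc t)
  let J : ℝ → ℝ := fun t => ∫ x, g (flow w t x)
  -- By the group property the derivative of `J` at `t` is the integral of the derivative along `w`
  -- of `G = g ∘ flow w t`. The latter is Lipschitz, so weak solenoidality makes it zero; smoothness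
  -- of the flow in space is not needed.
  have hJ : ∀ t, HasDerivAt J 0 t := by
    intro t
    set G : E d → ℝ := fun x => g (flow w t x) with hG
    set D' := D * (Real.exp (K * |t|)).toNNReal
    have hJt : ∀ h, J (t + h) = ∫ x, G (flow w h x) := fun h =>
      integral_congr_ae (ae_of_all _ fun x => by simp only [hG, hw.flow_add])
    rw [hasDerivAt_iff_tendsto_slope_zero]
    have hlim : Filter.Tendsto (fun h => ∫ x, h⁻¹ • (G (flow w h x) - G x))
        (nhdsWithin 0 {0}ᶜ) (nhds (∫ x, fderiv ℝ G x (w x))) := by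
      refine tendsto_integral_filter_of_dominated_convergence
        ((tsupport w).indicator fun _ => D' * L) ?_ ?_ ?_ ?_
      · refine Filter.Eventually.of_forall fun h => Continuous.aestronglyMeasurable ?_
        exact (continuous_const (y := h⁻¹)).smul (((hGl t).continuous.comp
          (hw.flow_lipschitz h).continuous).sub (hGl t).continuous)
      · filter_upwards [self_mem_nhdsWithin] with h hh
        refine ae_of_all _ fun x => ?_
        by_cases hx : x ∈ tsupport w
        · rw [indicator_of_mem hx, norm_smul, norm_inv, Real.norm_eq_abs h]
          have hpos : 0 < |h| := abs_pos.2 hh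
          rw [inv_mul_le_iff₀ hpos]
          have h1 := (hGl t).dist_le_mul (flow w h x) x
          rw [dist_eq_norm, dist_eq_norm] at h1
          refine h1.trans ?_
          calc (D' : ℝ) * ‖flow w h x - x‖ ≤ D' * (L * |h|) := by
                gcongr; exact hw.norm_flow_sub_le hL h x
            _ = |h| * (D' * L) := by ring
        · rw [indicator_of_notMem hx, hfix x hx]
          simp
      · exact (integrable_indicator_iff (isClosed_tsupport w).measurableSet).2
          (integrableOn_const hc.isCompact.measure_lt_top.ne)
      · filter_upwards [(hGl t).ae_differentiableAt] with x hx
        have h1 : HasFDerivAt G (fderiv ℝ G x) (flow w 0 x) := by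
          rw [hw.flow_zero]; exact hx.hasFDerivAt
        have h2 := h1.comp_hasDerivAt 0 (hw.isTrajectory x 0)
        rw [hasDerivAt_iff_tendsto_slope_zero] at h2
        simpa [hw.flow_zero] using h2
    rw [hdiv G D' (hGl t)] at hlim
    refine hlim.congr fun h => ?_
    rw [hJt, integral_smul]
    congr 1
    refine integral_sub ?_ (hint t)
    refine (hint (t + h)).congr (ae_of_all _ fun x => ?_)
    simp only [hG, hw.flow_add]
  have hconst := is_const_of_deriv_eq_zero (fun t => (hJ t).differentiableAt)
    (fun t => (hJ t).deriv) t 0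
  simpa [J, hw.flow_zero] using hconst

/-- The flow of a weakly solenoidal field does not increase the measure of preimages of open
bounded sets. -/
lemma volume_preimage_flow_le (hw : Complete w K) {L : ℝ} (hL : ∀ x, ‖w x‖ ≤ L)
    (hc : HasCompactSupport w)
    (hdiv : ∀ (g : E d → ℝ) (D : NNReal), LipschitzWith D g → ∫ x, fderiv ℝ g x (w x) = 0)
    {U : Set (E d)} (hU : IsOpen U) (hUb : Bornology.IsBounded U) (hne : Uᶜ.Nonempty) (t : ℝ) :
    volume (flow w t ⁻¹' U) < ⊤ ∧ volume.real (flow w t ⁻¹' U) ≤ volume.real U := by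
  have hcont : Continuous (flow w t) := (hw.flow_lipschitz t).continuous
  have hsub : flow w t ⁻¹' U ⊆ tsupport w ∪ closure U := by
    intro x hx
    by_cases h : x ∈ tsupport w
    · exact Or.inl h
    · right
      have := hw.flow_of_eq_zero (image_eq_zero_of_notMem_tsupport h) t
      rw [mem_preimage, this] at hx
      exact subset_closure hx
  have hfin : volume (flow w t ⁻¹' U) < ⊤ := (measure_mono hsub).trans_lt
    (hc.isCompact.union hUb.isCompact_closure).measure_lt_top
  refine ⟨hfin, ?_⟩
  have hUfin : volume U < ⊤ := hUb.measure_lt_top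
  -- Compactly supported Lipschitz functions converging to the indicator of `U` from below; the
  -- complement must be nonempty for the distance to be positive on `U`.
  let g : ℕ → E d → ℝ := fun n x => min (n * Metric.infDist x Uᶜ) 1
  have hg0 : ∀ n, ∀ x ∉ U, g n x = 0 := fun n x hx => by
    simp only [g]
    rw [Metric.infDist_zero_of_mem (show x ∈ Uᶜ from hx)]
    simp
  have hgn : ∀ n x, 0 ≤ g n x := fun n x => 
    le_min (mul_nonneg (Nat.cast_nonneg n) Metric.infDist_nonneg) zero_le_one
  have hgl : ∀ n : ℕ, LipschitzWith n (g n) := by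
    intro n
    have h1 : LipschitzWith (n * 1 : NNReal) fun x => (n : ℝ) * Metric.infDist x Uᶜ := by
      refine LipschitzWith.of_dist_le_mul fun x y => ?_
      rw [Real.dist_eq, ← mul_sub, abs_mul, abs_of_nonneg (Nat.cast_nonneg n)]
      have := (Metric.lipschitz_infDist_pt Uᶜ).dist_le_mul x y
      rw [Real.dist_eq] at this
      push_cast at this ⊢
      rw [mul_one]
      gcongr
      simpa using this
    rw [mul_one] at h1
    exact h1.min_const 1
  have hgc : ∀ n, HasCompactSupport (g n) := fun n =>
    HasCompactSupport.intro hUb.isCompact_closure fun x hx =>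
      hg0 n x fun h => hx (subset_closure h)
  have hlim : ∀ x, Filter.Tendsto (fun n => g n x) Filter.atTop
      (nhds (U.indicator (fun _ => (1 : ℝ)) x)) := by
    intro x
    by_cases hx : x ∈ U
    · rw [indicator_of_mem hx]
      have hpos : 0 < Metric.infDist x Uᶜ :=
        (hU.isClosed_compl.notMem_iff_infDist_pos hne).1 (by simpa using hx)
      refine tendsto_const_nhds.congr' ?_
      obtain ⟨m, hm⟩ := exists_nat_gt (1 / Metric.infDist x Uᶜ)
      filter_upwards [Filter.eventually_ge_atTop m] with n hn
      have hmn : (m : ℝ) ≤ n := by exact_mod_cast hn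
      refine (min_eq_right ?_).symm
      rw [div_lt_iff₀ hpos] at hm
      nlinarith
    · rw [indicator_of_notMem hx]
      simp [hg0 _ x hx]
  have hbound : ∀ n x, ‖g n x‖ ≤ U.indicator (fun _ => (1 : ℝ)) x := by
    intro n x
    by_cases hx : x ∈ U
    · rw [indicator_of_mem hx, Real.norm_of_nonneg (hgn n x)]
      exact min_le_right _ _
    · rw [indicator_of_notMem hx, hg0 n x hx, norm_zero]
  have hmeas := hcont.measurable hU.measurableSet
  have hI : Integrable ((flow w t ⁻¹' U).indicator fun _ => (1 : ℝ)) :=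
    (integrable_indicator_iff hmeas).2 (integrableOn_const hfin.ne)
  have hIU : Integrable (U.indicator fun _ => (1 : ℝ)) :=
    (integrable_indicator_iff hU.measurableSet).2 (integrableOn_const hUfin.ne)
  have htend : Filter.Tendsto (fun n => ∫ x, g n (flow w t x)) Filter.atTop
      (nhds (∫ x, (flow w t ⁻¹' U).indicator (fun _ => (1 : ℝ)) x)) :=
    tendsto_integral_of_dominated_convergence _
      (fun n => ((hgl n).continuous.comp hcont).aestronglyMeasurable) hI
      (fun n => ae_of_all _ fun x => hbound n _) (ae_of_all _ fun x => hlim _)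
  rw [integral_indicator_const _ hmeas, smul_eq_mul, mul_one] at htend
  refine le_of_tendsto' htend fun n => ?_
  rw [integral_comp_flow hw hL hc hdiv (hgl n) (hgc n) t]
  have := integral_mono (((hgl n).continuous).integrable_of_hasCompactSupport (hgc n)) hIU
    fun x => (le_abs_self _).trans (hbound n x)
  rwa [integral_indicator_const _ hU.measurableSet, smul_eq_mul, mul_one] at this

end Liouville
end OldroydLog
end

noncomputable section
namespace OldroydLog
open scoped Matrix.Norms.Frobenius

/-! ### The characteristic scheme -/

namespace Mesh
variable {d : ℕ} {M : Mesh d}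

lemma exists_complete (w : M.Vel) : ∃ K, Complete (M.fn w) K := by
  obtain ⟨K, hK⟩ := fn_lipschitz w
  obtain ⟨L, hL⟩ := hK.continuous.bounded_above_of_compact_support
    (M.hasCompactSupport_of_mem (fn_mem w))
  exact ⟨K, hK, exists_trajectory hK hL⟩

lemma continuous_flow (w : M.Vel) (t : ℝ) : Continuous (flow (M.fn w) t) := by
  obtain ⟨K, hK⟩ := exists_complete w
  exact (hK.flow_lipschitz t).continuous

lemma flow_mem_domain (w : M.Vel) (t : ℝ) {x : E d} (hx : x ∈ M.domain) :
    flow (M.fn w) t x ∈ M.domain := by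
  obtain ⟨K, hK⟩ := exists_complete w
  by_contra h
  have := hK.eq_of_flow_eq_zero ((fn_mem w).2.1 _ h)
  rw [this] at h
  exact h hx

lemma isBackwardFlow_flow (w : M.Vel) (t₀ t₁ : ℝ) :
    M.IsBackwardFlow (M.fn w) t₀ t₁ fun t x => flow (M.fn w) (t - t₁) x := by
  obtain ⟨K, hK⟩ := exists_complete w
  intro x hx
  refine ⟨by beta_reduce; rw [sub_self, hK.flow_zero], fun t _ => ⟨flow_mem_domain w _ hx, ?_⟩⟩
  have := (hK.isTrajectory x).comp_add (-t₁) t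
  simp only [← sub_eq_add_neg] at this
  exact this.hasDerivWithinAt

/-- The scheme asks only for some backward flow `X`; uniqueness for Lipschitz fields identifies it
on the domain. -/
lemma IsBackwardFlow.eq_flow {w : M.Vel} {t₀ t₁ : ℝ} (h01 : t₀ ≤ t₁) {X : ℝ → E d → E d}
    (hX : M.IsBackwardFlow (M.fn w) t₀ t₁ X) {x : E d} (hx : x ∈ M.domain) :
    X t₀ x = flow (M.fn w) (t₀ - t₁) x := by
  obtain ⟨K, hK⟩ := exists_complete w
  obtain ⟨h1, h2⟩ := hX x hx
  have htr := (hK.isTrajectory x).comp_add (-t₁)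
  simp only [← sub_eq_add_neg] at htr
  refine ODE_solution_unique_of_mem_Icc_left (v := fun _ => M.fn w) (s := fun _ => univ)
    (f := fun t => X t x) (g := fun t => flow (M.fn w) (t - t₁) x)
    (fun _ _ => hK.lipschitz.lipschitzOnWith) (fun t ht => (h2 t ht).2.continuousWithinAt)
    (fun t ht => ?_) (fun _ _ => mem_univ _) htr.continuous.continuousOn
    (fun t _ => (htr t).hasDerivWithinAt) (fun _ _ => mem_univ _) ?_ ⟨le_rfl, h01⟩
  · refine (h2 t (Ioc_subset_Icc_self ht)).2.mono_of_mem_nhdsWithin ?_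
    exact Filter.mem_of_superset (Icc_mem_nhdsLE ht.1) (Icc_subset_Icc_right ht.2)
  · simp only [h1, sub_self, hK.flow_zero]

variable (M) in
/-- The part of the element `k` which comes from the element `l` in the time `t`. -/
def transported (w : M.Vel) (t : ℝ) (k l : Fin M.N) : Set (E d) :=
  M.cellInt k ∩ flow (M.fn w) (-t) ⁻¹' M.cellInt l

lemma measurableSet_transported (w : M.Vel) (t : ℝ) (k l : Fin M.N) :
    MeasurableSet (M.transported w t k l) :=
  (isOpen_interior.inter (isOpen_interior.preimage (continuous_flow w (-t)))).measurableSet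

lemma nonempty_compl_cellInt [NeZero d] (k : Fin M.N) : (M.cellInt k)ᶜ.Nonempty := by
  by_contra h
  rw [not_nonempty_iff_eq_empty, compl_empty_iff] at h
  have : Bornology.IsBounded (univ : Set (E d)) := by
    rw [← h]; exact (M.isCompact_elem k).isBounded.subset interior_subset
  exact NormedSpace.unbounded_univ ℝ (E d) this

variable (M) in
/-- The characteristic method. -/
def characteristics [NeZero d] : Transport M.forms where
  old w t k l := volume.real (M.transported w t k l)
  flux _ _ _ _ := 0
  old_nonneg _ _ _ _ := measureReal_nonneg
  old_row w t k := by
    rw [← measureReal_iUnion_fintype (f := M.transported w t k)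
      (fun l l' h => ((M.disjoint_cellInt h).preimage _).mono inter_subset_right inter_subset_right)
      (measurableSet_transported w t k)
      (fun l => ((measure_mono inter_subset_left).trans_lt (M.volume_cellInt_lt_top k)).ne)]
    exact measureReal_mono (iUnion_subset fun l => inter_subset_left)
      (M.volume_cellInt_lt_top k).ne
  -- For fixed `l` the pieces are disjoint parts of the preimage of `K_l` under the flow, whose
  -- volume Liouville's theorem bounds by that of `K_l`.
  old_col w hw t _ l := by
    obtain ⟨K, hK⟩ := exists_complete w
    have hc := M.hasCompactSupport_of_mem (fn_mem w)
    obtain ⟨L, hL⟩ := hK.lipschitz.continuous.bounded_above_of_compact_support hc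
    obtain ⟨hfin, hle⟩ := volume_preimage_flow_le hK hL hc
      (fun g D hg => integral_fderiv_fn (divg_eq_zero hw) hg)
      (isOpen_interior : IsOpen (M.cellInt l))
      ((M.isCompact_elem l).isBounded.subset interior_subset) (nonempty_compl_cellInt l) (-t)
    rw [← measureReal_iUnion_fintype (f := fun k => M.transported w t k l)
      (fun k k' h => (M.disjoint_cellInt h).mono inter_subset_left inter_subset_left)
      (fun k => measurableSet_transported w t k l)
      (fun k => ((measure_mono inter_subset_right).trans_lt hfin).ne)]
    exact (measureReal_mono (iUnion_subset fun k => inter_subset_right) hfin.ne).trans hle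
  flux_nonneg _ _ _ _ := le_rfl
  flux_bound := ⟨0, fun w t k l => by simp⟩
  flux_balance _ _ _ _ := rfl

/-- This holds at every point of the open element, not just almost everywhere: where the foot of the
characteristic is in no open element, both sides vanish. -/
lemma p0_flow (ψ : Fin M.N → Mat d) (φ : Mat d) (w : M.Vel) (t : ℝ) {k : Fin M.N} {x : E d}
    (hx : x ∈ M.cellInt k) :
    ddot (M.p0 ψ (flow (M.fn w) (-t) x)) φ =
      ∑ l, (M.transported w t k l).indicator (fun _ => ddot (ψ l) φ) x := by
  rw [p0, cellwise, ddot_sum_left]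
  refine Finset.sum_congr rfl fun l _ => ?_
  by_cases h : flow (M.fn w) (-t) x ∈ M.cellInt l
  · rw [indicator_of_mem (show x ∈ M.transported w t k l from ⟨hx, h⟩)]
    exact congrArg (ddot · φ) (indicator_of_mem h _)
  · rw [indicator_of_notMem (show x ∉ M.transported w t k l from fun h' => h h'.2)]
    rw [show (interior (M.elem l)).indicator (fun _ => ψ l) (flow (M.fn w) (-t) x) = 0 from
      indicator_of_notMem h _, ddot_zero_left]

/-- The characteristic scheme, integrated over the elements. -/
lemma setIntegral_characteristics [NeZero d] {h : E d → ℝ} (hh : M.Nice h) (w : M.Vel) {t : ℝ}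
    {X : E d → E d} (hX : ∀ x ∈ M.domain, X x = flow (M.fn w) (-t) x)
    (ψ ψ' φ : Fin M.N → Mat d) :
    ∫ x in M.domain, (h x + ddot (t⁻¹ • (M.p0 ψ' x - M.p0 ψ (X x))) (M.p0 φ x)) =
      M.sumInt h + ∑ k, ddot (t⁻¹ • (M.vol k • ψ' k - ∑ l, M.characteristics.old w t k l • ψ l)
        + ∑ l, M.characteristics.flux w t l k • (ψ' k - ψ' l)) (φ k) := by
  have hcell : ∀ k, ∀ x ∈ M.cellInt k, h x + ddot (t⁻¹ • (M.p0 ψ' x - M.p0 ψ (X x))) (M.p0 φ x) =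
      h x + (t⁻¹ * ddot (ψ' k) (φ k) - t⁻¹ *
        ∑ l, (M.transported w t k l).indicator (fun _ => ddot (ψ l) (φ k)) x) := by
    intro k x hx
    rw [M.p0_apply ψ' hx, M.p0_apply φ hx, hX x (M.cellInt_subset_domain k hx), ddot_smul_left,
      ddot_sub_left, p0_flow ψ (φ k) w t hx, mul_sub]
  have hi : ∀ k l, IntegrableOn ((M.transported w t k l).indicator fun _ => ddot (ψ l) (φ k))
      (M.cellInt k) := fun k l =>
    (integrableOn_const (M.volume_cellInt_lt_top k).ne).indicator
      (measurableSet_transported w t k l)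
  have hi1 : ∀ k, IntegrableOn (fun x => t⁻¹ *
      ∑ l, (M.transported w t k l).indicator (fun _ => ddot (ψ l) (φ k)) x) (M.cellInt k) :=
    fun k => (integrable_finsetSum _ fun l _ => hi k l).const_mul _
  have hi0 : ∀ k, IntegrableOn (fun _ => t⁻¹ * ddot (ψ' k) (φ k)) (M.cellInt k) :=
    fun k => integrableOn_const (M.volume_cellInt_lt_top k).ne
  have hi2 : ∀ k, IntegrableOn (fun x => t⁻¹ * ddot (ψ' k) (φ k) - t⁻¹ *
      ∑ l, (M.transported w t k l).indicator (fun _ => ddot (ψ l) (φ k)) x) (M.cellInt k) :=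
    fun k => (hi0 k).sub (hi1 k)
  rw [M.setIntegral_domain _ fun k => ((hh.integrableOn k).add (hi2 k)).congr_fun
    (fun x hx => (hcell k x hx).symm) isOpen_interior.measurableSet, sumInt,
    ← Finset.sum_add_distrib]
  refine Finset.sum_congr rfl fun k _ => ?_
  rw [setIntegral_congr_fun isOpen_interior.measurableSet (hcell k),
    integral_add (hh.integrableOn k) (hi2 k), integral_sub (hi0 k) (hi1 k), setIntegral_const,
    integral_const_mul, integral_finsetSum _ fun l _ => hi k l]
  congr 1
  have h1 : ∀ l, ∫ x in M.cellInt k,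
      (M.transported w t k l).indicator (fun _ => ddot (ψ l) (φ k)) x =
      M.characteristics.old w t k l * ddot (ψ l) (φ k) := by
    intro l
    rw [setIntegral_indicator (measurableSet_transported w t k l),
      inter_eq_self_of_subset_right (show M.transported w t k l ⊆ M.cellInt k from inter_subset_left), setIntegral_const, smul_eq_mul]
    rfl
  have h2 : ∑ l, M.characteristics.flux w t l k • (ψ' k - ψ' l) = 0 :=
    Finset.sum_eq_zero fun l _ => zero_smul ℝ _
  simp only [h1, h2, add_zero, ddot_smul_left, ddot_sub_left, ddot_sum_left, smul_eq_mul]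
  change M.vol k * _ - _ = _
  ring

lemma characStep_iff [NeZero d] (P : Params) {t : ℝ} (ht : 0 < t) (n : ℕ)
    (Y Y' : M.Vel × (Fin M.N → Mat d)) :
    M.CharacStep P.Re P.Wi P.ε t n (M.fn Y.1, Y.2) (M.fn Y'.1, Y'.2) ↔
      M.WeakStep M.characteristics P t Y Y' := by
  have h01 : (n : ℝ) * t ≤ (n + 1) * t := by nlinarith
  have hsub : (n : ℝ) * t - (n + 1) * t = -t := by ring
  constructor
  · rintro ⟨hY', p', Ω, B, N, X, hdec, hX, h⟩
    refine ⟨hY'.2, p', Ω, B, N, hdec, fun v q φ hφ => ?_⟩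
    rw [h (M.fn v) (fn_mem v) q φ hφ]
    refine setIntegral_characteristics
      (sumInt_integrand Y.1 Y'.1 v p' q hY'.2 hdec).1 Y.1 (fun x hx => ?_) _ _ _
    rw [hX.eq_flow h01 hx, hsub]
  · rintro ⟨hψ', p', Ω, B, N, hdec, h⟩
    have hX := isBackwardFlow_flow Y.1 (n * t) ((n + 1) * t)
    refine ⟨⟨fn_mem _, hψ'⟩, p', Ω, B, N, _, hdec, hX, fun v hv q φ hφ => ?_⟩
    obtain ⟨v, rfl⟩ := exists_fn hv
    rw [h v q φ hφ]
    refine (setIntegral_characteristics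
      (sumInt_integrand Y.1 Y'.1 v p' q hψ' hdec).1 Y.1 (fun x hx => ?_) _ _ _).symm
    rw [hsub]

end Mesh
end OldroydLog
end

noncomputable section
namespace OldroydLog

lemma continuous_homothety {d : ℕ} (a : E d) :
    Continuous fun p : ℝ × E d => AffineMap.homothety a p.1 p.2 := by
  simp only [AffineMap.homothety_apply, vsub_eq_sub, vadd_eq_add]
  fun_prop

/-! ### The divergence theorem in a simplex, by conical coordinates -/

namespace Mesh
variable {d : ℕ} (M : Mesh d)

lemma sum_bary_smul (k : Fin M.N) (x : E d) :
    ∑ i, M.bary k i x • (M.cell k).points i = x :=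
  (M.basis k).linear_combination_coord_eq_self x

lemma affine_apply (k : Fin M.N) {W : Type*} [AddCommGroup W] [Module ℝ W] (f : E d →ᵃ[ℝ] W)
    (x : E d) : f x = ∑ i, M.bary k i x • f ((M.cell k).points i) := by
  conv_lhs => rw [f.decomp]
  simp only [Pi.add_apply]
  nth_rewrite 1 [← M.sum_bary_smul k x]
  rw [map_sum, ← one_smul ℝ (f 0), ← M.sum_bary k x, Finset.sum_smul, ← Finset.sum_add_distrib]
  refine Finset.sum_congr rfl fun i _ => ?_
  rw [map_smul, ← smul_add]
  congr 1
  have := congrFun f.decomp ((M.cell k).points i)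
  rw [Pi.add_apply] at this
  exact this.symm

lemma facet_eq (k : Fin M.N) (i : Fin (d + 1)) :
    M.facet k i = {x | x ∈ M.elem k ∧ M.bary k i x = 0} := by
  apply Subset.antisymm
  · intro x hx
    have hsub : (M.cell k).points '' {i}ᶜ ⊆ range (M.cell k).points := image_subset_range _ _
    refine ⟨convexHull_mono hsub hx, M.bary_eq_zero_of_mem_hull hsub ?_ hx⟩
    rintro ⟨j, hj, hij⟩
    exact hj ((M.cell k).independent.injective hij)
  · rintro x ⟨hx, h0⟩
    rw [mem_elem] at hx
    have hsum : ∑ j ∈ Finset.univ.erase i, M.bary k j x = 1 := by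
      rw [← M.sum_bary k x, ← Finset.add_sum_erase _ _ (Finset.mem_univ i), h0, zero_add]
    have hx' : ∑ j ∈ Finset.univ.erase i, M.bary k j x • (M.cell k).points j = x := by
      have := M.sum_bary_smul k x
      rwa [← Finset.add_sum_erase _ _ (Finset.mem_univ i), h0, zero_smul, zero_add] at this
    rw [← hx']
    exact (convex_convexHull ℝ _).sum_mem (fun j _ => hx j) hsum fun j hj =>
      subset_convexHull _ _ ⟨j, (Finset.mem_erase.1 hj).1, rfl⟩

lemma isCompact_facet (k : Fin M.N) (i : Fin (d + 1)) : IsCompact (M.facet k i) := by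
  rw [facet_eq]
  exact (M.isCompact_elem k).inter_right (isClosed_eq (M.continuous_bary k i) continuous_const)

lemma measurableSet_facet (k : Fin M.N) (i : Fin (d + 1)) : MeasurableSet (M.facet k i) :=
  (M.isCompact_facet k i).isClosed.measurableSet

lemma bary_homothety (k : Fin M.N) (i j : Fin (d + 1)) (τ : ℝ) (y : E d) :
    M.bary k j (AffineMap.homothety ((M.cell k).points i) τ y) =
      τ * M.bary k j y + (1 - τ) * if j = i then 1 else 0 := by
  rw [AffineMap.homothety_eq_lineMap, AffineMap.apply_lineMap, bary_points,
    AffineMap.lineMap_apply, vsub_eq_sub, vadd_eq_add, smul_eq_mul]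
  ring

/-- Slices of an element parallel to a facet. -/
lemma elem_inter_slice (k : Fin M.N) (i : Fin (d + 1)) {τ : ℝ} (hτ : 0 < τ) (hτ1 : τ ≤ 1)
    (A : Set (E d)) :
    {x | x ∈ A ∧ x ∈ M.elem k ∧ M.bary k i x = 1 - τ} =
      AffineMap.homothety ((M.cell k).points i) τ ''
        (M.facet k i ∩ AffineMap.homothety ((M.cell k).points i) τ ⁻¹' A) := by
  ext x
  constructor
  · rintro ⟨hA, hx, hi⟩
    set y := AffineMap.homothety ((M.cell k).points i) τ⁻¹ x
    have hxy : AffineMap.homothety ((M.cell k).points i) τ y = x := by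
      rw [← AffineMap.homothety_mul_apply, mul_inv_cancel₀ hτ.ne', AffineMap.homothety_one]
      rfl
    refine ⟨y, ⟨?_, by rw [mem_preimage, hxy]; exact hA⟩, hxy⟩
    have hb : ∀ j, M.bary k j y = τ⁻¹ * M.bary k j x + (1 - τ⁻¹) * if j = i then 1 else 0 :=
      fun j => M.bary_homothety k i j _ x
    have h0 : M.bary k i y = 0 := by
      rw [hb, hi, if_pos rfl]; field_simp; ring
    rw [facet_eq]
    refine ⟨M.mem_elem.2 fun j => ?_, h0⟩
    by_cases hj : j = i
    · rw [hj, h0]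
    · rw [hb, if_neg hj, mul_zero, add_zero]
      exact mul_nonneg (inv_nonneg.2 hτ.le) (M.mem_elem.1 hx j)
  · rintro ⟨y, ⟨hy, hyA⟩, rfl⟩
    rw [facet_eq] at hy
    refine ⟨hyA, M.mem_elem.2 fun j => ?_, ?_⟩
    · rw [bary_homothety]
      have := M.mem_elem.1 hy.1 j
      have : (0 : ℝ) ≤ if j = i then 1 else 0 := by split_ifs <;> norm_num
      have : 0 ≤ 1 - τ := by linarith
      positivity
    · rw [bary_homothety, hy.2, if_pos rfl]; ring

section Normal
variable [NeZero d]

/-- Both sides are affine in `x`, so it is enough to compare them at the vertices: zero at the apex,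
the height at the others. -/
lemma inner_sub_normal (k : Fin M.N) (i : Fin (d + 1)) (x : E d) :
    inner ℝ (x - (M.cell k).points i) (M.normal k i) =
      (M.cell k).height i * (1 - M.bary k i x) := by
  set h := (M.cell k).height i
  have hpos : 0 < h := (M.cell k).height_pos i
  set a := (M.cell k).points i
  set v := (M.cell k).altitudeFoot i - a
  have hpt : ∀ j, inner ℝ ((M.cell k).points j - a) v = h ^ 2 * (1 - if i = j then 1 else 0) := by
    intro j
    split_ifs with hij
    · subst hij
      simp [a]
    · have := (M.cell k).inner_vsub_vsub_altitudeFoot_eq_height_sq hij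
      rw [vsub_eq_sub, vsub_eq_sub] at this
      rw [← inner_neg_neg, neg_sub, neg_sub, this]
      ring
  have hx : x - a = ∑ j, M.bary k j x • ((M.cell k).points j - a) := by
    simp only [smul_sub, Finset.sum_sub_distrib, ← Finset.sum_smul, M.sum_bary_smul, M.sum_bary,
      one_smul]
  have hv : inner ℝ (x - a) v = h ^ 2 * (1 - M.bary k i x) := by
    rw [hx, sum_inner]
    simp only [real_inner_smul_left, hpt]
    have h1 : ∀ j, M.bary k j x * (h ^ 2 * (1 - if i = j then 1 else 0)) =
        h ^ 2 * M.bary k j x - h ^ 2 * (if i = j then M.bary k j x else 0) := by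
      intro j; split_ifs <;> ring
    simp only [h1, Finset.sum_sub_distrib, ← Finset.mul_sum, M.sum_bary, Finset.sum_ite_eq,
      Finset.mem_univ, if_true]
    ring
  change inner ℝ (x - a) (h⁻¹ • v) = _
  rw [real_inner_smul_right, hv]
  field_simp

lemma inner_normal (k : Fin M.N) (i : Fin (d + 1)) (w : E d) :
    inner ℝ w (M.normal k i) = -((M.cell k).height i * (M.bary k i).linear w) := by
  have := M.inner_sub_normal k i (w + (M.cell k).points i)
  rw [add_sub_cancel_right] at this
  rw [this, ← vadd_eq_add w, AffineMap.map_vadd, bary_points, if_pos rfl, vadd_eq_add]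
  ring

lemma norm_normal (k : Fin M.N) (i : Fin (d + 1)) : ‖M.normal k i‖ = 1 := by
  have hpos : 0 < (M.cell k).height i := (M.cell k).height_pos i
  rw [normal, norm_smul, norm_inv, Real.norm_of_nonneg hpos.le, vsub_eq_sub, ← dist_eq_norm,
    dist_comm]
  exact inv_mul_cancel₀ hpos.ne'

/-- Volume in an element, by slices parallel to a facet. -/
lemma volume_inter_elem (k : Fin M.N) (i : Fin (d + 1)) {A : Set (E d)} (hA : MeasurableSet A) :
    volume (A ∩ M.elem k) = ∫⁻ τ in Ioc (0 : ℝ) 1,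
      ENNReal.ofReal ((M.cell k).height i * τ ^ (d - 1)) *
        μHE[d - 1] (M.facet k i ∩ AffineMap.homothety ((M.cell k).points i) τ ⁻¹' A) := by
  set h := (M.cell k).height i
  have hpos : 0 < h := (M.cell k).height_pos i
  set a := (M.cell k).points i
  set n := M.normal k i
  have hn : ‖n‖ = 1 := M.norm_normal k i
  have hv : h • n ≠ 0 := smul_ne_zero hpos.ne' (norm_ne_zero_iff.1 (by rw [hn]; exact one_ne_zero))
  have hAK : MeasurableSet (A ∩ M.elem k) := hA.inter (M.isClosed_elem k).measurableSet
  -- Fubini along the altitude, with `τ` the fraction of the height below the apex. The slice at `τ`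
  -- is the facet contracted by `τ`, whence `τ ^ (d - 1)`; the height is the length of the altitude.
  have hslice := EuclideanGeometry.euclideanHausdorffMeasure_eq_lintegral a hv hAK
  rw [finrank_euclideanSpace_fin, EuclideanSpace.euclideanHausdorffMeasure_eq_volume] at hslice
  have henorm : ‖h • n‖ₑ = ENNReal.ofReal h := by
    rw [← ofReal_norm, norm_smul, hn, mul_one, Real.norm_of_nonneg hpos.le]
  have hset : ∀ τ : ℝ, A ∩ M.elem k ∩ (AffineSubspace.mk' (τ • (h • n) +ᵥ a) (Submodule.span ℝ {h • n})ᗮ :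
      Set (E d)) = {x | x ∈ A ∧ x ∈ M.elem k ∧ M.bary k i x = 1 - τ} := by
    intro τ
    ext x
    simp only [mem_inter_iff, SetLike.mem_coe, AffineSubspace.mem_mk', mem_ofPred_eq, and_assoc]
    refine and_congr_right fun _ => and_congr_right fun _ => ?_
    rw [Submodule.mem_orthogonal_singleton_iff_inner_left, vsub_eq_sub, vadd_eq_add,
      add_comm, ← sub_sub, inner_sub_left, real_inner_smul_right, M.inner_sub_normal k i x,
      real_inner_smul_left, real_inner_self_eq_norm_sq, norm_smul, hn,
      Real.norm_of_nonneg hpos.le]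
    change h * (h * (1 - M.bary k i x)) - τ * (h * 1) ^ 2 = 0 ↔ _
    constructor
    · intro e
      have : h ^ 2 * (1 - M.bary k i x - τ) = 0 := by linear_combination e
      rcases mul_eq_zero.1 this with e | e
      · exact absurd e (by positivity)
      · linarith
    · intro e
      rw [e]; ring
  simp only [hset] at hslice
  rw [hslice, henorm, ← lintegral_const_mul' _ _ ENNReal.ofReal_ne_top,
    ← lintegral_indicator measurableSet_Ioc]
  have h0 : ∀ᵐ τ : ℝ, τ ≠ 0 := by simp [ae_iff]
  refine lintegral_congr_ae ?_
  filter_upwards [h0] with τ hτ0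
  by_cases hτ : τ ∈ Ioc (0 : ℝ) 1
  · rw [indicator_of_mem hτ, M.elem_inter_slice k i hτ.1 hτ.2,
      euclideanHausdorffMeasure_homothety_image _ _ hτ0, ENNReal.ofReal_mul hpos.le, mul_assoc]
    congr 1
    rw [ENNReal.smul_def, smul_eq_mul]
    congr 1
    rw [← ENNReal.ofReal_coe_nnreal]
    congr 1
    push_cast
    rw [Real.norm_of_nonneg hτ.1.le]
  · rw [indicator_of_notMem hτ]
    have hempty : {x | x ∈ A ∧ x ∈ M.elem k ∧ M.bary k i x = 1 - τ} = ∅ := by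
      rw [eq_empty_iff_forall_notMem]
      rintro x ⟨-, hx, hi⟩
      have h1 := M.mem_elem.1 hx
      have h2 : M.bary k i x ≤ 1 := by
        rw [← M.sum_bary k x]
        exact Finset.single_le_sum (fun j _ => h1 j) (Finset.mem_univ i)
      have h3 := h1 i
      rw [mem_Ioc, not_and_or, not_lt, not_le] at hτ
      rcases hτ with hτ | hτ
      · have : τ < 0 := lt_of_le_of_ne hτ hτ0
        linarith
      · linarith
    rw [hempty, measure_empty, mul_zero]

/-- The volume of the simplex is finite, and by slicing it is a positive multiple of the measure of
the facet. -/
lemma facet_measure_lt_top (k : Fin M.N) (i : Fin (d + 1)) :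
    (μHE[d - 1] : Measure (E d)) (M.facet k i) < ⊤ := by
  have h := M.volume_inter_elem k i MeasurableSet.univ
  rw [univ_inter] at h
  simp only [preimage_univ, inter_univ] at h
  have hm : Measurable fun τ : ℝ => ENNReal.ofReal ((M.cell k).height i * τ ^ (d - 1)) := by
    fun_prop
  rw [lintegral_mul_const _ hm] at h
  have hfin : volume (M.elem k) < ⊤ := (M.isCompact_elem k).measure_lt_top
  rw [h] at hfin
  by_contra htop
  rw [not_lt, top_le_iff] at htop
  rw [htop, ENNReal.mul_top] at hfin
  · exact lt_irrefl _ hfin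
  intro h0
  rw [lintegral_eq_zero_iff hm] at h0
  have h1 : ∀ᵐ τ : ℝ, τ ∈ Ioc (0 : ℝ) 1 → False := by
    rw [← ae_restrict_iff' measurableSet_Ioc]
    filter_upwards [h0, ae_restrict_mem measurableSet_Ioc] with τ hτ hτ'
    have hp : 0 < (M.cell k).height i * τ ^ (d - 1) :=
      mul_pos ((M.cell k).height_pos i) (pow_pos hτ'.1 _)
    exact absurd (ENNReal.ofReal_eq_zero.1 hτ) (not_le.2 hp)
  have h2 : volume (Ioc (0 : ℝ) 1) = 0 := by
    rw [measure_eq_zero_iff_ae_notMem]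
    exact h1
  rw [Real.volume_Ioc] at h2
  norm_num at h2

/-- The density of volume in conical coordinates. -/
def coneMeasure (k : Fin M.N) (i : Fin (d + 1)) : Measure ℝ :=
  (volume.restrict (Ioc (0 : ℝ) 1)).withDensity fun τ =>
    ((((M.cell k).height i * τ ^ (d - 1)).toNNReal : NNReal) : ENNReal)

instance (k : Fin M.N) (i : Fin (d + 1)) :
    IsFiniteMeasure ((μHE[d - 1] : Measure (E d)).restrict (M.facet k i)) :=
  ⟨by rw [Measure.restrict_apply_univ]; exact M.facet_measure_lt_top k i⟩

lemma measurable_coneDensity (k : Fin M.N) (i : Fin (d + 1)) :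
    Measurable fun τ : ℝ => ((M.cell k).height i * τ ^ (d - 1)).toNNReal := by fun_prop

/-- Volume in an element is the image of the product measure in conical coordinates. -/
lemma map_cone (k : Fin M.N) (i : Fin (d + 1)) :
    Measure.map (fun p : ℝ × E d => AffineMap.homothety ((M.cell k).points i) p.1 p.2)
      ((M.coneMeasure k i).prod ((μHE[d - 1] : Measure (E d)).restrict (M.facet k i))) =
      volume.restrict (M.elem k) := by
  have hc := (continuous_homothety ((M.cell k).points i)).measurable
  ext A hA
  rw [Measure.map_apply hc hA, Measure.restrict_apply hA, M.volume_inter_elem k i hA,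
    Measure.prod_apply (hc hA), coneMeasure,
    lintegral_withDensity_eq_lintegral_mul _ (M.measurable_coneDensity k i).coe_nnreal_ennreal
      (measurable_measure_prodMk_left (hc hA))]
  refine lintegral_congr fun τ => ?_
  rw [Pi.mul_apply, Measure.restrict_apply (measurable_prodMk_left (hc hA)), inter_comm]
  rfl

instance (k : Fin M.N) (i : Fin (d + 1)) : SFinite (M.coneMeasure k i) := by
  unfold coneMeasure; infer_instance

/-- The divergence theorem in an element, for the field `x ↦ g x • (x - a)` where `a` is a
vertex. -/
lemma integral_cone (k : Fin M.N) (i : Fin (d + 1)) {g : E d → ℝ} {g' : E d → E d →L[ℝ] ℝ}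
    (hg : ∀ x, HasFDerivAt g (g' x) x) (hg' : Continuous g') :
    ∫ x in M.elem k, (d * g x + g' x (x - (M.cell k).points i)) =
      (M.cell k).height i * ∫ x in M.facet k i, g x ∂(μHE[d - 1]) := by
  set h := (M.cell k).height i
  have hpos : 0 < h := (M.cell k).height_pos i
  set a := (M.cell k).points i
  have hgc : Continuous g := continuous_iff_continuousAt.2 fun x => (hg x).continuousAt
  let f : E d → ℝ := fun x => d * g x + g' x (x - a)
  have hf : Continuous f := by fun_prop
  have hint : Integrable f (volume.restrict (M.elem k)) :=
    hf.continuousOn.integrableOn_compact (M.isCompact_elem k)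
  have hc := continuous_homothety a
  rw [← M.map_cone k i] at hint ⊢
  have hint2 : Integrable (fun p : ℝ × E d => f (AffineMap.homothety a p.1 p.2)) _ := (integrable_map_measure hf.aestronglyMeasurable hc.measurable.aemeasurable).1 hint
  change ∫ x, f x ∂_ = _
  rw [integral_map hc.measurable.aemeasurable hf.aestronglyMeasurable,
    integral_prod_symm _ hint2, ← integral_const_mul]
  refine integral_congr_ae (ae_of_all _ fun y => ?_)
  beta_reduce
  rw [coneMeasure, integral_withDensity_eq_integral_smul (M.measurable_coneDensity k i)]
  have hγ : ∀ τ : ℝ, HasDerivAt (fun τ : ℝ => AffineMap.homothety a τ y) (y - a) τ := by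
    intro τ
    simp only [AffineMap.homothety_apply, vsub_eq_sub, vadd_eq_add]
    simpa using ((hasDerivAt_id τ).smul_const (y - a)).add_const a
  -- Along the ray from the apex through `y`, the integrand with its conical density is the
  -- derivative of `h τ^d g`. Only the value at `τ = 1`, on the facet, remains after integration.
  have hder : ∀ τ : ℝ, HasDerivAt (fun τ : ℝ => h * (τ ^ d * g (AffineMap.homothety a τ y)))
      (h * (d * τ ^ (d - 1) * g (AffineMap.homothety a τ y) +
        τ ^ d * g' (AffineMap.homothety a τ y) (y - a))) τ := fun τ =>
    ((hasDerivAt_pow d τ).mul ((hg _).comp_hasDerivAt τ (hγ τ))).const_mul h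
  have hγc : Continuous fun τ : ℝ => AffineMap.homothety a τ y :=
    continuous_iff_continuousAt.2 fun τ => (hγ τ).continuousAt
  have hcont : Continuous fun τ : ℝ => h * (d * τ ^ (d - 1) * g (AffineMap.homothety a τ y) +
        τ ^ d * g' (AffineMap.homothety a τ y) (y - a)) := by fun_prop
  have hftc := intervalIntegral.integral_eq_sub_of_hasDerivAt (fun τ _ => hder τ)
    (hcont.intervalIntegrable 0 1)
  rw [intervalIntegral.integral_of_le zero_le_one] at hftc
  have h1 : AffineMap.homothety a (1 : ℝ) y = y := by rw [AffineMap.homothety_one]; rfl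
  rw [h1, one_pow, one_mul, zero_pow (NeZero.ne d), zero_mul, mul_zero, sub_zero] at hftc
  rw [← hftc]
  refine setIntegral_congr_fun measurableSet_Ioc fun τ hτ => ?_
  have hτ0 : 0 ≤ (M.cell k).height i * τ ^ (d - 1) := mul_nonneg hpos.le (pow_nonneg hτ.1.le _)
  have hpow : τ ^ d = τ ^ (d - 1) * τ := by
    rw [← pow_succ, Nat.sub_add_cancel (Nat.one_le_iff_ne_zero.2 (NeZero.ne d))]
  have hsub : AffineMap.homothety a τ y - a = τ • (y - a) := by
    simp [AffineMap.homothety_apply]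
  simp only [f, NNReal.smul_def, Real.coe_toNNReal _ hτ0, hsub, map_smul, smul_eq_mul]
  rw [hpow]
  simp only [h]
  ring

/-- The divergence theorem in an element. -/
lemma sum_facet_integral (k : Fin M.N) (q : Quad d) :
    ∑ i, ∫ x in M.facet k i, inner ℝ (q.eval x) (M.normal k i) ∂(μHE[d - 1]) =
      ∫ x in M.elem k, (toMat (q.deriv x)).trace := by
  -- The differentials `l i` of the barycentric coordinates satisfy `∑ l i = 0` and `∑ l i v • a i =
  -- v`, and the normal is `-h_i` times the gradient of the `i`-th coordinate. Each facet integral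
  -- is a cone formula with its own apex `a i`. In the sum all terms cancel except `∑ l i (Dq (a
  -- i))`, the trace of `Dq`.
  let l : Fin (d + 1) → E d →L[ℝ] ℝ := fun i => LinearMap.toContinuousLinearMap (M.bary k i).linear
  have hl0 : ∀ v, ∑ i, l i v = 0 := by
    intro v
    have h1 : ∀ i, l i v = M.bary k i v - M.bary k i 0 := fun i => by
      have := (M.bary k i).linearMap_vsub v 0
      rw [vsub_eq_sub, sub_zero, vsub_eq_sub] at this
      exact this
    simp only [h1, Finset.sum_sub_distrib, M.sum_bary, sub_self]
  have hlv : ∀ v, ∑ i, l i v • (M.cell k).points i = v := by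
    intro v
    have h1 : ∀ i, l i v = M.bary k i v - M.bary k i 0 := fun i => by
      have := (M.bary k i).linearMap_vsub v 0
      rw [vsub_eq_sub, sub_zero, vsub_eq_sub] at this
      exact this
    simp only [h1, sub_smul, Finset.sum_sub_distrib, M.sum_bary_smul, sub_zero]
  have hfacet : ∀ i, ∫ x in M.facet k i, inner ℝ (q.eval x) (M.normal k i) ∂(μHE[d - 1]) =
      ∫ x in M.elem k, -(d * l i (q.eval x) + l i (q.deriv x (x - (M.cell k).points i))) := by
    intro i
    have h1 := M.integral_cone k i (g := fun x => l i (q.eval x))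
      (g' := fun x => (l i) ∘L q.deriv x)
      (fun x => (l i).hasFDerivAt.comp x (q.hasFDerivAt x))
      (continuous_const.clm_comp q.continuous_deriv)
    have h2 : ∀ x, inner ℝ (q.eval x) (M.normal k i) = -(M.cell k).height i * l i (q.eval x) :=
      fun x => by rw [M.inner_normal, neg_mul]; rfl
    simp only [h2]
    rw [integral_const_mul, neg_mul, ← h1, integral_neg]
    rfl
  have hcd := q.continuous_deriv
  have hce := q.continuous_eval
  simp only [hfacet]
  rw [← integral_finsetSum]
  · refine integral_congr_ae (ae_of_all _ fun x => ?_)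
    beta_reduce
    have h3 : ∀ i, -(d * l i (q.eval x) + l i (q.deriv x (x - (M.cell k).points i))) =
        -(d * l i (q.eval x)) - l i (q.deriv x x) + l i (q.deriv x ((M.cell k).points i)) := by
      intro i; rw [map_sub, map_sub]; ring
    simp only [h3, Finset.sum_add_distrib, Finset.sum_sub_distrib, Finset.sum_neg_distrib,
      ← Finset.mul_sum, hl0, mul_zero, neg_zero, sub_zero, zero_add]
    rw [Matrix.trace]
    have h4 : ∀ j, (toMat (q.deriv x)).diag j =
        ∑ i, l i (EuclideanSpace.single j 1) * (q.deriv x ((M.cell k).points i)) j := by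
      intro j
      change (q.deriv x (EuclideanSpace.single j 1)) j = _
      nth_rewrite 1 [← hlv (EuclideanSpace.single j 1)]
      simp
    simp only [h4]
    rw [Finset.sum_comm]
    refine Finset.sum_congr rfl fun i _ => ?_
    nth_rewrite 1 [← sum_coord_smul_single (q.deriv x ((M.cell k).points i))]
    rw [map_sum]
    refine Finset.sum_congr rfl fun j _ => ?_
    rw [map_smul, smul_eq_mul, mul_comm]
  · intro i _
    refine ContinuousOn.integrableOn_compact (M.isCompact_elem k) (Continuous.continuousOn ?_)
    fun_prop

end Normal
end Mesh
end OldroydLog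
end

noncomputable section
namespace OldroydLog

/-! ### Facets shared by elements, and boundary facets -/

namespace Mesh
variable {d : ℕ} (M : Mesh d)

/-- The facet of `K_k` opposite to its `i`-th vertex is a facet of `K_l`. -/
def Shares (k : Fin M.N) (i : Fin (d + 1)) (l : Fin M.N) : Prop :=
  (M.cell k).points '' {i}ᶜ ⊆ range (M.cell l).points

variable {M}

/-- The `d` vertices of the facet leave exactly one of the `d + 1` vertices of `K_l`. -/
lemma Shares.exists_opposite {k l : Fin M.N} {i : Fin (d + 1)} (h : M.Shares k i l) :
    ∃ j, (M.cell l).points '' {j}ᶜ = (M.cell k).points '' {i}ᶜ := by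
  set S := (M.cell k).points '' {i}ᶜ
  set T := (M.cell l).points ⁻¹' S
  have himg : (M.cell l).points '' T = S := image_preimage_eq_of_subset h
  have hinj := (M.cell l).independent.injective
  have hS : S.ncard = d := by
    rw [ncard_image_of_injective _ (M.cell k).independent.injective, ncard_compl]
    simp
  have hT : Tᶜ.ncard = 1 := by
    rw [ncard_compl, ← ncard_image_of_injective T hinj, himg, hS]
    simp
  obtain ⟨j, hj⟩ := ncard_eq_one.1 hT
  refine ⟨j, ?_⟩
  rw [← hj, compl_compl, himg]

lemma shares_of_opposite {k l : Fin M.N} {i j : Fin (d + 1)}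
    (h : (M.cell l).points '' {j}ᶜ = (M.cell k).points '' {i}ᶜ) : M.Shares l j k := by
  rw [Shares, h]
  exact image_subset_range _ _

/-- Some vertex of `K_k` is not a vertex of `K_l`, and a shared facet must omit it. -/
lemma Shares.unique_vertex {k l : Fin M.N} (hkl : k ≠ l) {i i' : Fin (d + 1)}
    (h : M.Shares k i l) (h' : M.Shares k i' l) : i = i' := by
  obtain ⟨m, hm⟩ := M.exists_vertex_not_mem hkl
  have h1 : m = i := by
    by_contra hne
    exact hm (h ⟨m, hne, rfl⟩)
  have h2 : m = i' := by
    by_contra hne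
    exact hm (h' ⟨m, hne, rfl⟩)
  rw [← h1, h2]

variable (M)

lemma exists_mem_relative_interior [NeZero d] (k : Fin M.N) (i : Fin (d + 1)) :
    ∃ y, M.bary k i y = 0 ∧ ∀ m, m ≠ i → 0 < M.bary k m y := by
  obtain ⟨x, hx⟩ := M.nonempty_cellInt k
  rw [mem_cellInt] at hx
  obtain ⟨m, hm⟩ : ∃ m, m ≠ i := exists_ne i
  have hlt : M.bary k i x < 1 := by
    rw [← M.sum_bary k x]
    exact Finset.single_lt_sum hm (Finset.mem_univ _) (Finset.mem_univ _) (hx m)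
      fun j _ _ => (hx j).le
  have hpos : 0 < 1 - M.bary k i x := by linarith
  refine ⟨AffineMap.homothety ((M.cell k).points i) (1 - M.bary k i x)⁻¹ x, ?_, fun m hm => ?_⟩
  · rw [bary_homothety, if_pos rfl]
    field_simp
    ring
  · rw [bary_homothety, if_neg hm, mul_zero, add_zero]
    exact mul_pos (inv_pos.2 hpos) (hx m)

variable {M}

lemma bary_lineMap (k : Fin M.N) (m : Fin (d + 1)) (y p : E d) (δ : ℝ) :
    M.bary k m (AffineMap.lineMap y p δ) = (1 - δ) * M.bary k m y + δ * M.bary k m p := by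
  rw [AffineMap.apply_lineMap, AffineMap.lineMap_apply, vsub_eq_sub, vadd_eq_add, smul_eq_mul]
  ring

lemma eventually_mem_cellInt {k : Fin M.N} {i : Fin (d + 1)} {y p : E d}
    (h0 : M.bary k i y = 0) (hy : ∀ m, m ≠ i → 0 < M.bary k m y) (hp : 0 < M.bary k i p) :
    ∀ᶠ δ in nhdsWithin (0 : ℝ) (Ioi 0), AffineMap.lineMap y p δ ∈ M.cellInt k := by
  simp only [mem_cellInt, Filter.eventually_all]
  intro m
  by_cases hm : m = i
  · filter_upwards [self_mem_nhdsWithin] with δ hδ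
    rw [bary_lineMap, hm, h0, mul_zero, zero_add]
    exact mul_pos hδ hp
  · have hc : Continuous fun δ : ℝ => M.bary k m (AffineMap.lineMap y p δ) :=
      (M.continuous_bary k m).comp AffineMap.lineMap_continuous
    refine nhdsWithin_le_nhds ?_
    refine hc.continuousAt.eventually (lt_mem_nhds ?_)
    beta_reduce
    rw [AffineMap.lineMap_apply_zero]
    exact hy m hm

/-- Two elements with a common facet lie on different sides of it. -/
lemma not_same_side [NeZero d] {l l' : Fin M.N} (hl : l ≠ l') {j j' : Fin (d + 1)}
    (hF : (M.cell l).points '' {j}ᶜ = (M.cell l').points '' {j'}ᶜ) (p : E d) :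
    ¬(0 < M.bary l j p ∧ 0 < M.bary l' j' p) := by
  rintro ⟨hp, hp'⟩
  -- From a point in the relative interior of the common facet, a small move towards `p` would enter
  -- both open elements, which are disjoint.
  obtain ⟨y, hy0, hy⟩ := M.exists_mem_relative_interior l j
  have hmem : ∀ m, m ≠ j → ∃ m', m' ≠ j' ∧ (M.cell l').points m' = (M.cell l).points m := by
    intro m hm
    have : (M.cell l).points m ∈ (M.cell l').points '' {j'}ᶜ := hF ▸ ⟨m, hm, rfl⟩
    exact this
  have hexp : ∀ m', M.bary l' m' y =
      ∑ m, M.bary l m y * M.bary l' m' ((M.cell l).points m) := fun m' =>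
    M.affine_apply l (M.bary l' m') y
  have hterm : ∀ m' m, 0 ≤ M.bary l m y * M.bary l' m' ((M.cell l).points m) := by
    intro m' m
    by_cases hm : m = j
    · rw [hm, hy0, zero_mul]
    · obtain ⟨m'', -, h⟩ := hmem m hm
      rw [← h, bary_points]
      have := hy m hm
      split_ifs <;> simp [this.le]
  have hy0' : M.bary l' j' y = 0 := by
    rw [hexp]
    refine Finset.sum_eq_zero fun m _ => ?_
    by_cases hm : m = j
    · rw [hm, hy0, zero_mul]
    · obtain ⟨m'', hm'', h⟩ := hmem m hm
      rw [← h, bary_points, if_neg hm''.symm, mul_zero]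
  have hy' : ∀ m', m' ≠ j' → 0 < M.bary l' m' y := by
    intro m' hm'
    have : (M.cell l').points m' ∈ (M.cell l).points '' {j}ᶜ := hF ▸ ⟨m', hm', rfl⟩
    obtain ⟨m, hm, hmm⟩ := this
    rw [hexp]
    refine Finset.sum_pos' (fun m _ => hterm m' m) ⟨m, Finset.mem_univ _, ?_⟩
    rw [hmm, bary_points, if_pos rfl, mul_one]
    exact hy m hm
  obtain ⟨δ, h1, h2⟩ := ((eventually_mem_cellInt hy0 hy hp).and
    (eventually_mem_cellInt hy0' hy' hp')).exists
  exact Set.disjoint_left.1 (M.disjoint_cellInt hl) h1 h2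

/-- Both coordinates vanish on the common facet, hence are proportional, and the factor is the value
of one at the apex of the other. It is not positive, as the elements lie on opposite sides, and not
zero, since the coordinate is not identically zero. -/
lemma exists_bary_eq_mul [NeZero d] {k l : Fin M.N} (hkl : k ≠ l) {i j : Fin (d + 1)}
    (hF : (M.cell l).points '' {j}ᶜ = (M.cell k).points '' {i}ᶜ) :
    ∃ c < 0, ∀ x, M.bary l j x = c * M.bary k i x := by
  have hc : ∀ x, M.bary l j x = M.bary l j ((M.cell k).points i) * M.bary k i x := by
    intro x
    rw [M.affine_apply k (M.bary l j) x, Finset.sum_eq_single i]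
    · rw [smul_eq_mul, mul_comm]
    · intro m _ hm
      have : (M.cell k).points m ∈ (M.cell l).points '' {j}ᶜ := hF ▸ ⟨m, hm, rfl⟩
      obtain ⟨m', hm', h⟩ := this
      rw [← h, bary_points, if_neg (Ne.symm hm'), smul_zero]
    · simp
  refine ⟨_, lt_of_le_of_ne ?_ ?_, hc⟩
  · by_contra h
    rw [not_le] at h
    refine not_same_side hkl hF.symm ((M.cell k).points i) ⟨?_, h⟩
    rw [bary_points, if_pos rfl]
    exact one_pos
  · intro h
    have := hc ((M.cell l).points j)
    rw [h, zero_mul, bary_points, if_pos rfl] at this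
    exact one_ne_zero this

lemma normal_opposite [NeZero d] {k l : Fin M.N} (hkl : k ≠ l) {i j : Fin (d + 1)}
    (hF : (M.cell l).points '' {j}ᶜ = (M.cell k).points '' {i}ᶜ) :
    M.normal l j = -M.normal k i := by
  obtain ⟨c, hc, h⟩ := exists_bary_eq_mul hkl hF
  have hlin : ∀ v, (M.bary l j).linear v = c * (M.bary k i).linear v := by
    intro v
    have h1 := (M.bary l j).linearMap_vsub v 0
    have h2 := (M.bary k i).linearMap_vsub v 0
    simp only [vsub_eq_sub, sub_zero] at h1 h2
    rw [h1, h2, h, h]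
    ring
  have hk : 0 < (M.cell k).height i := (M.cell k).height_pos i
  have hl : 0 < (M.cell l).height j := (M.cell l).height_pos j
  set γ := (M.cell l).height j * c / (M.cell k).height i
  have hγ : γ < 0 := div_neg_of_neg_of_pos (mul_neg_of_pos_of_neg hl hc) hk
  have hn : M.normal l j = γ • M.normal k i := by
    refine ext_inner_left ℝ fun w => ?_
    rw [real_inner_smul_right, inner_normal, inner_normal, hlin]
    simp only [γ]
    field_simp
  have h1 : |γ| = 1 := by
    have := congrArg norm hn
    rwa [norm_smul, norm_normal, norm_normal, mul_one, Real.norm_eq_abs, eq_comm] at this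
  rw [abs_of_neg hγ] at h1
  rw [hn, show γ = -1 by linarith, neg_one_smul]

/-- A facet is shared by at most two elements. -/
lemma Shares.unique [NeZero d] {k l l' : Fin M.N} {i : Fin (d + 1)} (hl : l ≠ k) (hl' : l' ≠ k)
    (h : M.Shares k i l) (h' : M.Shares k i l') : l = l' := by
  by_contra hne
  obtain ⟨j, hj⟩ := h.exists_opposite
  obtain ⟨j', hj'⟩ := h'.exists_opposite
  obtain ⟨c, hc, hcx⟩ := exists_bary_eq_mul hl.symm hj
  obtain ⟨c', hc', hcx'⟩ := exists_bary_eq_mul hl'.symm hj'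
  obtain ⟨y, hy0, -⟩ := M.exists_mem_relative_interior k i
  -- Dilation by `2` from the apex passes beyond the facet. There the coordinates of `l` and `l'`
  -- would both be positive, putting these elements on the same side.
  have hp : M.bary k i (AffineMap.homothety ((M.cell k).points i) (2 : ℝ) y) = -1 := by
    rw [bary_homothety, hy0, if_pos rfl]; ring
  refine not_same_side hne (hj.trans hj'.symm)
    (AffineMap.homothety ((M.cell k).points i) (2 : ℝ) y) ⟨?_, ?_⟩
  · rw [hcx, hp]; linarith
  · rw [hcx', hp]; linarith

/-- Otherwise points just beyond the facet would lie in other elements, and one of these, being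
closed, would contain `y`. By conformity `y` is in the hull of the common vertices. As all
coordinates of `y` other than the `i`-th are positive, the whole facet would be shared. -/
lemma notMem_domain_of_not_shares {k : Fin M.N} {i : Fin (d + 1)}
    (h : ∀ l, l ≠ k → ¬M.Shares k i l) {y : E d} (hy0 : M.bary k i y = 0)
    (hy : ∀ m, m ≠ i → 0 < M.bary k m y) : y ∉ M.domain := by
  intro hyD
  set a := (M.cell k).points i
  let γ : ℝ → E d := fun δ => AffineMap.homothety a (1 + δ) y
  have hγ : Continuous γ := (continuous_homothety a).comp
    (by fun_prop : Continuous fun δ : ℝ => ((1 + δ, y) : ℝ × E d))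
  have hγ0 : γ 0 = y := by
    simp only [γ, add_zero, AffineMap.homothety_one]
    rfl
  have h1 : ∀ᶠ δ in nhdsWithin (0 : ℝ) (Ioi 0), ∃ l, l ≠ k ∧ γ δ ∈ M.elem l := by
    have hD : ∀ᶠ δ in nhdsWithin (0 : ℝ) (Ioi 0), γ δ ∈ M.domain :=
      nhdsWithin_le_nhds (hγ.continuousAt.eventually (M.isOpen_domain.mem_nhds (by rwa [hγ0])))
    filter_upwards [hD, self_mem_nhdsWithin] with δ hδ hδ0
    obtain ⟨l, hl⟩ := mem_iUnion.1 (M.domain_subset hδ)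
    refine ⟨l, ?_, hl⟩
    rintro rfl
    have h2 := M.mem_elem.1 hl i
    simp only [γ] at h2
    rw [bary_homothety, hy0, if_pos rfl] at h2
    have : (0 : ℝ) < δ := hδ0
    linarith
  have h2 := h1.frequently
  rw [Filter.frequently_exists] at h2
  obtain ⟨l, hl⟩ := h2
  have hlk : l ≠ k := hl.exists.choose_spec.1
  have hmem : y ∈ M.elem l := by
    rw [← hγ0]
    exact ((M.isClosed_elem l).preimage hγ).closure_subset (mem_closure_iff_frequently.2
      ((hl.mono fun δ hδ => hδ.2).filter_mono nhdsWithin_le_nhds))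
  have hyk : y ∈ M.elem k := M.mem_elem.2 fun m => by
    by_cases hm : m = i
    · rw [hm, hy0]
    · exact (hy m hm).le
  have hyh : y ∈ convexHull ℝ (range (M.cell k).points ∩ range (M.cell l).points) := by
    rw [← M.conformal]; exact ⟨hyk, hmem⟩
  refine h l hlk ?_
  rintro _ ⟨m, hm, rfl⟩
  by_contra hn
  have := M.bary_eq_zero_of_mem_hull (i := m) inter_subset_left (fun h => hn h.2) hyh
  exact (hy m hm).ne' this

/-- Velocities vanish on boundary facets. -/
lemma eq_zero_of_mem_boundary_facet [NeZero d] {k : Fin M.N} {i : Fin (d + 1)}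
    (h : ∀ l, l ≠ k → ¬M.Shares k i l) (w : M.Vel) {x : E d} (hx : x ∈ M.facet k i) :
    M.fn w x = 0 := by
  obtain ⟨y, hy0, hy⟩ := M.exists_mem_relative_interior k i
  rw [facet_eq] at hx
  have hc : Continuous fun δ : ℝ => M.fn w (AffineMap.lineMap x y δ) :=
    (fn_mem w).1.comp AffineMap.lineMap_continuous
  have h1 : Filter.Tendsto (fun δ : ℝ => M.fn w (AffineMap.lineMap x y δ))
      (nhdsWithin 0 (Ioi 0)) (nhds (M.fn w x)) := by
    have := hc.tendsto 0
    rw [AffineMap.lineMap_apply_zero] at this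
    exact this.mono_left nhdsWithin_le_nhds
  refine tendsto_nhds_unique h1 (tendsto_const_nhds.congr' ?_)
  filter_upwards [Ioc_mem_nhdsGT (zero_lt_one' ℝ)] with δ hδ
  refine ((fn_mem w).2.1 _ (notMem_domain_of_not_shares h ?_ fun m hm => ?_)).symm
  · rw [bary_lineMap, hx.2, hy0]; ring
  · rw [bary_lineMap]
    have h2 := M.mem_elem.1 hx.1 m
    have h3 := hy m hm
    have h4 : 0 ≤ 1 - δ := by linarith [hδ.2]
    have h5 : 0 < δ := hδ.1
    positivity

end Mesh
end OldroydLog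
end

noncomputable section
namespace OldroydLog
open scoped Matrix.Norms.Frobenius

/-! ### The discontinuous Galerkin scheme -/

namespace Mesh
variable {d : ℕ} {M : Mesh d}

variable (M) in
/-- Velocities as bounded continuous functions. -/
def toBounded : M.Vel →ₗ[ℝ] BoundedContinuousFunction (E d) (E d) where
  toFun w := BoundedContinuousFunction.ofNormedAddCommGroup (M.fn w) (fn_mem w).1
    ((fn_mem w).1.bounded_above_of_compact_support
      (M.hasCompactSupport_of_mem (fn_mem w))).choose
    ((fn_mem w).1.bounded_above_of_compact_support
      (M.hasCompactSupport_of_mem (fn_mem w))).choose_spec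
  map_add' u v := by ext1 x; exact fn_add u v x
  map_smul' c u := by ext1 x; exact fn_smul c u x

variable (M) in
lemma exists_norm_fn_le : ∃ C, 0 ≤ C ∧ ∀ (w : M.Vel) (x : E d), ‖M.fn w x‖ ≤ C * ‖w‖ := by
  obtain ⟨C, h0, hC⟩ := exists_bound_linear M.toBounded
  exact ⟨C, h0, fun w x => ((M.toBounded w).norm_coe_le_norm x).trans (hC w)⟩

variable [NeZero d]

variable (M) in
/-- The outflow through a facet. -/
def outflow (w : M.Vel) (k : Fin M.N) (i : Fin (d + 1)) : ℝ :=
  ∫ x in M.facet k i, max (inner ℝ (M.fn w x) (M.normal k i)) 0 ∂(μHE[d - 1])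

variable (M) in
/-- The inflow through a facet. -/
def inflow (w : M.Vel) (k : Fin M.N) (i : Fin (d + 1)) : ℝ :=
  ∫ x in M.facet k i, max (-inner ℝ (M.fn w x) (M.normal k i)) 0 ∂(μHE[d - 1])

variable (M) in
/-- The net outflow through a facet. -/
def netflow (w : M.Vel) (k : Fin M.N) (i : Fin (d + 1)) : ℝ :=
  ∫ x in M.facet k i, inner ℝ (M.fn w x) (M.normal k i) ∂(μHE[d - 1])

lemma integrableOn_facet (k : Fin M.N) (i : Fin (d + 1)) {f : E d → ℝ} (hf : Continuous f) :
    IntegrableOn f (M.facet k i) μHE[d - 1] :=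
  hf.continuousOn.integrableOn_of_subset_isCompact (M.isCompact_facet k i)
    (M.measurableSet_facet k i) Subset.rfl (M.facet_measure_lt_top k i).ne

lemma continuous_inner_normal (w : M.Vel) (k : Fin M.N) (i : Fin (d + 1)) :
    Continuous fun x => (inner ℝ (M.fn w x) (M.normal k i) : ℝ) :=
  (fn_mem w).1.inner continuous_const

lemma outflow_sub_inflow (w : M.Vel) (k : Fin M.N) (i : Fin (d + 1)) :
    M.outflow w k i - M.inflow w k i = M.netflow w k i := by
  have hc := continuous_inner_normal w k i
  rw [outflow, inflow, netflow, ← integral_sub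
    (integrableOn_facet k i (hc.max continuous_const))
    (integrableOn_facet k i (Continuous.max (f := fun x => -inner ℝ (M.fn w x) (M.normal k i))
      hc.neg continuous_const))]
  refine integral_congr_ae (ae_of_all _ fun x => ?_)
  exact max_zero_sub_max_neg_zero_eq_self _

lemma outflow_nonneg (w : M.Vel) (k : Fin M.N) (i : Fin (d + 1)) : 0 ≤ M.outflow w k i :=
  integral_nonneg fun _ => le_max_right _ _

lemma inflow_nonneg (w : M.Vel) (k : Fin M.N) (i : Fin (d + 1)) : 0 ≤ M.inflow w k i :=
  integral_nonneg fun _ => le_max_right _ _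

lemma exists_flow_bound : ∃ C, 0 ≤ C ∧ ∀ (w : M.Vel) (k : Fin M.N) (i : Fin (d + 1)),
    M.outflow w k i ≤ C * ‖w‖ ∧ M.inflow w k i ≤ C * ‖w‖ := by
  obtain ⟨C, h0, hC⟩ := M.exists_norm_fn_le
  let m : Fin M.N → Fin (d + 1) → ℝ := fun k i =>
    (μHE[d - 1] : Measure (E d)).real (M.facet k i)
  have hm : ∀ k i, 0 ≤ m k i := fun k i => measureReal_nonneg
  let S : ℝ := ∑ k, ∑ i, m k i
  have hS : ∀ k i, m k i ≤ S := fun k i =>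
    (Finset.single_le_sum (fun i _ => hm k i) (Finset.mem_univ i)).trans
      (Finset.single_le_sum (f := fun k => ∑ i, m k i)
        (fun k _ => Finset.sum_nonneg fun i _ => hm k i) (Finset.mem_univ k))
  have habs : ∀ (w : M.Vel) k i x, |inner ℝ (M.fn w x) (M.normal k i)| ≤ C * ‖w‖ := by
    intro w k i x
    refine (abs_real_inner_le_norm _ _).trans ?_
    rw [norm_normal, mul_one]
    exact hC w x
  have hS0 : 0 ≤ S := Finset.sum_nonneg fun k _ => Finset.sum_nonneg fun i _ => hm k i
  have key : ∀ (w : M.Vel) k i (f : E d → ℝ), Continuous f → (∀ x, f x ≤ C * ‖w‖) →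
      ∫ x in M.facet k i, f x ∂(μHE[d - 1]) ≤ C * S * ‖w‖ := by
    intro w k i f hf hb
    calc ∫ x in M.facet k i, f x ∂(μHE[d - 1])
        ≤ ∫ _ in M.facet k i, C * ‖w‖ ∂(μHE[d - 1]) :=
          integral_mono (integrableOn_facet k i hf) (integrableOn_facet k i continuous_const) hb
      _ = m k i * (C * ‖w‖) := by rw [setIntegral_const, smul_eq_mul]
      _ ≤ S * (C * ‖w‖) := by have := hS k i; gcongr
      _ = C * S * ‖w‖ := by ring
  have hw0 : ∀ w : M.Vel, 0 ≤ C * ‖w‖ := fun w => by positivity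
  refine ⟨C * S, by positivity, fun w k i => ⟨?_, ?_⟩⟩
  · exact key w k i _ ((continuous_inner_normal w k i).max continuous_const) fun x =>
      max_le ((le_abs_self _).trans (habs w k i x)) (hw0 w)
  · exact key w k i _ ((continuous_inner_normal w k i).neg.max continuous_const) fun x =>
      max_le ((neg_le_abs _).trans (habs w k i x)) (hw0 w)

lemma sum_netflow {w : M.Vel} (hw : w ∈ M.solenoidal) (k : Fin M.N) :
    ∑ i, M.netflow w k i = 0 := by
  obtain ⟨q, hq⟩ := M.exists_quad_of_mem (fn_mem w)
  have h1 : ∀ i, M.netflow w k i =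
      ∫ x in M.facet k i, inner ℝ ((q k).eval x) (M.normal k i) ∂(μHE[d - 1]) := by
    intro i
    refine setIntegral_congr_fun (M.measurableSet_facet k i) fun x hx => ?_
    rw [facet_eq] at hx
    beta_reduce
    rw [hq k x hx.1]
  simp only [h1]
  rw [M.sum_facet_integral, setIntegral_congr_set (M.elem_ae_eq k)]
  refine setIntegral_eq_zero_of_forall_eq_zero fun x hx => ?_
  have := divg_eq_zero hw k x hx
  rwa [divg, grad_eq, (M.hasFDerivAt_of_mem hq hx).fderiv] at this

open scoped Classical in
variable (M) in
/-- The net flow between two elements. -/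
def exchange (w : M.Vel) (k l : Fin M.N) : ℝ :=
  ∑ i, if M.Shares k i l then M.netflow w k i else 0

lemma netflow_opposite (w : M.Vel) {k l : Fin M.N} (hkl : k ≠ l) {i j : Fin (d + 1)}
    (hF : (M.cell l).points '' {j}ᶜ = (M.cell k).points '' {i}ᶜ) :
    M.netflow w l j = -M.netflow w k i := by
  rw [netflow, netflow, facet, facet, hF, normal_opposite hkl hF, ← integral_neg]
  simp only [inner_neg_right]

lemma exchange_antisymm (w : M.Vel) {k l : Fin M.N} (hkl : k ≠ l) :
    M.exchange w k l = -M.exchange w l k := by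
  classical
  have hsingle : ∀ {k l : Fin M.N} (_ : k ≠ l) {i : Fin (d + 1)} (_ : M.Shares k i l),
      M.exchange w k l = M.netflow w k i := by
    intro k l hkl i h
    rw [exchange, Finset.sum_eq_single i]
    · rw [if_pos h]
    · intro i' _ hne
      exact if_neg fun h' => hne (h'.unique_vertex hkl h)
    · simp
  by_cases h : ∃ i, M.Shares k i l
  · obtain ⟨i, hi⟩ := h
    obtain ⟨j, hj⟩ := hi.exists_opposite
    rw [hsingle hkl hi, hsingle hkl.symm (shares_of_opposite hj), netflow_opposite w hkl hj,
      neg_neg]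
  · have h1 : M.exchange w k l = 0 :=
      Finset.sum_eq_zero fun i _ => if_neg fun hi => h ⟨i, hi⟩
    have h2 : M.exchange w l k = 0 := by
      refine Finset.sum_eq_zero fun j _ => if_neg fun hj => h ?_
      obtain ⟨i, hi⟩ := hj.exists_opposite
      exact ⟨i, shares_of_opposite hi⟩
    rw [h1, h2, neg_zero]

/-- A facet is shared with exactly one other element or lies on the boundary, where the velocity
vanishes. The sum over neighbours is thus the sum over facets, zero by the divergence theorem. -/
lemma sum_exchange {w : M.Vel} (hw : w ∈ M.solenoidal) (k : Fin M.N) :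
    ∑ l, (if l = k then 0 else M.exchange w k l) = 0 := by
  classical
  refine Eq.trans ?_ (sum_netflow hw k)
  have h1 : ∀ l, (if l = k then 0 else M.exchange w k l) =
      ∑ i, if l ≠ k ∧ M.Shares k i l then M.netflow w k i else 0 := by
    intro l
    by_cases h : l = k
    · simp [h]
    · simp [h, exchange]
  simp only [h1]
  rw [Finset.sum_comm]
  refine Finset.sum_congr rfl fun i _ => ?_
  by_cases h : ∃ l, l ≠ k ∧ M.Shares k i l
  · obtain ⟨l, hl, hs⟩ := h
    rw [Finset.sum_eq_single l, if_pos ⟨hl, hs⟩]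
    · intro l' _ hne
      exact if_neg fun h' => hne (h'.2.unique h'.1 hl hs)
    · simp
  · push Not at h
    rw [Finset.sum_eq_zero fun l _ => if_neg fun h' => h l h'.1 h'.2]
    refine (setIntegral_eq_zero_of_forall_eq_zero fun x hx => ?_).symm
    rw [eq_zero_of_mem_boundary_facet h w hx, inner_zero_left]

open scoped Classical in
variable (M) in
/-- The flow of the velocity from an element to another one. -/
def upwindFlux (w : M.Vel) (k l : Fin M.N) : ℝ :=
  -- An internal edge is listed once, as a facet of the element of smaller index. Both directions
  -- are measured on that facet: outflow from the smaller index, inflow from the larger.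
  if k < l then ∑ i, if M.Shares k i l then M.outflow w k i else 0
  else if l < k then ∑ i, if M.Shares l i k then M.inflow w l i else 0
  else 0

lemma upwindFlux_sub (w : M.Vel) (k l : Fin M.N) :
    M.upwindFlux w k l - M.upwindFlux w l k = if l = k then 0 else M.exchange w k l := by
  have key : ∀ k l : Fin M.N, k < l →
      M.upwindFlux w k l - M.upwindFlux w l k = M.exchange w k l := by
    intro k l h
    rw [upwindFlux, upwindFlux, if_pos h, if_neg h.not_gt, if_pos h, ← Finset.sum_sub_distrib]
    refine Finset.sum_congr rfl fun i _ => ?_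
    split_ifs
    · exact outflow_sub_inflow w k i
    · exact sub_zero 0
  rcases lt_trichotomy k l with h | h | h
  · rw [key k l h, if_neg h.ne']
  · rw [h, sub_self, if_pos rfl]
  · rw [← neg_sub, key l k h, if_neg h.ne, exchange_antisymm w h.ne, neg_neg]

lemma upwindFlux_nonneg (w : M.Vel) (k l : Fin M.N) : 0 ≤ M.upwindFlux w k l := by
  rw [upwindFlux]
  split_ifs
  · exact Finset.sum_nonneg fun i _ => by split_ifs <;> [exact outflow_nonneg w k i; exact le_rfl]
  · exact Finset.sum_nonneg fun i _ => by split_ifs <;> [exact inflow_nonneg w l i; exact le_rfl]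
  · exact le_rfl

variable (M) in
/-- The discontinuous Galerkin method. -/
def galerkin : Transport M.forms where
  old _ _ k l := if k = l then M.vol k else 0
  flux w _ k l := M.upwindFlux w k l
  old_nonneg w t k l := by
    split_ifs
    · exact (M.vol_pos k).le
    · exact le_rfl
  old_row w t k := by
    rw [Finset.sum_ite_eq, if_pos (Finset.mem_univ k)]; exact le_rfl
  old_col w hw t _ l := by
    rw [Finset.sum_ite_eq', if_pos (Finset.mem_univ l)]; exact le_rfl
  flux_nonneg w t k l := upwindFlux_nonneg w k l
  flux_bound := by
    obtain ⟨C, h0, hC⟩ := exists_flow_bound (M := M)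
    have hsum : ∀ (w : M.Vel) (f : Fin (d + 1) → ℝ), (∀ i, f i ≤ C * ‖w‖) →
        ∑ i, f i ≤ (d + 1) * C * ‖w‖ := by
      intro w f hf
      refine (Finset.sum_le_sum fun i _ => hf i).trans_eq ?_
      simp [mul_assoc]
    have hw0 : ∀ w : M.Vel, 0 ≤ C * ‖w‖ := fun w => by positivity
    refine ⟨(d + 1) * C, fun w t k l => ?_⟩
    rw [upwindFlux]
    split_ifs
    · exact hsum w _ fun i => by split_ifs <;> [exact (hC w k i).1; exact hw0 w]
    · exact hsum w _ fun i => by split_ifs <;> [exact (hC w l i).2; exact hw0 w]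
    · positivity
  flux_balance w hw t k := by
    have := sum_exchange hw k
    simp only [← upwindFlux_sub, Finset.sum_sub_distrib] at this
    linarith

/-- Split `|u · n|` into positive and negative parts; the sign decides which element is downstream.
Where `u · n = 0` the convention is harmless, since the weight is zero. -/
lemma jump_facet (w : M.Vel) (ψ φ : Fin M.N → Mat d) (k l : Fin M.N) (i : Fin (d + 1)) :
    ∫ x in M.facet k i, |inner ℝ (M.fn w x) (M.normal k i)| *
        ddot (M.downstream ψ k l (M.normal k i) (M.fn w x) -
            M.upstream ψ k l (M.normal k i) (M.fn w x))
          (M.downstream φ k l (M.normal k i) (M.fn w x)) ∂(μHE[d - 1]) =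
      M.outflow w k i * ddot (ψ l - ψ k) (φ l) + M.inflow w k i * ddot (ψ k - ψ l) (φ k) := by
  have hc := continuous_inner_normal w k i
  have h1 : Continuous fun x => max (inner ℝ (M.fn w x) (M.normal k i)) 0 * ddot (ψ l - ψ k) (φ l) :=
    (hc.max continuous_const).mul continuous_const
  have h2 : Continuous fun x => max (-inner ℝ (M.fn w x) (M.normal k i)) 0 *
      ddot (ψ k - ψ l) (φ k) := (hc.neg.max continuous_const).mul continuous_const
  rw [outflow, inflow, ← integral_mul_const, ← integral_mul_const,
    ← integral_add (integrableOn_facet k i h1) (integrableOn_facet k i h2)]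
  refine integral_congr_ae (ae_of_all _ fun x => ?_)
  beta_reduce
  rw [downstream, upstream, downstream]
  by_cases h : 0 ≤ inner ℝ (M.fn w x) (M.normal k i)
  · rw [if_pos h, if_pos h, if_pos h, abs_of_nonneg h, max_eq_left h, max_eq_right (by linarith)]
    ring
  · have h' := (not_le.1 h).le
    rw [if_neg h, if_neg h, if_neg h, abs_of_nonpos h', max_eq_right h', max_eq_left (by linarith)]
    ring

lemma sum_sum_eq_sum_lt {n : ℕ} (T : Fin n → Fin n → ℝ) (h : ∀ k, T k k = 0) :
    ∑ k, ∑ l, T k l = ∑ k, ∑ l, if k < l then T k l + T l k else 0 := by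
  have h1 : ∀ k l, T k l = (if k < l then T k l else 0) + (if l < k then T k l else 0) := by
    intro k l
    rcases lt_trichotomy k l with hkl | hkl | hkl
    · simp [hkl, hkl.not_gt]
    · simp [hkl, h]
    · simp [hkl, hkl.not_gt]
  have h2 : ∑ k, ∑ l, (if l < k then T k l else 0) = ∑ k, ∑ l, (if k < l then T l k else 0) :=
    Finset.sum_comm
  calc ∑ k, ∑ l, T k l
      = ∑ k, ∑ l, ((if k < l then T k l else 0) + (if l < k then T k l else 0)) := by
        simp only [← h1]
    _ = ∑ k, ∑ l, (if k < l then T k l else 0) + ∑ k, ∑ l, (if k < l then T l k else 0) := by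
        simp only [Finset.sum_add_distrib, h2]
    _ = _ := by
        simp only [← Finset.sum_add_distrib]
        refine Finset.sum_congr rfl fun k _ => Finset.sum_congr rfl fun l _ => ?_
        split_ifs <;> simp

/-- The double sum over elements is folded onto pairs `k < l`, the way edges are listed; each edge
then gives one flux term in each direction. -/
lemma jumpTerm_eq (w : M.Vel) (ψ φ : Fin M.N → Mat d) :
    M.jumpTerm (M.fn w) ψ φ = ∑ k, ddot (∑ l, M.upwindFlux w l k • (ψ k - ψ l)) (φ k) := by
  classical
  simp only [ddot_sum_left, ddot_smul_left]
  rw [sum_sum_eq_sum_lt _ fun k => by rw [sub_self, ddot_zero_left, mul_zero]]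
  rw [jumpTerm, internalEdges, Finset.sum_filter, Fintype.sum_prod_type]
  refine Finset.sum_congr rfl fun k _ => ?_
  rw [Fintype.sum_prod_type, Finset.sum_comm]
  refine Finset.sum_congr rfl fun l _ => ?_
  by_cases hkl : k < l
  · rw [if_pos hkl, upwindFlux, upwindFlux, if_neg hkl.not_gt, if_pos hkl, if_pos hkl,
      Finset.sum_mul, Finset.sum_mul, ← Finset.sum_add_distrib]
    refine Finset.sum_congr rfl fun i _ => ?_
    by_cases hs : M.Shares k i l
    · rw [if_pos ⟨hkl, hs⟩, if_pos hs, if_pos hs, jump_facet]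
      ring
    · rw [if_neg fun h => hs h.2, if_neg hs, if_neg hs, zero_mul, zero_mul, add_zero]
  · rw [if_neg hkl]
    exact Finset.sum_eq_zero fun i _ => if_neg fun h => hkl h.1

/-- The discontinuous Galerkin scheme, integrated over the elements. -/
lemma sum_integral_galerkin {h : E d → ℝ} (hh : M.Nice h) (w : M.Vel) (t : ℝ)
    (ψ ψ' φ : Fin M.N → Mat d) :
    (∑ k, ∫ x in M.elem k, (h x + ddot (t⁻¹ • (M.p0 ψ' x - M.p0 ψ x)) (M.p0 φ x)))
      + M.jumpTerm (M.fn w) ψ' φ =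
      M.sumInt h + ∑ k, ddot (t⁻¹ • (M.vol k • ψ' k - ∑ l, M.galerkin.old w t k l • ψ l)
        + ∑ l, M.galerkin.flux w t l k • (ψ' k - ψ' l)) (φ k) := by
  obtain ⟨n1, i1⟩ := sumInt_cellwise_const
    (f := fun x => ddot (t⁻¹ • (M.p0 ψ' x - M.p0 ψ x)) (M.p0 φ x))
    (fun k => ddot (t⁻¹ • (ψ' k - ψ k)) (φ k)) fun k x hx => by
      simp only [M.p0_apply _ hx]
  have h1 : (∑ k, ∫ x in M.elem k, (h x + ddot (t⁻¹ • (M.p0 ψ' x - M.p0 ψ x)) (M.p0 φ x))) =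
      M.sumInt fun x => h x + ddot (t⁻¹ • (M.p0 ψ' x - M.p0 ψ x)) (M.p0 φ x) :=
    Finset.sum_congr rfl fun k _ => setIntegral_congr_set (M.elem_ae_eq k)
  rw [h1, sumInt_add hh n1, i1, jumpTerm_eq, add_assoc, ← Finset.sum_add_distrib]
  congr 1
  refine Finset.sum_congr rfl fun k _ => ?_
  have h2 : ∑ l, M.galerkin.old w t k l • ψ l = M.vol k • ψ k := by
    simp [galerkin]
  rw [h2, ddot_add_left, ← smul_sub, ddot_smul_left, ddot_smul_left, ddot_smul_left]
  change _ + _ = _ + ddot (∑ l, M.upwindFlux w l k • (ψ' k - ψ' l)) (φ k)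
  ring

lemma dgStep_iff (P : Params) (t : ℝ) (Y Y' : M.Vel × (Fin M.N → Mat d)) :
    M.DGStep P.Re P.Wi P.ε t (M.fn Y.1, Y.2) (M.fn Y'.1, Y'.2) ↔
      M.WeakStep M.galerkin P t Y Y' := by
  constructor
  · rintro ⟨hY', p', Ω, B, N, hdec, h⟩
    refine ⟨hY'.2, p', Ω, B, N, hdec, fun v q φ hφ => ?_⟩
    rw [h (M.fn v) (fn_mem v) q φ hφ]
    exact sum_integral_galerkin (sumInt_integrand Y.1 Y'.1 v p' q hY'.2 hdec).1 Y.1 t _ _ _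
  · rintro ⟨hψ', p', Ω, B, N, hdec, h⟩
    refine ⟨⟨fn_mem _, hψ'⟩, p', Ω, B, N, hdec, fun v hv q φ hφ => ?_⟩
    obtain ⟨v, rfl⟩ := exists_fn hv
    rw [h v q φ hφ]
    exact (sum_integral_galerkin (sumInt_integrand Y.1 Y'.1 v p' q hψ' hdec).1 Y.1 t _ _ _).symm

/-- Well-posedness of a scheme which amounts to a transport discretization. -/
lemma exists_sequence_of_iff (T : Transport M.forms) (P : Params)
    {S : ℝ → ℕ → M.State → M.State → Prop}
    (hmem : ∀ t n Y Y', S t n Y Y' → Y' ∈ M.stateSpace)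
    (hS : ∀ t n, 0 < t → ∀ Y Y' : M.Vel × (Fin M.N → Mat d),
      S t n (M.fn Y.1, Y.2) (M.fn Y'.1, Y'.2) ↔ M.WeakStep T P t Y Y')
    {Y₀ : M.State} (hY₀ : Y₀ ∈ M.stateSpace) :
    ∃ c₁ : ℝ, 0 < c₁ ∧ ∀ t : ℝ, 0 < t → t < c₁ →
      ∃ Y : ℕ → M.State, Y 0 = Y₀ ∧ ∀ n : ℕ, S t n (Y n) (Y (n + 1)) ∧
        ∀ Z : M.State, S t n (Y n) Z → Z = Y (n + 1) := by
  obtain ⟨u₀, ψ₀⟩ := Y₀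
  obtain ⟨u₀, rfl⟩ := exists_fn hY₀.1
  obtain ⟨c, hc, h⟩ := T.exists_sequence P (u₀, ψ₀) hY₀.2
  refine ⟨c, hc, fun t ht htc => ?_⟩
  obtain ⟨Y, hY0, hY⟩ := h t ht htc
  have hsymm : ∀ n k, ((Y n).2 k).IsSymm := by
    intro n
    cases n with
    | zero => rw [hY0]; exact hY₀.2
    | succ n => exact (hY n).1.symm
  refine ⟨fun n => (M.fn (Y n).1, (Y n).2), by beta_reduce; rw [hY0], fun n => ⟨?_, ?_⟩⟩
  · exact (hS t n ht _ _).2 ((weakStep_iff T P t (hsymm n)).2 (hY n).1)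
  · rintro ⟨u, ψ⟩ hZ
    obtain ⟨u, rfl⟩ := exists_fn (hmem _ _ _ _ hZ).1
    have := (hY n).2 (u, ψ) ((weakStep_iff T P t (hsymm n)).1 ((hS t n ht _ (u, ψ)).1 hZ))
    beta_reduce
    rw [← this]

end Mesh
end OldroydLog
end


/-! ### The theorem for both schemes -/

theorem mainTheorem9 (d : ℕ) [NeZero d] (hd : d = 2 ∨ d = 3) (M : OldroydLog.Mesh d)
    (Re Wi ε : ℝ) (hRe : 0 ≤ Re) (hWi : 0 < Wi) (hε₀ : 0 < ε) (hε₁ : ε < 1)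
    (Y₀ : M.State) (hY₀ : Y₀ ∈ M.stateSpace) :
    (∃ c₁ : ℝ, 0 < c₁ ∧ ∀ Δt : ℝ, 0 < Δt → Δt < c₁ →
      ∃ Y : ℕ → M.State, Y 0 = Y₀ ∧
        ∀ n : ℕ, M.CharacStep Re Wi ε Δt n (Y n) (Y (n + 1)) ∧
          ∀ Z : M.State, M.CharacStep Re Wi ε Δt n (Y n) Z → Z = Y (n + 1)) ∧
    (∃ c₁ : ℝ, 0 < c₁ ∧ ∀ Δt : ℝ, 0 < Δt → Δt < c₁ →
      ∃ Y : ℕ → M.State, Y 0 = Y₀ ∧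
        ∀ n : ℕ, M.DGStep Re Wi ε Δt (Y n) (Y (n + 1)) ∧
          ∀ Z : M.State, M.DGStep Re Wi ε Δt (Y n) Z → Z = Y (n + 1)) := by
  let P : OldroydLog.Params := ⟨Re, Wi, ε, hRe, hWi, hε₀, hε₁⟩
  constructor
  · exact OldroydLog.Mesh.exists_sequence_of_iff M.characteristics P
      (S := fun t n => M.CharacStep Re Wi ε t n) (fun _ _ _ _ h => h.1)
      (fun _ n ht Y Y' => OldroydLog.Mesh.characStep_iff P ht n Y Y') hY₀
  · exact OldroydLog.Mesh.exists_sequence_of_iff M.galerkin P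
      (S := fun t _ => M.DGStep Re Wi ε t) (fun _ _ _ _ h => h.1)
      (fun t _ _ Y Y' => OldroydLog.Mesh.dgStep_iff P t Y Y') hY₀
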